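/- **Setting.** Fix integers $N_T\ge 1$, $K\ge 1$, $1\le k\le K$ and reals $f_D,T,E_P,E_C,\sigma>0$, pilot symbols $p_n\in\mathbb C$ with $|p_n|=1$, and put $\gamma_P=E_P/\sigma^2$, $\gamma_C=E_C/\sigma^2$. For $1\le t\le N_T$ and $r\ge 1$ let $(h_{t,r}(m))_m$ be circularly symmetric complex Gaussian processes with mean zero and $\mathrm E[h_{t,r}(m)\overline{h_{t,r}(n)}]=\rho(m,n):=J_0(2\pi f_D|m-n|T)$, where $J_0$ is the zeroth-order Bessel function of the first kind, and for each $r$ let $(z_r(m))_m$ be white circularly symmetric complex Gaussian noise of variance $\sigma^2$; all these processes are independent and live on one probability space. For $n=1,\dots,N$ let $i_{t,n}=t+(n-1)(N_T+K)$ (pilot times) and $k_n=N_T+k+(n-1)(N_T+K)$ (data times). Let $R_P=(\rho(i_{t,n},i_{t,m}))_{n,m}$, $R_k=(\rho(k_n,k_m))_{n,m}$, $R_{P,t,k}=(\rho(k_n,i_{t,m}))_{n,m}$, $X_P=\mathrm{diag}(p_1,\dots,p_N)$, and, from the received pilots $y_{t,r}=\sqrt{E_P}\,X_P\,(h_{t,r}(i_{t,n}))_n+(z_r(i_{t,n}))_n$,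 form the MMSE channel estimates $$\hat h_{t,r,k}=\sqrt{E_P}\,R_{P,t,k}X_P^{H}\left(E_PX_PR_PX_P^{H}+\sigma^2I_N\right)^{-1}y_{t,r},$$ stacked over the receive antennas $r=1,\dots,N_R$ into $\hat h_{t,k}\in\mathbb C^{NN_R}$. Let $\tilde R_{t,k}=R_k-R_{P,t,k}(R_P+\gamma_P^{-1}I_N)^{-1}R_{P,t,k}^{H}$, $W=\sum_{t=1}^{N_T}\tilde R_{t,k}+\gamma_C^{-1}I_N$ and $\breve h_{t,k}=(I_{N_R}\otimes W^{-1/2})\hat h_{t,k}$. Let $\hat H_{[t],k}$ and $\breve H_{[t],k}$ be the matrices with the columns $\hat h_{l,k}$, respectively $\breve h_{l,k}$, $l\ne t$. The MMSE output SINR and the normalized achievable sum rate are $$\gamma_{\mathrm{MMSE},t,k}=\hat h_{t,k}^{H}\left(\hat H_{[t],k}\hat H_{[t],k}^{H}+I_{N_R}\otimes W\right)^{-1}\hat h_{t,k},\qquad R_{\mathrm{MMSE},k}=\frac1N\sum_{t=1}^{N_T}\log_2\left(1+\gamma_{\mathrm{MMSE},t,k}\right).$$ Put $\Phi_l=\mathrm{cov}(\breve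 h_{l,k},\breve h_{l,k})$, $Q_{t,k}=\Phi_t$, $B_{t,k}=\breve H_{[t],k}\breve H_{[t],k}^{H}$ and $m_{B,Q,t,k}=\frac1{NN_R}\mathrm{Tr}\left[Q_{t,k}(B_{t,k}+I)^{-1}\right]$. **Claim.** (i) For all $N,N_R,t$ there is exactly one family $e=(e_l)_{l\ne t}$ of nonnegative reals with $$e_l=\mathrm{Tr}\left(\Phi_lT_{t,k}\right)\quad(l\ne t),\qquad T_{t,k}=T_{t,k}(e)=\Big(\sum_{l\ne t}\frac{\Phi_l}{1+e_l}+I_{NN_R}\Big)^{-1},$$ and the iteration $e\mapsto(\mathrm{Tr}(\Phi_lT_{t,k}(e)))_{l\ne t}$ started at $e=0$ converges to it. (ii) With this solution, as $NN_R\to\infty$ (with all other parameters fixed, $(N,N_R)$ ranging over all pairs), almost surely, for every $t$, $$\frac{\gamma_{\mathrm{MMSE},t,k}}{NN_R}-m_{B,Q,t,k}\to0,\qquad m_{B,Q,t,k}-\frac{\mathrm{Tr}(Q_{t,k}T_{t,k})}{NN_R}\to0,\qquad \frac{\gamma_{\mathrm{MMSE},t,k}}{NN_R}-\frac{\mathrm{Tr}(Q_{t,k}T_{t,k})}{NN_R}\to0,$$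 and $$R_{\mathrm{MMSE},k}-\frac1N\sum_{t=1}^{N_T}\log_2\left(1+\mathrm{Tr}(Q_{t,k}T_{t,k})\right)\to0 .$$ -/

import Mathlib

open MeasureTheory ProbabilityTheory Filter Topology
open scoped Matrix Kronecker ComplexConjugate

noncomputable section

namespace DopplerMIMO

/-- The zeroth-order Bessel function of the first kind, through Bessel's integral. -/
def besselJ0 (x : ℝ) : ℝ :=
  (1 / Real.pi) * ∫ θ in (0 : ℝ)..Real.pi, Real.cos (x * Real.sin θ)

/-- A circularly symmetric (jointly) complex Gaussian process with zero mean and covariance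
function `C i j = E[X i * conj (X j)]`. -/
structure IsCSCGProcess {ι Ω : Type*} [MeasurableSpace Ω] (X : ι → Ω → ℂ) (C : ι → ι → ℂ)
    (P : Measure Ω) : Prop where
  measurable : ∀ i, Measurable (X i)
  gaussian : IsGaussianProcess X P
  mean_zero : ∀ i, ∫ ω, X i ω ∂P = 0
  covariance : ∀ i j, ∫ ω, X i ω * conj (X j ω) ∂P = C i j
  pseudo_covariance : ∀ i j, ∫ ω, X i ω * X j ω ∂P = 0

/-- The covariance matrix `E[(X - E X) (X - E X)ᴴ]` of a complex random vector. -/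
def covMatrix {ι Ω : Type*} [MeasurableSpace Ω] (P : Measure Ω) (X : Ω → ι → ℂ) :
    Matrix ι ι ℂ :=
  Matrix.of fun i j =>
    ∫ ω, (X ω i - ∫ ω', X ω' i ∂P) * conj (X ω j - ∫ ω', X ω' j ∂P) ∂P

/-- The parameters of the system that do not grow. -/
structure Params where
  /-- number of transmit antennas -/
  NT : ℕ
  /-- number of data symbols in a block -/
  K : ℕ
  /-- index of the data symbol under consideration, counted from `1` -/
  k : ℕ
  /-- maximum Doppler spread -/
  fD : ℝ
  /-- symbol interval -/
  T : ℝ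
  /-- energy of a pilot symbol -/
  EP : ℝ
  /-- energy of a data symbol -/
  EC : ℝ
  /-- standard deviation of the noise -/
  sigma : ℝ
  /-- pilot symbols; `pilot n` is the symbol sent in the slot number `n + 1` -/
  pilot : ℕ → ℂ

namespace Params

/-- The ranges of the parameters. Unit modulus of the pilots is `X_P * X_Pᴴ = 1`. -/
structure Valid (S : Params) : Prop where
  one_le_k : 1 ≤ S.k
  k_le_K : S.k ≤ S.K
  fD_pos : 0 < S.fD
  T_pos : 0 < S.T
  EP_pos : 0 < S.EP
  EC_pos : 0 < S.EC
  sigma_pos : 0 < S.sigma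
  pilot_unit : ∀ n, ‖S.pilot n‖ = 1

variable (S : Params)

/-- Pilot signal-to-noise ratio. -/
def gammaP : ℝ := S.EP / S.sigma ^ 2

/-- Data signal-to-noise ratio. -/
def gammaC : ℝ := S.EC / S.sigma ^ 2

/-- `E[h (m) * conj (h (n))]` for the channel between any pair of antennas. -/
def rho (m n : ℕ) : ℝ := besselJ0 (2 * Real.pi * S.fD * |(m : ℝ) - (n : ℝ)| * S.T)

/-- Time index of the pilot of transmit antenna `t` in slot `n`. Here `t` and `n` are counted
from `0`, the time indices from `1`. -/
def pilotTime (t : Fin S.NT) (n : ℕ) : ℕ := (t : ℕ) + 1 + n * (S.NT + S.K)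

/-- Time index of the data symbol under consideration in slot `n` (counted from `0`). -/
def dataTime (n : ℕ) : ℕ := S.NT + S.k + n * (S.NT + S.K)

/-- A Rayleigh fading channel with Jakes' correlation and white Gaussian noise: `h t r m` is the
coefficient between transmit antenna `t` and receive antenna `r` at time `m`, and `z r m` is the
noise at receive antenna `r` at time `m`. The channels between the antenna pairs and the noises at
the receive antennas are mutually independent. -/
structure IsChannel {Ω : Type*} [MeasurableSpace Ω] (P : Measure Ω)
    (h : Fin S.NT → ℕ → ℕ → Ω → ℂ) (z : ℕ → ℕ → Ω → ℂ) : Prop where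
  channel : ∀ t r, IsCSCGProcess (h t r) (fun m n => (S.rho m n : ℂ)) P
  noise : ∀ r, IsCSCGProcess (z r) (fun m n => if m = n then (S.sigma : ℂ) ^ 2 else 0) P
  indep : iIndepFun
    (Sum.elim (fun (p : Fin S.NT × ℕ) (ω : Ω) (m : ℕ) => h p.1 p.2 m ω)
      (fun (r : ℕ) (ω : Ω) (m : ℕ) => z r m ω)) P

section Deterministic

variable (N : ℕ)

/-- `R_P`, the covariance matrix of the channel at the pilot times. -/
def RP : Matrix (Fin N) (Fin N) ℂ :=
  Matrix.of fun n m => (besselJ0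
    (2 * Real.pi * S.fD * |(n : ℝ) - (m : ℝ)| * (((S.NT : ℝ) + S.K) * S.T)) : ℂ)

/-- `R_k`, the covariance matrix of the channel at the data times. -/
def Rk : Matrix (Fin N) (Fin N) ℂ :=
  Matrix.of fun n m => (S.rho (S.dataTime n) (S.dataTime m) : ℂ)

/-- `R_{P,t,k}`, the cross covariance of the channel at the data times and the pilot times. -/
def RPtk (t : Fin S.NT) : Matrix (Fin N) (Fin N) ℂ :=
  Matrix.of fun n m => (S.rho (S.dataTime n) (S.pilotTime t m) : ℂ)

/-- The covariance matrix of the channel estimation error. -/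
def Rtilde (t : Fin S.NT) : Matrix (Fin N) (Fin N) ℂ :=
  S.Rk N - S.RPtk N t * (S.RP N + ((1 / S.gammaP : ℝ) : ℂ) • 1)⁻¹ * (S.RPtk N t)ᴴ

/-- `∑ t, Rtilde t + (1 / γ_C) I`. -/
def W : Matrix (Fin N) (Fin N) ℂ :=
  (∑ t, S.Rtilde N t) + ((1 / S.gammaC : ℝ) : ℂ) • 1

/-- The inverse square root of `W`. -/
def WInvSqrt : Matrix (Fin N) (Fin N) ℂ := cfc (fun x : ℝ => (Real.sqrt x)⁻¹) (S.W N)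

/-- The diagonal matrix `X_P` of the pilots. -/
def XP : Matrix (Fin N) (Fin N) ℂ := Matrix.diagonal fun n => S.pilot n

end Deterministic

section Random

variable {Ω : Type*} (h : Fin S.NT → ℕ → ℕ → Ω → ℂ) (z : ℕ → ℕ → Ω → ℂ)

/-- Received pilot signal `y_{P,t,r} = √E_P X_P h_{P,t,r} + z_{P,t,r}`. -/
def yP (N : ℕ) (t : Fin S.NT) (r : ℕ) (ω : Ω) : Fin N → ℂ :=
  (Real.sqrt S.EP : ℂ) • (S.XP N *ᵥ fun n : Fin N => h t r (S.pilotTime t n) ω)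
    + fun n : Fin N => z r (S.pilotTime t n) ω

/-- The MMSE estimate of the vector `(h_{t,r}(k_n))_n` from the received pilots. -/
def hHatR (N : ℕ) (t : Fin S.NT) (r : ℕ) (ω : Ω) : Fin N → ℂ :=
  ((Real.sqrt S.EP : ℂ) • (S.RPtk N t * (S.XP N)ᴴ *
    ((S.EP : ℂ) • (S.XP N * S.RP N * (S.XP N)ᴴ) + (S.sigma : ℂ) ^ 2 • 1)⁻¹)) *ᵥ S.yP h z N t r ω

/-- The `t`-th column of the estimated channel matrix: the estimates of all `NR` receive antennas
stacked. -/
def hHat (N NR : ℕ) (t : Fin S.NT) (ω : Ω) : Fin NR × Fin N → ℂ :=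
  fun i => S.hHatR h z N t i.1 ω i.2

/-- The whitened `t`-th column `[I ⊗ W^{-1/2}] hHat`. -/
def hBreve (N NR : ℕ) (t : Fin S.NT) (ω : Ω) : Fin NR × Fin N → ℂ :=
  ((1 : Matrix (Fin NR) (Fin NR) ℂ) ⊗ₖ S.WInvSqrt N) *ᵥ S.hHat h z N NR t ω

/-- The estimated channel matrix without its `t`-th column. -/
def HHatMinus (N NR : ℕ) (t : Fin S.NT) (ω : Ω) :
    Matrix (Fin NR × Fin N) {l : Fin S.NT // l ≠ t} ℂ :=
  Matrix.of fun i l => S.hHat h z N NR l ω i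

/-- The whitened estimated channel matrix without its `t`-th column. -/
def HBreveMinus (N NR : ℕ) (t : Fin S.NT) (ω : Ω) :
    Matrix (Fin NR × Fin N) {l : Fin S.NT // l ≠ t} ℂ :=
  Matrix.of fun i l => S.hBreve h z N NR l ω i

/-- The output SINR of the MMSE receiver,
`hHat_tᴴ (HHat_[t] HHat_[t]ᴴ + I ⊗ W)⁻¹ hHat_t` (a real number). -/
def gammaMMSE (N NR : ℕ) (t : Fin S.NT) (ω : Ω) : ℝ :=
  (star (S.hHat h z N NR t ω) ⬝ᵥ
    ((S.HHatMinus h z N NR t ω * (S.HHatMinus h z N NR t ω)ᴴ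
      + (1 : Matrix (Fin NR) (Fin NR) ℂ) ⊗ₖ S.W N)⁻¹ *ᵥ S.hHat h z N NR t ω)).re

/-- The normalized achievable sum rate of the MMSE receiver. -/
def rateMMSE (N NR : ℕ) (ω : Ω) : ℝ :=
  (1 / (N : ℝ)) * ∑ t, Real.logb 2 (1 + S.gammaMMSE h z N NR t ω)

variable [MeasurableSpace Ω] (P : Measure Ω)

/-- `Phi l = cov(hBreve_l, hBreve_l)`; for `l = t` this is `Q_t`. -/
def Phi (N NR : ℕ) (l : Fin S.NT) : Matrix (Fin NR × Fin N) (Fin NR × Fin N) ℂ :=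
  covMatrix P (S.hBreve h z N NR l)

/-- `Tr(Q_t (B_t + I)⁻¹) / (N NR)` with `B_t = HBreve_[t] HBreve_[t]ᴴ`. -/
def mBQ (N NR : ℕ) (t : Fin S.NT) (ω : Ω) : ℝ :=
  (1 / ((N : ℝ) * NR)) * (Matrix.trace (S.Phi h z P N NR t *
    (S.HBreveMinus h z N NR t ω * (S.HBreveMinus h z N NR t ω)ᴴ + 1)⁻¹)).re

/-- `T_t(e) = (∑_{l ≠ t} Phi_l / (1 + e_l) + I)⁻¹`. -/
def TMat (N NR : ℕ) (t : Fin S.NT) (e : {l : Fin S.NT // l ≠ t} → ℝ) :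
    Matrix (Fin NR × Fin N) (Fin NR × Fin N) ℂ :=
  ((∑ l : {l : Fin S.NT // l ≠ t}, ((1 + e l : ℝ) : ℂ)⁻¹ • S.Phi h z P N NR l) + 1)⁻¹

/-- `e` is a nonnegative solution of the equations `e_l = Tr(Phi_l T_t(e))`, `l ≠ t`. -/
def IsFixedPoint (N NR : ℕ) (t : Fin S.NT) (e : {l : Fin S.NT // l ≠ t} → ℝ) : Prop :=
  ∀ l, 0 ≤ e l ∧ (e l : ℂ) = Matrix.trace (S.Phi h z P N NR l * S.TMat h z P N NR t e)

/-- One step `e ↦ (Tr(Phi_l T_t(e)))_l` of the iterative computation of the solution. -/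
def fixedPointStep (N NR : ℕ) (t : Fin S.NT) (e : {l : Fin S.NT // l ≠ t} → ℝ) :
    {l : Fin S.NT // l ≠ t} → ℝ :=
  fun l => (Matrix.trace (S.Phi h z P N NR l * S.TMat h z P N NR t e)).re

/-- `Tr(Q_t T_t(e))` (a real number). -/
def trQT (N NR : ℕ) (t : Fin S.NT) (e : {l : Fin S.NT // l ≠ t} → ℝ) : ℝ :=
  (Matrix.trace (S.Phi h z P N NR t * S.TMat h z P N NR t e)).re

end Random

end Params

/-- The regime `N * NR → ∞` for pairs `(N, NR)`. -/
def prodAtTop : Filter (ℕ × ℕ) := comap (fun p : ℕ × ℕ => p.1 * p.2) atTop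

end DopplerMIMO

end

/-! The number of transmit antennas stays fixed while the dimension `N * NR` grows, so the
interference has bounded rank. Write `Q` for the covariance of the whitened desired column and `G =
(B + 1)⁻¹` for the interference resolvent. The matrix `1 - G` is a positive semidefinite
contraction, and its trace is at most the number of interferers (`trace_one_sub_resolvent_le`). The
same holds for `1 - T` at a fixed point: there `1 - T = ∑ l, Φ l T / (1 + e l)` has trace `∑ l, e l
/ (1 + e l)` (`trace_one_sub_resolventSum_le`). By Cauchy-Schwarz for traces, `Tr (Q G)` and `Tr (Q
T)` both lie in the interval from `Tr Q - √(NT * Tr Q²)` to `Tr Q`. The two are thus compared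
deterministically, without any random matrix limit theorem.

It remains to see that `Tr Q²` is small against `(N * NR)²`. Whitening costs at most a factor
`γ_C²`, the estimate covariance lies below the Jakes matrix `R_k`, and `J₀(x)² ≤ 9 / x`. Hence `Tr
Q² = O(NR * N * log N)`, which is bounded by a multiple of `NR * N ^ (5 / 4)`.

The SINR itself is a quadratic form `xᴴ G x` in a circularly symmetric Gaussian vector `x`
independent of `G`. Diagonalization turns it into a sum of independent squared moduli, so its
centered fourth moment is at most a constant times `(Tr Q²)²`. Divided by `(N * NR)⁴`, this is
summable over all pairs, and a Borel-Cantelli argument gives almost sure convergence in the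
two-parameter regime.

The rate needs more, because the factor `1 / N` does not decay when only `NR` grows. If `NR ≤ N²`,
both logarithms are `O(log N)` and the factor `1 / N` suffices. If `N² < NR`, the error is small
relative to `Tr Q`, since `Tr Q² ≤ (Tr Q)² / NR` by the block structure, and a small relative error
moves the logarithm little.

Part (i) rests on the map `e ↦ Tr (Φ l T(e))` being monotone, bounded and strictly subhomogeneous:
its iterates from `0` increase to a fixed point, and two fixed points cannot differ. -/

namespace DopplerMIMO

open scoped ComplexOrder

set_option linter.unusedSectionVars false

/-! ### Traces, the Loewner order and resolvents -/

section MatrixLemmas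

variable {n m : Type*} [Fintype n] [Fintype m] [DecidableEq n] [DecidableEq m]

open scoped MatrixOrder in
theorem exists_conjTranspose_mul_self {A : Matrix n n ℂ} (hA : A.PosSemidef) :
    ∃ L : Matrix n n ℂ, A = Lᴴ * L := by
  refine ⟨CFC.sqrt A, ?_⟩
  have h : (CFC.sqrt A)ᴴ = CFC.sqrt A := (Matrix.nonneg_iff_posSemidef.1 (CFC.sqrt_nonneg A)).1
  rw [h, CFC.sqrt_mul_sqrt_self A hA.nonneg]

/-- With `B = Lᴴ L`, cyclicity turns the trace into that of the congruence `L A Lᴴ`. -/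
theorem trace_mul_nonneg {A B : Matrix n n ℂ} (hA : A.PosSemidef) (hB : B.PosSemidef) :
    0 ≤ (A * B).trace := by
  obtain ⟨L, rfl⟩ := exists_conjTranspose_mul_self hB
  rw [← mul_assoc, Matrix.trace_mul_comm, ← mul_assoc]
  exact (hA.mul_mul_conjTranspose_same L).trace_nonneg

theorem trace_mul_re_nonneg {A B : Matrix n n ℂ} (hA : A.PosSemidef) (hB : B.PosSemidef) :
    0 ≤ (A * B).trace.re :=
  (Complex.nonneg_iff.1 (trace_mul_nonneg hA hB)).1

theorem ofReal_trace_mul_re {A B : Matrix n n ℂ} (hA : A.PosSemidef) (hB : B.PosSemidef) :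
    ((A * B).trace.re : ℂ) = (A * B).trace := by
  have h := Complex.nonneg_iff.1 (trace_mul_nonneg hA hB)
  exact Complex.ext (by simp) (by simpa using h.2)

theorem trace_mul_re_mono {A B C : Matrix n n ℂ} (hA : A.PosSemidef) (hBC : (C - B).PosSemidef) :
    (A * B).trace.re ≤ (A * C).trace.re := by
  have h := trace_mul_re_nonneg hA hBC
  rw [mul_sub, Matrix.trace_sub, Complex.sub_re] at h
  linarith

/-- With `A = Lᴴ L`, a vanishing trace would force the positive semidefinite matrix `L B Lᴴ` to be
zero, and definiteness of `B` then kills every column of `Lᴴ`. This strictness drives uniqueness of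
the fixed point. -/
theorem trace_mul_re_pos {A B : Matrix n n ℂ} (hA : A.PosSemidef) (hA0 : A ≠ 0)
    (hB : B.PosDef) : 0 < (A * B).trace.re := by
  obtain ⟨L, rfl⟩ := exists_conjTranspose_mul_self hA
  have h0 : (Lᴴ * L * B).trace = (L * B * Lᴴ).trace := by
    rw [mul_assoc, Matrix.trace_mul_comm]
  have hps : (L * B * Lᴴ).PosSemidef := hB.posSemidef.mul_mul_conjTranspose_same L
  rw [h0]
  have hnn := Complex.nonneg_iff.1 hps.trace_nonneg
  refine lt_of_le_of_ne hnn.1 fun h => hA0 ?_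
  have htr : (L * B * Lᴴ).trace = 0 := Complex.ext (by simpa using h.symm) (by simpa using hnn.2.symm)
  rw [hps.trace_eq_zero_iff] at htr
  have hL : L = 0 := by
    by_contra hL
    obtain ⟨i, hi⟩ : ∃ i, Lᴴ *ᵥ Pi.single i 1 ≠ 0 := by
      by_contra hcon
      push Not at hcon
      apply hL
      have : Lᴴ = 0 := by
        ext a i
        have := congrFun (hcon i) a
        simpa using this
      simpa using this
    have h1 := hB.dotProduct_mulVec_pos hi
    have h2 : star (Lᴴ *ᵥ Pi.single i 1) ⬝ᵥ (B *ᵥ (Lᴴ *ᵥ Pi.single i 1))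
        = star (Pi.single i 1 : n → ℂ) ⬝ᵥ ((L * B * Lᴴ) *ᵥ Pi.single i 1) := by
      rw [Matrix.star_mulVec, Matrix.conjTranspose_conjTranspose, ← Matrix.dotProduct_mulVec,
        Matrix.mulVec_mulVec, Matrix.mulVec_mulVec]
    rw [h2, htr] at h1
    simp at h1
  simp [hL]

theorem posDef_of_sub_posSemidef {A B : Matrix n n ℂ} (hA : A.PosDef) (hAB : (B - A).PosSemidef) :
    B.PosDef := by
  simpa using hA.add_posSemidef hAB

/-- The resolvent identity applied twice, arranged symmetrically: both summands are congruences, of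
`B - A` and of `A⁻¹`, so antitonicity of the inverse, weak and strict, can be read off. -/
theorem inv_sub_inv_eq {A B : Matrix n n ℂ} (hA : A.PosDef) (hB : B.PosDef) :
    A⁻¹ - B⁻¹ = B⁻¹ * (B - A) * B⁻¹ + (B⁻¹ * (B - A)) * A⁻¹ * ((B - A) * B⁻¹) := by
  have hAu := (Matrix.isUnit_iff_isUnit_det _).1 hA.isUnit
  have hBu := (Matrix.isUnit_iff_isUnit_det _).1 hB.isUnit
  have h1 : B⁻¹ * (B - A) = 1 - B⁻¹ * A := by rw [mul_sub, Matrix.nonsing_inv_mul _ hBu]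
  have h2 : (B - A) * B⁻¹ = 1 - A * B⁻¹ := by rw [sub_mul, Matrix.mul_nonsing_inv _ hBu]
  have h3 : A⁻¹ * (1 - A * B⁻¹) = A⁻¹ - B⁻¹ := by
    rw [mul_sub, mul_one, ← mul_assoc, Matrix.nonsing_inv_mul _ hAu, one_mul]
  rw [h2, mul_assoc (B⁻¹ * (B - A)), h3, h1, sub_mul, sub_mul, mul_sub (B⁻¹ * A), mul_assoc B⁻¹ A A⁻¹,
    Matrix.mul_nonsing_inv _ hAu]
  simp

theorem inv_sub_inv_posSemidef {A B : Matrix n n ℂ} (hA : A.PosDef) (hAB : (B - A).PosSemidef) :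
    (A⁻¹ - B⁻¹).PosSemidef := by
  have hB := posDef_of_sub_posSemidef hA hAB
  have hBi : (B⁻¹)ᴴ = B⁻¹ := hB.inv.1
  rw [inv_sub_inv_eq hA hB]
  refine Matrix.PosSemidef.add ?_ ?_
  · have := hAB.mul_mul_conjTranspose_same B⁻¹
    rwa [hBi] at this
  · have := hA.inv.posSemidef.mul_mul_conjTranspose_same (B⁻¹ * (B - A))
    rwa [Matrix.conjTranspose_mul, hBi, hAB.1] at this

theorem inv_sub_inv_posDef {A B : Matrix n n ℂ} (hA : A.PosDef) (hAB : (B - A).PosDef) :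
    (A⁻¹ - B⁻¹).PosDef := by
  have hB := posDef_of_sub_posSemidef hA hAB.posSemidef
  have hBi : (B⁻¹)ᴴ = B⁻¹ := hB.inv.1
  rw [inv_sub_inv_eq hA hB]
  refine Matrix.PosDef.add_posSemidef ?_ ?_
  · have h := (Matrix.IsUnit.posDef_star_left_conjugate_iff (x := B - A) hB.inv.isUnit).2 hAB
    rwa [Matrix.star_eq_conjTranspose, hBi] at h
  · have := hA.inv.posSemidef.mul_mul_conjTranspose_same (B⁻¹ * (B - A))
    rwa [Matrix.conjTranspose_mul, hBi, hAB.1] at this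

/-- The resolvent `(M + 1)⁻¹` of a positive semidefinite matrix is at most the identity. -/
theorem one_sub_resolvent_posSemidef {M : Matrix n n ℂ} (hM : M.PosSemidef) :
    (1 - (M + 1)⁻¹).PosSemidef := by
  have h := inv_sub_inv_posSemidef (A := (1 : Matrix n n ℂ)) (B := M + 1) Matrix.PosDef.one
    (by simpa using hM)
  simpa using h

theorem resolvent_posDef {M : Matrix n n ℂ} (hM : M.PosSemidef) : ((M + 1)⁻¹).PosDef :=
  (Matrix.PosDef.one.posSemidef_add hM).inv

theorem resolvent_add_mul {M : Matrix n n ℂ} (hM : M.PosSemidef) :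
    1 - (M + 1)⁻¹ = M * (M + 1)⁻¹ := by
  have hu := (Matrix.isUnit_iff_isUnit_det _).1 (Matrix.PosDef.one.posSemidef_add hM).isUnit
  have h := Matrix.mul_nonsing_inv _ hu
  rw [add_mul, one_mul] at h
  exact sub_eq_of_eq_add h.symm

/-- A quadratic bound: `Tr (Φ A Φ A) ≤ Tr (Φ Φ)` for `0 ≤ A ≤ 1`. -/
theorem trace_mul_mul_mul_le {Φ A : Matrix n n ℂ} (hΦ : Φ.PosSemidef) (hA : A.PosSemidef)
    (hA1 : (1 - A).PosSemidef) : (Φ * A * Φ * A).trace.re ≤ (Φ * Φ).trace.re := by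
  have h1 : (Φ * A * Φ).PosSemidef := by
    have := hA.mul_mul_conjTranspose_same Φ
    rwa [hΦ.1] at this
  have h2 : (Φ * Φ).PosSemidef := by
    have := Matrix.posSemidef_conjTranspose_mul_self Φ
    rwa [hΦ.1] at this
  have h3 := trace_mul_re_mono h1 hA1
  have h4 := trace_mul_re_mono h2 hA1
  rw [mul_one] at h3 h4
  have h5 : (Φ * A * Φ).trace = (Φ * Φ * A).trace := by
    rw [Matrix.trace_mul_comm, ← mul_assoc]
  rw [h5] at h3
  exact h3.trans h4

theorem trace_mul_self_nonneg {Φ : Matrix n n ℂ} (hΦ : Φ.IsHermitian) :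
    0 ≤ (Φ * Φ).trace.re := by
  have := (Complex.nonneg_iff.1 (Matrix.posSemidef_conjTranspose_mul_self Φ).trace_nonneg).1
  rwa [hΦ] at this

/-- Cauchy-Schwarz for the trace against a contraction of small trace. -/
theorem trace_mul_le_sqrt {Φ D : Matrix n n ℂ} (hΦ : Φ.PosSemidef) (hD : D.PosSemidef)
    (hD1 : (1 - D).PosSemidef) {r : ℝ} (hr : D.trace.re ≤ r) :
    (Φ * D).trace.re ≤ Real.sqrt ((Φ * Φ).trace.re * r) := by
  apply Real.le_sqrt_of_sq_le
  have hDD : (D * D).trace.re ≤ r := by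
    have := trace_mul_re_mono hD hD1
    rw [mul_one] at this
    exact this.trans hr
  -- The quadratic polynomial `s ↦ Tr ((s Φ - D)²)` is nonnegative, so its discriminant is not
  -- positive. This is Cauchy-Schwarz; `D² ≤ D` in trace then replaces `Tr D²` by `r`.
  have key : ∀ s : ℝ, 0 ≤ (Φ * Φ).trace.re * (s * s) + (-2 * (Φ * D).trace.re) * s
      + (D * D).trace.re := by
    intro s
    have hH : ((s : ℂ) • Φ - D).IsHermitian := by
      refine Matrix.IsHermitian.sub ?_ hD.1
      rw [Matrix.IsHermitian, Matrix.conjTranspose_smul, hΦ.1]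
      simp
    have h := trace_mul_self_nonneg hH
    have e : (((s : ℂ) • Φ - D) * ((s : ℂ) • Φ - D)).trace
        = (s : ℂ) * s * (Φ * Φ).trace - 2 * s * (Φ * D).trace + (D * D).trace := by
      simp only [sub_mul, mul_sub, Matrix.trace_sub, Matrix.smul_mul, Matrix.mul_smul,
        Matrix.trace_smul, smul_eq_mul, Matrix.trace_mul_comm D Φ]
      ring
    rw [e] at h
    simp only [Complex.add_re, Complex.sub_re, Complex.mul_re, Complex.ofReal_re,
      Complex.ofReal_im, Complex.mul_im, Complex.re_ofNat, Complex.im_ofNat] at h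
    linarith
  have hdisc := discrim_le_zero key
  rw [discrim] at hdisc
  have h0 := trace_mul_self_nonneg hΦ.1
  nlinarith [mul_le_mul_of_nonneg_left hDD h0]

/-- `Tr (1 - (H Hᴴ + 1)⁻¹)` is at most the number of columns of `H`. -/
theorem trace_one_sub_resolvent_le (H : Matrix n m ℂ) :
    (1 - (H * Hᴴ + 1)⁻¹).trace.re ≤ (Fintype.card m : ℝ) := by
  have hA := Matrix.posSemidef_self_mul_conjTranspose H
  have hG := Matrix.posSemidef_conjTranspose_mul_self H
  have hAu := (Matrix.isUnit_iff_isUnit_det _).1 (Matrix.PosDef.one.posSemidef_add hA).isUnit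
  have hGu := (Matrix.isUnit_iff_isUnit_det _).1 (Matrix.PosDef.one.posSemidef_add hG).isUnit
  -- The push-through identity transfers the trace to the Gram matrix `Hᴴ H`, whose size is the
  -- number of columns. There `1 - (Hᴴ H + 1)⁻¹ ≤ 1` has trace at most that number.
  have push : Hᴴ * (H * Hᴴ + 1)⁻¹ = (Hᴴ * H + 1)⁻¹ * Hᴴ := by
    have h1 : (Hᴴ * H + 1) * Hᴴ = Hᴴ * (H * Hᴴ + 1) := by
      rw [Matrix.add_mul, Matrix.mul_add, Matrix.one_mul, Matrix.mul_one, Matrix.mul_assoc]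
    calc Hᴴ * (H * Hᴴ + 1)⁻¹
        = (Hᴴ * H + 1)⁻¹ * ((Hᴴ * H + 1) * Hᴴ) * (H * Hᴴ + 1)⁻¹ := by
          rw [← Matrix.mul_assoc (Hᴴ * H + 1)⁻¹, Matrix.nonsing_inv_mul _ hGu, Matrix.one_mul]
      _ = (Hᴴ * H + 1)⁻¹ * Hᴴ := by
          rw [h1, Matrix.mul_assoc, Matrix.mul_assoc, Matrix.mul_nonsing_inv _ hAu, Matrix.mul_one]
  have e : (1 - (H * Hᴴ + 1)⁻¹).trace = (1 - (Hᴴ * H + 1)⁻¹).trace := by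
    rw [resolvent_add_mul hA, resolvent_add_mul hG, Matrix.mul_assoc, push, Matrix.trace_mul_comm,
      Matrix.mul_assoc, Matrix.trace_mul_comm]
  rw [e, Matrix.trace_sub, Matrix.trace_one, Complex.sub_re]
  have := (Complex.nonneg_iff.1 (resolvent_posDef hG).posSemidef.trace_nonneg).1
  simp only [Complex.natCast_re]
  linarith

end MatrixLemmas

end DopplerMIMO

namespace DopplerMIMO

open scoped ComplexOrder

set_option linter.unusedSectionVars false

/-! ### The fixed-point equation -/

section FixedPoint

variable {ι n : Type*} [Fintype ι] [Fintype n] [DecidableEq n]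

/-- The matrix `(∑ l, Φ l / (1 + e l) + 1)⁻¹`. -/
noncomputable def resolventSum (Φ : ι → Matrix n n ℂ) (e : ι → ℝ) : Matrix n n ℂ :=
  ((∑ l, ((1 + e l : ℝ) : ℂ)⁻¹ • Φ l) + 1)⁻¹

/-- The map `e ↦ Tr (Φ l (∑ j, Φ j / (1 + e j) + 1)⁻¹)`. -/
noncomputable def traceStep (Φ : ι → Matrix n n ℂ) (e : ι → ℝ) : ι → ℝ :=
  fun l => (Φ l * resolventSum Φ e).trace.re

theorem sum_smul_posSemidef {Φ : ι → Matrix n n ℂ} (hΦ : ∀ l, (Φ l).PosSemidef) {c : ι → ℝ}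
    (hc : ∀ l, 0 ≤ c l) : (∑ l, (c l : ℂ) • Φ l).PosSemidef :=
  Matrix.posSemidef_sum _ fun l _ => (hΦ l).smul (Complex.zero_le_real.2 (hc l))

theorem sum_inv_smul_posSemidef {Φ : ι → Matrix n n ℂ} (hΦ : ∀ l, (Φ l).PosSemidef) {e : ι → ℝ}
    (he : ∀ l, 0 ≤ e l) : (∑ l, ((1 + e l : ℝ) : ℂ)⁻¹ • Φ l).PosSemidef := by
  have := sum_smul_posSemidef hΦ (c := fun l => (1 + e l)⁻¹)
    fun l => inv_nonneg.2 (by linarith [he l])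
  simpa only [Complex.ofReal_inv] using this

theorem resolventSum_posDef {Φ : ι → Matrix n n ℂ} (hΦ : ∀ l, (Φ l).PosSemidef) {e : ι → ℝ}
    (he : ∀ l, 0 ≤ e l) : (resolventSum Φ e).PosDef :=
  resolvent_posDef (sum_inv_smul_posSemidef hΦ he)

theorem one_sub_resolventSum_posSemidef {Φ : ι → Matrix n n ℂ} (hΦ : ∀ l, (Φ l).PosSemidef)
    {e : ι → ℝ} (he : ∀ l, 0 ≤ e l) : (1 - resolventSum Φ e).PosSemidef :=
  one_sub_resolvent_posSemidef (sum_inv_smul_posSemidef hΦ he)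

/-- At a fixed point, `Tr (1 - T(e))` is at most the number of summands. -/
theorem trace_one_sub_resolventSum_le {Φ : ι → Matrix n n ℂ} (hΦ : ∀ l, (Φ l).PosSemidef)
    {e : ι → ℝ} (he : ∀ l, 0 ≤ e l) (hfix : traceStep Φ e = e) :
    (1 - resolventSum Φ e).trace.re ≤ (Fintype.card ι : ℝ) := by
  -- Since `1 - T = M T` with `M = ∑ l, Φ l / (1 + e l)`, the fixed-point equation evaluates each
  -- `Tr (Φ l T)` as `e l`.
  have h1 : (1 - resolventSum Φ e).trace.re = ∑ l, (1 + e l)⁻¹ * e l := by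
    unfold resolventSum
    rw [resolvent_add_mul (sum_inv_smul_posSemidef hΦ he), Finset.sum_mul, Matrix.trace_sum,
      Complex.re_sum]
    refine Finset.sum_congr rfl fun l _ => ?_
    rw [Matrix.smul_mul, Matrix.trace_smul, smul_eq_mul, ← Complex.ofReal_inv, Complex.re_ofReal_mul]
    congr 1
    exact congrFun hfix l
  rw [h1]
  calc ∑ l, (1 + e l)⁻¹ * e l ≤ ∑ _l : ι, (1 : ℝ) := by
        refine Finset.sum_le_sum fun l _ => ?_
        have := he l
        rw [inv_mul_le_iff₀ (by linarith)]
        linarith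
    _ = _ := by simp

/-- Larger `e` shrinks the weights `1 / (1 + e l)`, and inversion reverses the order. -/
theorem resolventSum_mono {Φ : ι → Matrix n n ℂ} (hΦ : ∀ l, (Φ l).PosSemidef) {e e' : ι → ℝ}
    (he : ∀ l, 0 ≤ e l) (hee : e ≤ e') : (resolventSum Φ e' - resolventSum Φ e).PosSemidef := by
  have he' : ∀ l, 0 ≤ e' l := fun l => (he l).trans (hee l)
  refine inv_sub_inv_posSemidef (Matrix.PosDef.one.posSemidef_add (sum_inv_smul_posSemidef hΦ he')) ?_
  have h := sum_smul_posSemidef hΦ (c := fun l => (1 + e l)⁻¹ - (1 + e' l)⁻¹) fun l => by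
    have := he l
    have := hee l
    exact sub_nonneg.2 (inv_anti₀ (by linarith) (by linarith))
  simpa [sub_smul, Finset.sum_sub_distrib] using h

theorem traceStep_mono {Φ : ι → Matrix n n ℂ} (hΦ : ∀ l, (Φ l).PosSemidef) {e e' : ι → ℝ}
    (he : ∀ l, 0 ≤ e l) (hee : e ≤ e') : traceStep Φ e ≤ traceStep Φ e' :=
  fun l => trace_mul_re_mono (hΦ l) (resolventSum_mono hΦ he hee)

theorem traceStep_nonneg {Φ : ι → Matrix n n ℂ} (hΦ : ∀ l, (Φ l).PosSemidef) {e : ι → ℝ}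
    (he : ∀ l, 0 ≤ e l) (l : ι) : 0 ≤ traceStep Φ e l :=
  trace_mul_re_nonneg (hΦ l) (resolventSum_posDef hΦ he).posSemidef

theorem traceStep_le {Φ : ι → Matrix n n ℂ} (hΦ : ∀ l, (Φ l).PosSemidef) {e : ι → ℝ}
    (he : ∀ l, 0 ≤ e l) (l : ι) : traceStep Φ e l ≤ (Φ l).trace.re := by
  have := trace_mul_re_mono (hΦ l) (one_sub_resolventSum_posSemidef hΦ he)
  rwa [mul_one] at this

/-- Strict subhomogeneity. Put `M(e) = ∑ l, Φ l / (1 + e l)`. From `1 + α e ≤ α (1 + e)` it follows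
that `M(α e) + 1` exceeds `α⁻¹ (M(e) + 1)` by at least `(1 - α⁻¹) 1`, a positive definite matrix;
strict antitonicity of the inverse gives `T(α e) < α T(e)`, and `Φ l ≠ 0` keeps the inequality
strict under the trace. -/
theorem traceStep_scale_lt {Φ : ι → Matrix n n ℂ} (hΦ : ∀ l, (Φ l).PosSemidef) {e : ι → ℝ}
    (he : ∀ l, 0 ≤ e l) {α : ℝ} (hα : 1 < α) {l : ι} (hl : Φ l ≠ 0) :
    traceStep Φ (fun j => α * e j) l < α * traceStep Φ e l := by
  have hα0 : 0 < α := by linarith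
  have heα : ∀ j, 0 ≤ α * e j := fun j => mul_nonneg hα0.le (he j)
  have hA := Matrix.PosDef.one.posSemidef_add (sum_inv_smul_posSemidef hΦ he)
  have hαinv : (0 : ℂ) < ((α⁻¹ : ℝ) : ℂ) := Complex.zero_lt_real.2 (inv_pos.2 hα0)
  have key := inv_sub_inv_posDef (A := ((α⁻¹ : ℝ) : ℂ) • ((∑ l, ((1 + e l : ℝ) : ℂ)⁻¹ • Φ l) + 1))
    (B := (∑ l, ((1 + α * e l : ℝ) : ℂ)⁻¹ • Φ l) + 1) (hA.smul hαinv) (by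
      have h1 := sum_smul_posSemidef hΦ (c := fun j => (1 + α * e j)⁻¹ - α⁻¹ * (1 + e j)⁻¹)
        fun j => by
          have := he j
          rw [← mul_inv]
          exact sub_nonneg.2 (inv_anti₀ (by positivity) (by linarith))
      have h2 := (Matrix.PosDef.one (n := n) (R := ℂ)).smul (α := ℂ) (a := ((1 - α⁻¹ : ℝ) : ℂ))
        (Complex.zero_lt_real.2 (sub_pos.2 (inv_lt_one_of_one_lt₀ hα)))
      have h3 := h2.posSemidef_add h1
      convert h3 using 1
      simp only [Complex.ofReal_sub, Complex.ofReal_mul, Complex.ofReal_inv, sub_smul,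
        Finset.sum_sub_distrib, smul_add, Finset.smul_sum, smul_smul, Complex.ofReal_one, one_smul]
      abel)
  have hpos := trace_mul_re_pos (hΦ l) hl key
  have hinv : (((α⁻¹ : ℝ) : ℂ) • ((∑ l, ((1 + e l : ℝ) : ℂ)⁻¹ • Φ l) + 1))⁻¹
      = (α : ℂ) • resolventSum Φ e := by
    have hu := (Matrix.isUnit_iff_isUnit_det _).1 hA.isUnit
    refine Matrix.inv_eq_right_inv ?_
    rw [Matrix.smul_mul, Matrix.mul_smul, smul_smul, resolventSum, Matrix.mul_nonsing_inv _ hu,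
      ← Complex.ofReal_mul, inv_mul_cancel₀ hα0.ne']
    simp
  rw [hinv, mul_sub, Matrix.mul_smul, Matrix.trace_sub, Matrix.trace_smul, Complex.sub_re,
    smul_eq_mul, Complex.re_ofReal_mul] at hpos
  exact sub_pos.1 hpos

theorem traceStep_pos {Φ : ι → Matrix n n ℂ} (hΦ : ∀ l, (Φ l).PosSemidef) {e : ι → ℝ}
    (he : ∀ l, 0 ≤ e l) {l : ι} (hl : Φ l ≠ 0) : 0 < traceStep Φ e l :=
  trace_mul_re_pos (hΦ l) hl (resolventSum_posDef hΦ he)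

/-- Suppose `e' ≤ e` fails, and let `l` maximize the ratio `α = e' l / e l` among the indices with
`e l < e' l`. Then `e' ≤ α e`, so `e' l` is at most the `l`-th value of the map at `α e`, which is
strictly below `α e l = e' l`. -/
theorem fixedPoint_le {Φ : ι → Matrix n n ℂ} (hΦ : ∀ l, (Φ l).PosSemidef) {e e' : ι → ℝ}
    (he : ∀ l, 0 ≤ e l) (he' : ∀ l, 0 ≤ e' l) (hf : traceStep Φ e = e)
    (hf' : traceStep Φ e' = e') : e' ≤ e := by
  classical
  by_contra hcon
  obtain ⟨l₀, hl₀⟩ : ∃ l, e l < e' l := by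
    simpa [Pi.le_def] using hcon
  -- The ratios make sense: `Φ l = 0` would force `e' l = 0`, and `Φ l ≠ 0` makes the fixed point
  -- positive at `l`.
  have hne : ∀ l, e l < e' l → Φ l ≠ 0 ∧ 0 < e l := by
    intro l hl
    have h0 : Φ l ≠ 0 := by
      intro h0
      have : e' l = 0 := by rw [← hf', traceStep, h0]; simp
      linarith [he l]
    refine ⟨h0, ?_⟩
    have := traceStep_pos hΦ he h0
    rwa [hf] at this
  obtain ⟨l, hl, hmax⟩ := Finset.exists_max_image (Finset.univ.filter fun l => e l < e' l)
    (fun l => e' l / e l) ⟨l₀, by simpa using hl₀⟩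
  simp only [Finset.mem_filter, Finset.mem_univ, true_and] at hl hmax
  obtain ⟨hΦl, hel⟩ := hne l hl
  have hα : 1 < e' l / e l := (one_lt_div hel).2 hl
  have hle : e' ≤ fun j => e' l / e l * e j := by
    intro j
    by_cases hj : e j < e' j
    · have := hmax j hj
      rwa [div_le_iff₀ (hne j hj).2] at this
    · have h1 := he j
      push Not at hj
      exact hj.trans (le_mul_of_one_le_left h1 hα.le)
  have h1 := traceStep_mono hΦ he' hle l
  have h2 := traceStep_scale_lt hΦ he hα hΦl
  rw [hf'] at h1
  rw [hf, div_mul_cancel₀ _ hel.ne'] at h2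
  exact absurd (h1.trans_lt h2) (lt_irrefl _)

theorem traceStep_continuousAt {Φ : ι → Matrix n n ℂ} (hΦ : ∀ l, (Φ l).PosSemidef) {e : ι → ℝ}
    (he : ∀ l, 0 ≤ e l) : ContinuousAt (traceStep Φ) e := by
  have hA := Matrix.PosDef.one.posSemidef_add (sum_inv_smul_posSemidef hΦ he)
  have hT : ContinuousAt (resolventSum Φ) e := by
    unfold resolventSum
    have h1 : ContinuousAt (fun e : ι → ℝ => (∑ l, ((1 + e l : ℝ) : ℂ)⁻¹ • Φ l) + 1) e := by
      refine ContinuousAt.add (tendsto_finsetSum _ fun l _ => ?_) continuousAt_const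
      refine Filter.Tendsto.smul (Filter.Tendsto.inv₀ ?_ ?_) tendsto_const_nhds
      · exact (Complex.continuous_ofReal.comp
          (continuous_const.add (continuous_apply l))).continuousAt
      · have := he l
        exact Complex.ofReal_ne_zero.2 (by linarith)
    have h2 : ContinuousAt (fun M : Matrix n n ℂ => M⁻¹)
        ((∑ l, ((1 + e l : ℝ) : ℂ)⁻¹ • Φ l) + 1) := by
      apply continuousAt_matrix_inv
      have := (Matrix.isUnit_iff_isUnit_det _).1 hA.isUnit
      simp only [Ring.inverse_eq_inv']
      exact continuousAt_inv₀ this.ne_zero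
    exact ContinuousAt.comp (f := fun e : ι → ℝ => (∑ l, ((1 + e l : ℝ) : ℂ)⁻¹ • Φ l) + 1) h2 h1
  refine continuousAt_pi.2 fun l => ?_
  have hc : Continuous fun M : Matrix n n ℂ => (Φ l * M).trace.re :=
    Complex.continuous_re.comp (Continuous.matrix_trace (continuous_const.matrix_mul continuous_id))
  exact hc.continuousAt.comp hT

/-- The iterates from `0` increase by monotonicity and stay below `Tr (Φ l)`; continuity of the map
on nonnegative points makes their limit a fixed point. -/
theorem exists_fixedPoint {Φ : ι → Matrix n n ℂ} (hΦ : ∀ l, (Φ l).PosSemidef) :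
    ∃ e : ι → ℝ, (∀ l, 0 ≤ e l) ∧ traceStep Φ e = e ∧
      Tendsto (fun j : ℕ => (traceStep Φ)^[j] 0) atTop (𝓝 e) := by
  set x : ℕ → ι → ℝ := fun j => (traceStep Φ)^[j] 0 with hx
  have hsucc : ∀ j, x (j + 1) = traceStep Φ (x j) := fun j => Function.iterate_succ_apply' _ _ _
  have hnn : ∀ j l, 0 ≤ x j l := by
    intro j
    induction j with
    | zero => intro l; simp [hx]
    | succ j ih => intro l; rw [hsucc]; exact traceStep_nonneg hΦ ih l
  have hmono : Monotone x := by
    refine monotone_nat_of_le_succ fun j => ?_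
    induction j with
    | zero => intro l; simpa [hx] using hnn 1 l
    | succ j ih =>
      have := traceStep_mono hΦ (hnn j) ih
      rwa [← hsucc, ← hsucc] at this
  have hbdd : ∀ l, BddAbove (Set.range fun j => x j l) := by
    intro l
    refine ⟨(Φ l).trace.re, ?_⟩
    rintro _ ⟨j, rfl⟩
    refine (hmono (Nat.le_succ j) l).trans ?_
    rw [Nat.succ_eq_add_one, hsucc]
    exact traceStep_le hΦ (hnn j) l
  have hlim : Tendsto x atTop (𝓝 fun l => ⨆ j, x j l) :=
    tendsto_pi_nhds.2 fun l => tendsto_atTop_ciSup (fun i j hij => hmono hij l) (hbdd l)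
  have hpos : ∀ l, 0 ≤ ⨆ j, x j l := fun l => (hnn 0 l).trans (le_ciSup (hbdd l) 0)
  refine ⟨_, hpos, ?_, hlim⟩
  have h1 : Tendsto (fun j => traceStep Φ (x j)) atTop (𝓝 (traceStep Φ fun l => ⨆ j, x j l)) :=
    (traceStep_continuousAt hΦ hpos).tendsto.comp hlim
  have h2 : Tendsto (fun j => traceStep Φ (x j)) atTop (𝓝 fun l => ⨆ j, x j l) := by
    simpa only [Function.comp_def, hsucc] using hlim.comp (tendsto_add_atTop_nat 1)
  exact tendsto_nhds_unique h1 h2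

end FixedPoint

end DopplerMIMO

namespace DopplerMIMO

set_option linter.unusedSectionVars false

/-! ### Circularly symmetric Gaussian processes -/

section CSCG

variable {ι κ Ω : Type*} [MeasurableSpace Ω] {P : Measure Ω} {X : ι → Ω → ℂ} {C : ι → ι → ℂ}

theorem IsCSCGProcess.memLp (hX : IsCSCGProcess X C P) (i : ι) {p : ENNReal} (hp : p ≠ ⊤) :
    MemLp (X i) p P :=
  (hX.gaussian.hasGaussianLaw_eval i).memLp hp

theorem IsCSCGProcess.integrable (hX : IsCSCGProcess X C P) (i : ι) : Integrable (X i) P :=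
  (hX.gaussian.hasGaussianLaw_eval i).integrable

theorem IsCSCGProcess.integrable_mul (hX : IsCSCGProcess X C P) (i j : ι) :
    Integrable (fun ω => X i ω * X j ω) P :=
  (hX.memLp i (ENNReal.ofNat_ne_top : (2 : ENNReal) ≠ ⊤)).integrable_mul
    (hX.memLp j (ENNReal.ofNat_ne_top : (2 : ENNReal) ≠ ⊤))

theorem IsCSCGProcess.integrable_mul_conj (hX : IsCSCGProcess X C P) (i j : ι) :
    Integrable (fun ω => X i ω * conj (X j ω)) P := by
  have h2 : MemLp (fun ω => conj (X j ω)) 2 P := by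
    have := (hX.memLp j (ENNReal.ofNat_ne_top : (2 : ENNReal) ≠ ⊤))
    refine this.congr_norm ?_ (by simp)
    exact (Complex.continuous_conj.measurable.comp (hX.measurable j)).aestronglyMeasurable
  exact (hX.memLp i (ENNReal.ofNat_ne_top : (2 : ENNReal) ≠ ⊤)).integrable_mul h2

theorem IsCSCGProcess.congr_cov (hX : IsCSCGProcess X C P) {C' : ι → ι → ℂ}
    (h : ∀ i j, C i j = C' i j) : IsCSCGProcess X C' P where
  measurable := hX.measurable
  gaussian := hX.gaussian
  mean_zero := hX.mean_zero
  covariance i j := by rw [hX.covariance, h]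
  pseudo_covariance := hX.pseudo_covariance

/-- Reindexing of a circularly symmetric Gaussian process. -/
theorem IsCSCGProcess.comp (hX : IsCSCGProcess X C P) (f : κ → ι) :
    IsCSCGProcess (fun j => X (f j)) (fun i j => C (f i) (f j)) P where
  measurable i := hX.measurable (f i)
  gaussian := hX.gaussian.comp_right f
  mean_zero i := hX.mean_zero (f i)
  covariance i j := hX.covariance (f i) (f j)
  pseudo_covariance i j := hX.pseudo_covariance (f i) (f j)

/-- Finite linear combinations of a circularly symmetric Gaussian process. -/
theorem IsCSCGProcess.linearComb {ν : Type*} [Fintype ν] (hX : IsCSCGProcess X C P)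
    (f : κ → ν → ι) (a : κ → ν → ℂ) :
    IsCSCGProcess (fun j ω => ∑ i, a j i * X (f j i) ω)
      (fun j j' => ∑ i, ∑ i', a j i * conj (a j' i') * C (f j i) (f j' i')) P where
  measurable j := Finset.measurable_sum _ fun i _ => (hX.measurable _).const_mul _
  gaussian := by
    classical
    refine hX.gaussian.of_isGaussianProcess fun j => ?_
    refine ⟨Finset.univ.image (f j),
      { toFun := fun x => ∑ i, a j i * x ⟨f j i, by simp⟩
        map_add' := fun x y => by simp [mul_add, Finset.sum_add_distrib]
        map_smul' := fun c x => by
          simp only [Pi.smul_apply, RingHom.id_apply, Finset.smul_sum]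
          exact Finset.sum_congr rfl fun i _ => by rw [mul_smul_comm]
        cont := by fun_prop }, fun ω => rfl⟩
  mean_zero j := by
    rw [integral_finsetSum _ fun i _ => (hX.integrable _).const_mul _]
    exact Finset.sum_eq_zero fun i _ => by rw [integral_const_mul, hX.mean_zero, mul_zero]
  covariance j j' := by
    have e : ∀ ω, (∑ i, a j i * X (f j i) ω) * conj (∑ i, a j' i * X (f j' i) ω)
        = ∑ i, ∑ i', a j i * conj (a j' i') * (X (f j i) ω * conj (X (f j' i') ω)) := by
      intro ω
      rw [map_sum, Finset.sum_mul_sum]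
      refine Finset.sum_congr rfl fun i _ => Finset.sum_congr rfl fun i' _ => ?_
      rw [map_mul]; ring
    simp_rw [e]
    rw [integral_finsetSum _ fun i _ => integrable_finsetSum _ fun i' _ =>
      (hX.integrable_mul_conj _ _).const_mul _]
    refine Finset.sum_congr rfl fun i _ => ?_
    rw [integral_finsetSum _ fun i' _ => (hX.integrable_mul_conj _ _).const_mul _]
    exact Finset.sum_congr rfl fun i' _ => by rw [integral_const_mul, hX.covariance]
  pseudo_covariance j j' := by
    have e : ∀ ω, (∑ i, a j i * X (f j i) ω) * (∑ i, a j' i * X (f j' i) ω)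
        = ∑ i, ∑ i', a j i * a j' i' * (X (f j i) ω * X (f j' i') ω) := by
      intro ω
      rw [Finset.sum_mul_sum]
      refine Finset.sum_congr rfl fun i _ => Finset.sum_congr rfl fun i' _ => ?_
      ring
    simp_rw [e]
    rw [integral_finsetSum _ fun i _ => integrable_finsetSum _ fun i' _ =>
      (hX.integrable_mul _ _).const_mul _]
    refine Finset.sum_eq_zero fun i _ => ?_
    rw [integral_finsetSum _ fun i' _ => (hX.integrable_mul _ _).const_mul _]
    exact Finset.sum_eq_zero fun i' _ => by
      rw [integral_const_mul, hX.pseudo_covariance, mul_zero]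

/-- Every real functional on `ℂ` is `x ↦ Re (w x)`, which expresses its covariances through the
covariance and the pseudo-covariance of the process. -/
theorem strongDual_complex_apply (L : StrongDual ℝ ℂ) (x : ℂ) :
    L x = (((L 1 : ℂ) - L Complex.I * Complex.I) * x).re := by
  have h : x = x.re • (1 : ℂ) + x.im • Complex.I := by
    apply Complex.ext <;> simp
  conv_lhs => rw [h, map_add, map_smul, map_smul]
  simp
  ring

/-- Entries with vanishing covariance are uncorrelated as random elements of `ℝ²`. -/
theorem IsCSCGProcess.cov_strongDual_eq_zero (hX : IsCSCGProcess X C P) {i j : ι}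
    (hij : C i j = 0) (L₁ L₂ : StrongDual ℝ ℂ) : cov[L₁ ∘ X i, L₂ ∘ X j; P] = 0 := by
  have := hX.gaussian.isProbabilityMeasure
  have hm : ∀ (L : StrongDual ℝ ℂ) k, ∫ ω, L (X k ω) ∂P = 0 := fun L k => by
    rw [L.integral_comp_comm (hX.integrable k), hX.mean_zero, map_zero]
  rw [covariance_eq_sub (((hX.gaussian.hasGaussianLaw_eval i).map L₁).memLp_two)
    (((hX.gaussian.hasGaussianLaw_eval j).map L₂).memLp_two)]
  have h1 : ∫ ω, (L₁ ∘ X i) ω ∂P = 0 := hm L₁ i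
  rw [h1, zero_mul, sub_zero]
  set w : ℂ := (L₁ 1 : ℂ) - L₁ Complex.I * Complex.I
  set v : ℂ := (L₂ 1 : ℂ) - L₂ Complex.I * Complex.I
  have e : ∀ ω, (L₁ ∘ X i * L₂ ∘ X j) ω
      = (w * v / 2 * (X i ω * X j ω) + w * conj v / 2 * (X i ω * conj (X j ω))).re := by
    intro ω
    simp only [Pi.mul_apply, Function.comp_apply]
    rw [strongDual_complex_apply L₁, strongDual_complex_apply L₂]
    -- The term `a * b` produces the pseudo-covariance, which vanishes by circular symmetry, and `a
    -- * conj b` the covariance, which vanishes by assumption.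
    have h2 : ∀ a b : ℂ, a.re * b.re = ((a * b + a * conj b) / 2).re := by
      intro a b
      simp
    rw [h2, map_mul]
    congr 1
    ring
  simp_rw [e]
  have hi1 := (hX.integrable_mul i j).const_mul (w * v / 2)
  have hi2 := (hX.integrable_mul_conj i j).const_mul (w * conj v / 2)
  have h3 := integral_re (hi1.add hi2)
  simp only [Pi.add_apply, RCLike.re_to_complex] at h3
  rw [h3, integral_add hi1 hi2, integral_const_mul, integral_const_mul, hX.pseudo_covariance,
    hX.covariance, hij]
  simp

/-- Families of uncorrelated members of a circularly symmetric Gaussian process are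
independent. -/
theorem IsCSCGProcess.indepFun {S T : Type*} (hX : IsCSCGProcess X C P) (f : S → ι) (g : T → ι)
    (h : ∀ s t, C (f s) (g t) = 0) :
    IndepFun (fun ω s => X (f s) ω) (fun ω t => X (g t) ω) P := by
  refine IsGaussianProcess.indepFun_of_covariance_strongDual (X := fun s => X (f s))
    (Y := fun t => X (g t)) ?_ (fun s => (hX.measurable _).aemeasurable)
    (fun s => (hX.measurable _).aemeasurable) fun s t L₁ L₂ => hX.cov_strongDual_eq_zero (h s t) _ _
  have := hX.gaussian.comp_right (Sum.elim f g)
  convert this using 1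
  ext (s | t) <;> rfl

theorem IsCSCGProcess.iIndepFun [Fintype ι] (hX : IsCSCGProcess X C P)
    (h : ∀ i j, i ≠ j → C i j = 0) : iIndepFun X P := by
  refine HasGaussianLaw.iIndepFun_of_covariance_strongDual ?_ fun i j hij L₁ L₂ =>
    hX.cov_strongDual_eq_zero (h i j hij) _ _
  let L : ({i // i ∈ (Finset.univ : Finset ι)} → ℂ) →L[ℝ] ι → ℂ :=
    { toFun := fun x i => x ⟨i, Finset.mem_univ i⟩
      map_add' := fun x y => rfl
      map_smul' := fun c x => rfl }
  exact (hX.gaussian.hasGaussianLaw Finset.univ).map L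

/-- Independent circularly symmetric Gaussian processes are jointly so. -/
theorem IsCSCGProcess.joint {T S : Type*} [DecidableEq T] {Y : T → S → Ω → ℂ} {D : T → S → S → ℂ}
    (hY : ∀ t, IsCSCGProcess (Y t) (D t) P) (hind : ProbabilityTheory.iIndepFun (fun t ω s => Y t s ω) P) :
    IsCSCGProcess (fun p : T × S => Y p.1 p.2)
      (fun p q => if p.1 = q.1 then D p.1 p.2 q.2 else 0) P where
  measurable p := (hY p.1).measurable p.2
  gaussian := by
    classical
    constructor
    intro I
    -- A finite set of index pairs lies in a finite rectangle `J × M`, on which independence across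
    -- `J` gives a joint Gaussian law; restriction to `I` is linear.
    set J := I.image Prod.fst
    set M := I.image Prod.snd
    have h1 : HasGaussianLaw (fun ω (t : J) (s : M) => Y t s ω) P := by
      refine iIndepFun.hasGaussianLaw (X := fun (t : J) ω (s : M) => Y t s ω)
        (fun t => (hY t).gaussian.hasGaussianLaw M) ?_
      have := hind.precomp (g := fun t : J => (t : T)) Subtype.val_injective
      exact this.comp (fun _ x (s : M) => x s) fun _ => by fun_prop
    let L : (J → M → ℂ) →L[ℝ] I → ℂ :=
      { toFun := fun x p => x ⟨p.1.1, Finset.mem_image_of_mem _ p.2⟩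
          ⟨p.1.2, Finset.mem_image_of_mem _ p.2⟩
        map_add' := fun x y => rfl
        map_smul' := fun c x => rfl }
    exact h1.map L
  mean_zero p := (hY p.1).mean_zero p.2
  covariance p q := by
    split_ifs with h
    · obtain ⟨t, s⟩ := p
      obtain ⟨t', s'⟩ := q
      obtain rfl : t = t' := h
      exact (hY t).covariance s s'
    · have hi : IndepFun (fun ω => Y p.1 p.2 ω) (fun ω => conj (Y q.1 q.2 ω)) P :=
        (hind.indepFun h).comp (φ := fun x : S → ℂ => x p.2) (ψ := fun x : S → ℂ => conj (x q.2))
          (by fun_prop) (Complex.continuous_conj.measurable.comp (by fun_prop))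
      rw [hi.integral_fun_mul_eq_mul_integral ((hY _).measurable _).aestronglyMeasurable
        (Complex.continuous_conj.measurable.comp ((hY _).measurable _)).aestronglyMeasurable,
        (hY _).mean_zero, zero_mul]
  pseudo_covariance p q := by
    by_cases h : p.1 = q.1
    · obtain ⟨t, s⟩ := p
      obtain ⟨t', s'⟩ := q
      obtain rfl : t = t' := h
      exact (hY t).pseudo_covariance s s'
    · have hi : IndepFun (fun ω => Y p.1 p.2 ω) (fun ω => Y q.1 q.2 ω) P :=
        (hind.indepFun h).comp (φ := fun x : S → ℂ => x p.2) (ψ := fun x : S → ℂ => x q.2)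
          (by fun_prop) (by fun_prop)
      rw [hi.integral_fun_mul_eq_mul_integral ((hY _).measurable _).aestronglyMeasurable
        ((hY _).measurable _).aestronglyMeasurable, (hY _).mean_zero, zero_mul]

open scoped ComplexOrder in
-- The quadratic form at `x` is `E |∑ i, conj (x i) * X i|²`.
theorem IsCSCGProcess.cov_posSemidef [Fintype ι] (hX : IsCSCGProcess X C P) :
    (Matrix.of C).PosSemidef := by
  refine Matrix.PosSemidef.of_dotProduct_mulVec_nonneg ?_ fun x => ?_
  · ext i j
    simp only [Matrix.conjTranspose_apply, Matrix.of_apply, ← hX.covariance, RCLike.star_def]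
    rw [← integral_conj]
    congr 1
    ext ω
    simp [mul_comm]
  · have h := (hX.linearComb (fun (_ : Unit) (i : ι) => i) (fun _ i => conj (x i))).covariance () ()
    have e : star x ⬝ᵥ (Matrix.of C *ᵥ x)
        = ∫ ω, (∑ i, conj (x i) * X i ω) * conj (∑ i, conj (x i) * X i ω) ∂P := by
      rw [h]
      simp only [dotProduct, Matrix.mulVec, Matrix.of_apply, Finset.mul_sum, Pi.star_apply,
        RCLike.star_def, Complex.conj_conj]
      exact Finset.sum_congr rfl fun i _ => Finset.sum_congr rfl fun j _ => by ring
    rw [e]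
    have e2 : ∀ ω, (∑ i, conj (x i) * X i ω) * conj (∑ i, conj (x i) * X i ω)
        = ((‖∑ i, conj (x i) * X i ω‖ ^ 2 : ℝ) : ℂ) := fun ω => by
      rw [Complex.mul_conj, Complex.normSq_eq_norm_sq]
    simp_rw [e2]
    rw [integral_complex_ofReal]
    exact Complex.zero_le_real.2 (integral_nonneg fun ω => by positivity)

end CSCG

end DopplerMIMO

namespace DopplerMIMO

set_option linter.unusedSectionVars false

/-! ### Moment bounds for Gaussian squared moduli -/

section Moments

variable {ι Ω : Type*} [MeasurableSpace Ω] {P : Measure Ω}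

theorem MemLp.integrable_pow_of_le [IsFiniteMeasure P] {f : Ω → ℝ} {p : ℕ} (hf : MemLp f p P) {k : ℕ}
    (hk : k ≤ p) : Integrable (fun ω => f ω ^ k) P := by
  have h1 : MemLp f k P := hf.mono_exponent (by exact_mod_cast hk)
  have h2 := h1.integrable_norm_pow'
  refine h2.mono' (hf.aestronglyMeasurable.pow k) ?_
  exact Eventually.of_forall fun ω => by simp

/-- Fourth moment of a sum of independent centered random variables. -/
theorem fourth_moment_sum_le [IsProbabilityMeasure P] {Y : ι → Ω → ℝ} {v : ι → ℝ} {K : ℝ}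
    (hK : 1 ≤ K) (hm : ∀ i, Measurable (Y i)) (hY : ∀ i, MemLp (Y i) (4 : ℕ) P)
    (hind : iIndepFun Y P)
    (hv : ∀ i, 0 ≤ v i) (h1 : ∀ i, ∫ ω, Y i ω ∂P = 0) (h2 : ∀ i, ∫ ω, Y i ω ^ 2 ∂P ≤ K * v i)
    (h4 : ∀ i, ∫ ω, Y i ω ^ 4 ∂P ≤ K * v i ^ 2) (s : Finset ι) :
    ∫ ω, (∑ i ∈ s, Y i ω) ∂P = 0 ∧ ∫ ω, (∑ i ∈ s, Y i ω) ^ 2 ∂P ≤ K * ∑ i ∈ s, v i ∧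
      ∫ ω, (∑ i ∈ s, Y i ω) ^ 4 ∂P ≤ 3 * K ^ 2 * (∑ i ∈ s, v i) ^ 2 := by
  classical
  induction s using Finset.induction_on with
  | empty => simp
  | insert a s ha ih =>
    obtain ⟨i1, i2, i4⟩ := ih
    have hS : MemLp (fun ω => ∑ i ∈ s, Y i ω) (4 : ℕ) P := memLp_finsetSum s fun i _ => hY i
    have hSi : ∀ k ≤ 4, Integrable (fun ω => (∑ i ∈ s, Y i ω) ^ k) P :=
      fun k hk => MemLp.integrable_pow_of_le hS hk
    have hYi : ∀ k ≤ 4, Integrable (fun ω => Y a ω ^ k) P :=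
      fun k hk => MemLp.integrable_pow_of_le (hY a) hk
    have hI : IndepFun (fun ω => ∑ i ∈ s, Y i ω) (Y a) P := by
      have := hind.indepFun_finsetSum_of_notMem hm ha
      convert this using 1
      ext ω
      simp
    have hIk : ∀ k l : ℕ, IndepFun (fun ω => (∑ i ∈ s, Y i ω) ^ k) (fun ω => Y a ω ^ l) P :=
      fun k l => hI.comp (φ := fun x : ℝ => x ^ k) (ψ := fun x : ℝ => x ^ l)
        (by fun_prop) (by fun_prop)
    have hint : ∀ k ≤ 4, ∀ l ≤ 4, Integrable (fun ω => (∑ i ∈ s, Y i ω) ^ k * Y a ω ^ l) P :=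
      fun k hk l hl => (hIk k l).integrable_mul (hSi k hk) (hYi l hl)
    have hprod : ∀ k ≤ 4, ∀ l ≤ 4, ∫ ω, (∑ i ∈ s, Y i ω) ^ k * Y a ω ^ l ∂P
        = (∫ ω, (∑ i ∈ s, Y i ω) ^ k ∂P) * ∫ ω, Y a ω ^ l ∂P :=
      fun k hk l hl => (hIk k l).integral_fun_mul_eq_mul_integral
        (hSi k hk).aestronglyMeasurable (hYi l hl).aestronglyMeasurable
    have z1 : ∫ ω, Y a ω ^ 1 ∂P = 0 := by simpa using h1 a
    have z2 : ∫ ω, (∑ i ∈ s, Y i ω) ^ 1 ∂P = 0 := by simpa using i1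
    have hvs : 0 ≤ ∑ i ∈ s, v i := Finset.sum_nonneg fun i _ => hv i
    simp only [Finset.sum_insert ha]
    refine ⟨?_, ?_, ?_⟩
    · have e : ∀ ω, Y a ω + ∑ i ∈ s, Y i ω = Y a ω ^ 1 + (∑ i ∈ s, Y i ω) ^ 1 := fun ω => by ring
      simp_rw [e]
      rw [integral_add (hYi 1 (by norm_num)) (hSi 1 (by norm_num)), z1, z2, add_zero]
    · have e : ∀ ω, (Y a ω + ∑ i ∈ s, Y i ω) ^ 2 = Y a ω ^ 2 + (∑ i ∈ s, Y i ω) ^ 2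
          + 2 * ((∑ i ∈ s, Y i ω) ^ 1 * Y a ω ^ 1) := fun ω => by ring
      simp_rw [e]
      rw [integral_add ((hYi 2 (by norm_num)).fun_add (hSi 2 (by norm_num)))
        ((hint 1 (by norm_num) 1 (by norm_num)).const_mul _),
        integral_add (hYi 2 (by norm_num)) (hSi 2 (by norm_num)), integral_const_mul,
        hprod 1 (by norm_num) 1 (by norm_num), z1]
      have := h2 a
      linarith
    -- Cross terms containing a first power vanish by independence and centering. The surviving term
    -- `6 E[S²] E[Y²] ≤ 6 K² (∑ v) (v a)` is exactly the cross term of `3 K² (v a + ∑ v)²`, which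
    -- explains the constant.
    · have e : ∀ ω, (Y a ω + ∑ i ∈ s, Y i ω) ^ 4 = ((Y a ω ^ 4 + (∑ i ∈ s, Y i ω) ^ 4)
          + 6 * ((∑ i ∈ s, Y i ω) ^ 2 * Y a ω ^ 2)) + (4 * ((∑ i ∈ s, Y i ω) ^ 3 * Y a ω ^ 1)
          + 4 * ((∑ i ∈ s, Y i ω) ^ 1 * Y a ω ^ 3)) := fun ω => by ring
      simp_rw [e]
      have j1 := (hint 2 (by norm_num) 2 (by norm_num)).const_mul 6
      have j2 := (hint 3 (by norm_num) 1 (by norm_num)).const_mul 4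
      have j3 := (hint 1 (by norm_num) 3 (by norm_num)).const_mul 4
      have j4 := (hYi 4 le_rfl).fun_add (hSi 4 le_rfl)
      rw [integral_add (j4.fun_add j1) (j2.fun_add j3), integral_add j4 j1, integral_add j2 j3,
        integral_add (hYi 4 le_rfl) (hSi 4 le_rfl), integral_const_mul, integral_const_mul,
        integral_const_mul, hprod 2 (by norm_num) 2 (by norm_num),
        hprod 3 (by norm_num) 1 (by norm_num), hprod 1 (by norm_num) 3 (by norm_num), z1, z2]
      have k1 : (∫ ω, (∑ i ∈ s, Y i ω) ^ 2 ∂P) * ∫ ω, Y a ω ^ 2 ∂P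
          ≤ (K * ∑ i ∈ s, v i) * (K * v a) :=
        mul_le_mul i2 (h2 a) (integral_nonneg fun ω => by positivity)
          (mul_nonneg (by linarith) hvs)
      have k2 := h4 a
      have k3 : K * v a ^ 2 ≤ 3 * K ^ 2 * v a ^ 2 :=
        mul_le_mul_of_nonneg_right (by nlinarith) (sq_nonneg _)
      nlinarith

/-- The eighth moment of the standard normal distribution. -/
noncomputable def gaussianEighthMoment : ℝ := ∫ x, x ^ 8 ∂(gaussianReal 0 1)

theorem gaussianEighthMoment_nonneg : 0 ≤ gaussianEighthMoment :=
  integral_nonneg fun x => by positivity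

/-- A centered real Gaussian variable has the law of `√w` times a standard normal one, where `w` is
its variance. -/
theorem integral_pow_eight_of_gaussian {Y : Ω → ℝ} (hY : HasGaussianLaw Y P)
    (h0 : ∫ ω, Y ω ∂P = 0) :
    ∫ ω, Y ω ^ 8 ∂P = (∫ ω, Y ω ^ 2 ∂P) ^ 4 * gaussianEighthMoment := by
  have := hY.isProbabilityMeasure
  have hvar : Var[Y; P] = ∫ ω, Y ω ^ 2 ∂P := by
    rw [variance_eq_sub hY.memLp_two, h0]
    simp
  set w := ∫ ω, Y ω ^ 2 ∂P with hw
  have hw0 : 0 ≤ w := integral_nonneg fun ω => by positivity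
  have hmap : P.map Y = (gaussianReal 0 1).map (fun x => Real.sqrt w * x) := by
    rw [hY.map_eq_gaussianReal, h0, hvar, gaussianReal_map_const_mul]
    congr 1
    · simp
    · ext
      simp [Real.sq_sqrt hw0, Real.coe_toNNReal _ hw0]
  calc ∫ ω, Y ω ^ 8 ∂P = ∫ x, x ^ 8 ∂(P.map Y) :=
        (integral_map hY.aemeasurable (f := fun x : ℝ => x ^ 8) (by fun_prop)).symm
    _ = ∫ x, (Real.sqrt w * x) ^ 8 ∂(gaussianReal 0 1) := by
        rw [hmap, integral_map (by fun_prop) (by fun_prop)]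
    _ = w ^ 4 * gaussianEighthMoment := by
        have : Real.sqrt w ^ 8 = w ^ 4 := by
          rw [show (8 : ℕ) = 2 * 4 from rfl, pow_mul, Real.sq_sqrt hw0]
        simp_rw [mul_pow, this]
        rw [integral_const_mul, gaussianEighthMoment]

/-- The constant in the fourth moment bound for the squared modulus. -/
noncomputable def modulusConst : ℝ := 8 * (16 * gaussianEighthMoment + 1)

theorem one_le_modulusConst : 1 ≤ modulusConst := by
  have := gaussianEighthMoment_nonneg
  rw [modulusConst]
  linarith

theorem IsCSCGProcess.integral_normSq {X : ι → Ω → ℂ} {C : ι → ι → ℂ} (hX : IsCSCGProcess X C P)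
    (i : ι) : ∫ ω, ‖X i ω‖ ^ 2 ∂P = (C i i).re := by
  rw [← hX.covariance]
  have e : ∀ ω, X i ω * conj (X i ω) = ((‖X i ω‖ ^ 2 : ℝ) : ℂ) := fun ω => by
    rw [Complex.mul_conj, Complex.normSq_eq_norm_sq]
  simp_rw [e]
  rw [integral_complex_ofReal, Complex.ofReal_re]

theorem IsCSCGProcess.memLp_normSq_sub {X : ι → Ω → ℂ} {C : ι → ι → ℂ} (hX : IsCSCGProcess X C P)
    (i : ι) (c : ℝ) : MemLp (fun ω => ‖X i ω‖ ^ 2 - c) (4 : ℕ) P := by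
  have := hX.gaussian.isProbabilityMeasure
  refine MemLp.sub ?_ (memLp_const c)
  have h := (hX.memLp i (p := 8) ENNReal.ofNat_ne_top).norm_rpow_div 2
  have h84 : (8 : ENNReal) / 2 = (4 : ℕ) := by
    rw [show (8 : ENNReal) = (4 : ℕ) * 2 by norm_num]
    exact ENNReal.mul_div_cancel_right (by norm_num) (by norm_num)
  rw [h84] at h
  simpa using h

theorem IsCSCGProcess.fourth_moment_normSq_sub {X : ι → Ω → ℂ} {C : ι → ι → ℂ}
    (hX : IsCSCGProcess X C P) (i : ι) :
    ∫ ω, (‖X i ω‖ ^ 2 - (C i i).re) ^ 4 ∂P ≤ modulusConst * ((C i i).re ^ 2) ^ 2 := by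
  have hP := hX.gaussian.isProbabilityMeasure
  set c := (C i i).re with hc
  have hcn := hX.integral_normSq i
  have hgre : HasGaussianLaw (fun ω => (X i ω).re) P :=
    (hX.gaussian.hasGaussianLaw_eval i).map Complex.reCLM
  have hgim : HasGaussianLaw (fun ω => (X i ω).im) P :=
    (hX.gaussian.hasGaussianLaw_eval i).map Complex.imCLM
  have h0re : ∫ ω, (X i ω).re ∂P = 0 := by
    have := integral_re (hX.integrable i)
    simp only [RCLike.re_to_complex] at this
    rw [this, hX.mean_zero, Complex.zero_re]
  have h0im : ∫ ω, (X i ω).im ∂P = 0 := by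
    have := integral_im (hX.integrable i)
    simp only [RCLike.im_to_complex] at this
    rw [this, hX.mean_zero, Complex.zero_im]
  have hnsq : Integrable (fun ω => ‖X i ω‖ ^ 2) P :=
    MemLp.integrable_norm_pow' (hX.memLp i (by simp))
  have hns : ∀ ω, ‖X i ω‖ ^ 2 = (X i ω).re ^ 2 + (X i ω).im ^ 2 := fun ω => by
    rw [← Complex.normSq_eq_norm_sq, Complex.normSq_apply]; ring
  have hvre : ∫ ω, (X i ω).re ^ 2 ∂P ≤ c := by
    rw [hc, ← hcn]
    refine integral_mono_of_nonneg (Eventually.of_forall fun ω => sq_nonneg _) hnsq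
      (Eventually.of_forall fun ω => ?_)
    simp only [hns]
    nlinarith [sq_nonneg (X i ω).im]
  have hvim : ∫ ω, (X i ω).im ^ 2 ∂P ≤ c := by
    rw [hc, ← hcn]
    refine integral_mono_of_nonneg (Eventually.of_forall fun ω => sq_nonneg _) hnsq
      (Eventually.of_forall fun ω => ?_)
    simp only [hns]
    nlinarith [sq_nonneg (X i ω).re]
  have h8re : ∫ ω, (X i ω).re ^ 8 ∂P ≤ c ^ 4 * gaussianEighthMoment := by
    rw [integral_pow_eight_of_gaussian hgre h0re]
    exact mul_le_mul_of_nonneg_right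
      (pow_le_pow_left₀ (integral_nonneg fun ω => sq_nonneg _) hvre 4) gaussianEighthMoment_nonneg
  have h8im : ∫ ω, (X i ω).im ^ 8 ∂P ≤ c ^ 4 * gaussianEighthMoment := by
    rw [integral_pow_eight_of_gaussian hgim h0im]
    exact mul_le_mul_of_nonneg_right
      (pow_le_pow_left₀ (integral_nonneg fun ω => sq_nonneg _) hvim 4) gaussianEighthMoment_nonneg
  have ire : Integrable (fun ω => (X i ω).re ^ 8) P :=
    MemLp.integrable_pow_of_le (p := 8) (hgre.memLp (by simp)) le_rfl
  have iim : Integrable (fun ω => (X i ω).im ^ 8) P :=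
    MemLp.integrable_pow_of_le (p := 8) (hgim.memLp (by simp)) le_rfl
  -- The inequality `(x + y)⁴ ≤ 8 (x⁴ + y⁴)` is used twice. The real and imaginary parts each
  -- contribute at most `c⁴` times the normal eighth moment, whence the constant `8 * (16 *
  -- gaussianEighthMoment + 1)`.
  have hpt : ∀ ω, (‖X i ω‖ ^ 2 - c) ^ 4
      ≤ 8 * (8 * ((X i ω).re ^ 8 + (X i ω).im ^ 8) + c ^ 4) := by
    intro ω
    have aux : ∀ x y : ℝ, (x + y) ^ 4 ≤ 8 * (x ^ 4 + y ^ 4) := by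
      intro x y
      have h1 : (x + y) ^ 2 ≤ 2 * (x ^ 2 + y ^ 2) := by nlinarith [sq_nonneg (x - y)]
      have h2 : ((x + y) ^ 2) ^ 2 ≤ (2 * (x ^ 2 + y ^ 2)) ^ 2 :=
        pow_le_pow_left₀ (sq_nonneg _) h1 2
      nlinarith [sq_nonneg (x ^ 2 - y ^ 2)]
    have h1 := aux (‖X i ω‖ ^ 2) (-c)
    have h2 := aux ((X i ω).re ^ 2) ((X i ω).im ^ 2)
    rw [← hns ω] at h2
    have e1 : ((X i ω).re ^ 2) ^ 4 = (X i ω).re ^ 8 := by ring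
    have e2 : ((X i ω).im ^ 2) ^ 4 = (X i ω).im ^ 8 := by ring
    have e3 : (-c) ^ 4 = c ^ 4 := by ring
    rw [e1, e2] at h2
    rw [e3, ← sub_eq_add_neg] at h1
    linarith
  calc ∫ ω, (‖X i ω‖ ^ 2 - c) ^ 4 ∂P
      ≤ ∫ ω, 8 * (8 * ((X i ω).re ^ 8 + (X i ω).im ^ 8) + c ^ 4) ∂P :=
        integral_mono (MemLp.integrable_pow_of_le (hX.memLp_normSq_sub i c) le_rfl)
          ((((ire.fun_add iim).const_mul 8).add (integrable_const _)).const_mul 8) hpt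
    _ = 8 * (8 * (∫ ω, (X i ω).re ^ 8 ∂P + ∫ ω, (X i ω).im ^ 8 ∂P) + c ^ 4) := by
        rw [integral_const_mul, integral_add ((ire.fun_add iim).const_mul 8) (integrable_const _),
          integral_const_mul, integral_add ire iim]
        simp
    _ ≤ modulusConst * (c ^ 2) ^ 2 := by
        rw [modulusConst]
        nlinarith

/-- The variance of `Y²` is nonnegative. -/
theorem sq_integral_sq_le [IsProbabilityMeasure P] {Y : Ω → ℝ} (hY : MemLp Y (4 : ℕ) P) :
    (∫ ω, Y ω ^ 2 ∂P) ^ 2 ≤ ∫ ω, Y ω ^ 4 ∂P := by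
  set a := ∫ ω, Y ω ^ 2 ∂P
  have i4 := MemLp.integrable_pow_of_le hY (k := 4) le_rfl
  have i2 := MemLp.integrable_pow_of_le hY (k := 2) (by norm_num)
  have h : 0 ≤ ∫ ω, (Y ω ^ 2 - a) ^ 2 ∂P := integral_nonneg fun ω => sq_nonneg _
  have e : ∀ ω, (Y ω ^ 2 - a) ^ 2 = (Y ω ^ 4 + -(2 * a) * Y ω ^ 2) + a ^ 2 := fun ω => by ring
  simp_rw [e] at h
  rw [integral_add (i4.fun_add (i2.const_mul _)) (integrable_const _),
    integral_add i4 (i2.const_mul _), integral_const_mul] at h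
  simp only [integral_const, probReal_univ, one_smul] at h
  nlinarith

theorem IsCSCGProcess.second_moment_normSq_sub {X : ι → Ω → ℂ} {C : ι → ι → ℂ}
    (hX : IsCSCGProcess X C P) (i : ι) :
    ∫ ω, (‖X i ω‖ ^ 2 - (C i i).re) ^ 2 ∂P ≤ modulusConst * (C i i).re ^ 2 := by
  have hP := hX.gaussian.isProbabilityMeasure
  have h1 := sq_integral_sq_le (hX.memLp_normSq_sub i (C i i).re)
  have h2 := hX.fourth_moment_normSq_sub i
  have hK := one_le_modulusConst
  -- Squares are compared: the square of the second moment is at most the fourth moment, and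
  -- `modulusConst ≤ modulusConst²`.
  refine abs_le_of_sq_le_sq' ?_ (by positivity) |>.2
  refine (h1.trans h2).trans ?_
  have : 0 ≤ ((C i i).re ^ 2) ^ 2 := by positivity
  nlinarith

/-- The constant in the fourth moment bound for quadratic forms. -/
noncomputable def quadConst : ℝ := 3 * modulusConst ^ 2

theorem quadConst_nonneg : 0 ≤ quadConst := by
  unfold quadConst
  positivity

theorem IsCSCGProcess.fourth_moment_sum [Fintype ι] {X : ι → Ω → ℂ} {C : ι → ι → ℂ}
    (hX : IsCSCGProcess X C P) (hC : ∀ i j, i ≠ j → C i j = 0) :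
    Integrable (fun ω => (∑ i, (‖X i ω‖ ^ 2 - (C i i).re)) ^ 4) P ∧
    ∫ ω, (∑ i, (‖X i ω‖ ^ 2 - (C i i).re)) ^ 4 ∂P ≤ quadConst * (∑ i, (C i i).re ^ 2) ^ 2 := by
  have hP := hX.gaussian.isProbabilityMeasure
  have hmem := fun i => hX.memLp_normSq_sub i (C i i).re
  refine ⟨MemLp.integrable_pow_of_le (p := 4) (memLp_finsetSum _ fun i _ => hmem i) le_rfl, ?_⟩
  refine (fourth_moment_sum_le (v := fun i => (C i i).re ^ 2)
    (Y := fun i ω => ‖X i ω‖ ^ 2 - (C i i).re) one_le_modulusConst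
    (fun i => ((hX.measurable i).norm.pow_const 2).sub_const _) hmem ?_ (fun i => sq_nonneg _) ?_
    (fun i => hX.second_moment_normSq_sub i) (fun i => hX.fourth_moment_normSq_sub i)
    Finset.univ).2.2
  · exact (hX.iIndepFun hC).comp (fun i x => ‖x‖ ^ 2 - (C i i).re) fun i => by fun_prop
  · intro i
    have hnsq : Integrable (fun ω => ‖X i ω‖ ^ 2) P :=
      MemLp.integrable_norm_pow' (hX.memLp i (by simp))
    rw [integral_sub hnsq (integrable_const _), hX.integral_normSq]
    simp

end Moments

/-! ### Concentration of Gaussian quadratic forms -/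

section QuadraticForm

open scoped ComplexOrder

variable {ι Ω : Type*} [MeasurableSpace Ω] {P : Measure Ω} [Fintype ι] [DecidableEq ι]

/-- Concentration of a quadratic form in a circularly symmetric Gaussian vector. -/
theorem IsCSCGProcess.fourth_moment_quadraticForm {X : ι → Ω → ℂ} {C : ι → ι → ℂ}
    (hX : IsCSCGProcess X C P) {A : Matrix ι ι ℂ} (hA : A.PosSemidef) :
    ∫⁻ ω, ENNReal.ofReal (((star (fun i => X i ω) ⬝ᵥ (A *ᵥ fun i => X i ω)).re
      - (Matrix.of C * A).trace.re) ^ 4) ∂P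
      ≤ ENNReal.ofReal
        (quadConst * ((Matrix.of C * A * Matrix.of C * A).trace.re) ^ 2) := by
  obtain ⟨L, rfl⟩ := exists_conjTranspose_mul_self hA
  set Φ : Matrix ι ι ℂ := Matrix.of C with hΦdef
  have hΦ : Φ.PosSemidef := hX.cov_posSemidef
  have hM : (L * Φ * Lᴴ).PosSemidef := hΦ.mul_mul_conjTranspose_same L
  set U : Matrix ι ι ℂ := (hM.1.eigenvectorUnitary : Matrix ι ι ℂ) with hU
  set lam := hM.1.eigenvalues with hlam
  set D : Matrix ι ι ℂ := Matrix.diagonal (fun i => (lam i : ℂ)) with hD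
  have hUU : U * Uᴴ = 1 := Unitary.mul_star_self_of_mem hM.1.eigenvectorUnitary.2
  have hUU' : Uᴴ * U = 1 := Unitary.star_mul_self_of_mem hM.1.eigenvectorUnitary.2
  have hspec : L * Φ * Lᴴ = U * D * Uᴴ := by
    have := hM.1.spectral_theorem
    rw [Unitary.conjStarAlgAut_apply] at this
    exact this
  -- In the coordinates `Z = B X` the covariance is the diagonal matrix `D`, so the entries of `Z`
  -- are independent, while `Xᴴ A X = ∑ i, |Z i|²`. The traces of `Φ A` and `Φ A Φ A` become `∑ i,
  -- lam i` and `∑ i, lam i ^ 2`.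
  set B := Uᴴ * L with hB
  have hBB : Bᴴ * B = Lᴴ * L := by
    rw [hB, Matrix.conjTranspose_mul, Matrix.conjTranspose_conjTranspose, mul_assoc,
      ← mul_assoc U, hUU, one_mul]
  have hBC : B * Φ * Bᴴ = D := by
    have : B * Φ * Bᴴ = Uᴴ * (L * Φ * Lᴴ) * U := by
      rw [hB, Matrix.conjTranspose_mul, Matrix.conjTranspose_conjTranspose]
      simp only [mul_assoc]
    rw [this, hspec]
    calc Uᴴ * (U * D * Uᴴ) * U = (Uᴴ * U) * D * (Uᴴ * U) := by simp only [mul_assoc]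
      _ = D := by rw [hUU', one_mul, mul_one]
  have hZ := (hX.linearComb (fun (_ : ι) (i : ι) => i) (fun j i => B j i)).congr_cov
    (C' := fun i j => D i j) (by
      intro i j
      rw [← hBC, Matrix.mul_apply]
      simp only [Matrix.mul_apply, Matrix.conjTranspose_apply, RCLike.star_def, Finset.sum_mul]
      rw [Finset.sum_comm]
      refine Finset.sum_congr rfl fun k _ => Finset.sum_congr rfl fun l _ => ?_
      simp only [hΦdef, Matrix.of_apply]
      ring)
  have hmain := hZ.fourth_moment_sum fun i j hij => Matrix.diagonal_apply_ne _ hij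
  have hDii : ∀ i, (D i i).re = lam i := fun i => by simp [hD]
  simp only [hDii] at hmain
  have htr1 : (Φ * (Lᴴ * L)).trace.re = ∑ i, lam i := by
    have : (Φ * (Lᴴ * L)).trace = D.trace := by
      rw [← hBC, ← hBB, ← mul_assoc, Matrix.trace_mul_comm, ← mul_assoc]
    rw [this, Matrix.trace, Complex.re_sum]
    exact Finset.sum_congr rfl fun i _ => hDii i
  have htr2 : (Φ * (Lᴴ * L) * Φ * (Lᴴ * L)).trace.re = ∑ i, lam i ^ 2 := by
    have : (Φ * (Lᴴ * L) * Φ * (Lᴴ * L)).trace = (D * D).trace := by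
      rw [← hBC, ← hBB, ← mul_assoc _ Bᴴ B, Matrix.trace_mul_comm]
      simp only [mul_assoc]
    rw [this, hD, Matrix.diagonal_mul_diagonal, Matrix.trace_diagonal, Complex.re_sum]
    exact Finset.sum_congr rfl fun i _ => by
      rw [← Complex.ofReal_mul, Complex.ofReal_re, sq]
  have hquad : ∀ ω, (star (fun i => X i ω) ⬝ᵥ ((Lᴴ * L) *ᵥ fun i => X i ω)).re
      - (Φ * (Lᴴ * L)).trace.re = ∑ i, (‖∑ k, B i k * X k ω‖ ^ 2 - lam i) := by
    intro ω
    rw [htr1, Finset.sum_sub_distrib]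
    congr 1
    rw [← hBB, ← Matrix.mulVec_mulVec, Matrix.dotProduct_mulVec, ← Matrix.star_mulVec, dotProduct,
      Complex.re_sum]
    refine Finset.sum_congr rfl fun i _ => ?_
    rw [Pi.star_apply, RCLike.star_def, mul_comm, Complex.mul_conj, Complex.ofReal_re,
      Complex.normSq_eq_norm_sq]
    rfl
  simp_rw [hquad]
  rw [htr2, ← ofReal_integral_eq_lintegral_ofReal hmain.1
    (Eventually.of_forall fun ω => by positivity)]
  exact ENNReal.ofReal_le_ofReal hmain.2

end QuadraticForm

end DopplerMIMO

namespace DopplerMIMO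

/-! ### Decay of the Bessel function and the Frobenius norm of the Jakes matrix -/

section Bessel

theorem abs_besselJ0_le_one (x : ℝ) : |besselJ0 x| ≤ 1 := by
  have h := intervalIntegral.norm_integral_le_of_norm_le_const (a := 0) (b := Real.pi) (C := 1)
    (f := fun θ => Real.cos (x * Real.sin θ)) fun θ _ => by
      rw [Real.norm_eq_abs]; exact Real.abs_cos_le_one _
  rw [Real.norm_eq_abs, sub_zero, abs_of_pos Real.pi_pos, one_mul] at h
  rw [besselJ0, abs_mul, abs_of_pos (by positivity), one_div, inv_mul_le_iff₀ Real.pi_pos, mul_one]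
  exact h

/-- Integration by parts away from the stationary point `π / 2`: divide and multiply by the
derivative `x cos θ` of the phase. -/
theorem abs_integral_cos_mul_sin_le {x b : ℝ} (hx : 0 < x) (hb0 : 0 ≤ b) (hb : b < Real.pi / 2) :
    |∫ θ in (0 : ℝ)..b, Real.cos (x * Real.sin θ)| ≤ 2 / (x * Real.cos b) := by
  have hcos : ∀ θ ∈ Set.uIcc 0 b, 0 < Real.cos θ := fun θ hθ => by
    rw [Set.uIcc_of_le hb0] at hθ
    exact Real.cos_pos_of_mem_Ioo ⟨by linarith [hθ.1, Real.pi_pos], by linarith [hθ.2]⟩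
  -- `F` is the boundary term and `g` the remainder, so `∫ cos (x sin θ) = F b - ∫ g`. The remainder
  -- is dominated by the derivative of `1 / (x cos θ)`, so each of the two terms is at most `1 / (x
  -- cos b)`.
  set F : ℝ → ℝ := fun θ => Real.sin (x * Real.sin θ) / (x * Real.cos θ)
  set g : ℝ → ℝ := fun θ => Real.sin (x * Real.sin θ) * Real.sin θ / (x * Real.cos θ ^ 2)
  have hF : ∀ θ ∈ Set.uIcc 0 b, HasDerivAt F (Real.cos (x * Real.sin θ) + g θ) θ := by
    intro θ hθ
    have hc := hcos θ hθ
    have h1 : HasDerivAt (fun θ => Real.sin (x * Real.sin θ))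
        (Real.cos (x * Real.sin θ) * (x * Real.cos θ)) θ :=
      ((Real.hasDerivAt_sin θ).const_mul x).sin
    have h2 : HasDerivAt (fun θ => x * Real.cos θ) (x * -Real.sin θ) θ :=
      (Real.hasDerivAt_cos θ).const_mul x
    have h3 := h1.div h2 (by positivity)
    refine h3.congr_deriv ?_
    simp only [g]
    field_simp
    ring
  have hG : ∀ θ ∈ Set.uIcc 0 b, HasDerivAt (fun θ => 1 / (x * Real.cos θ))
      (Real.sin θ / (x * Real.cos θ ^ 2)) θ := by
    intro θ hθ
    have hc := hcos θ hθ
    have h2 : HasDerivAt (fun θ => x * Real.cos θ) (x * -Real.sin θ) θ :=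
      (Real.hasDerivAt_cos θ).const_mul x
    have h3 := (hasDerivAt_const θ (1 : ℝ)).div h2 (by positivity)
    refine h3.congr_deriv ?_
    field_simp
    ring
  have hgc : ContinuousOn g (Set.uIcc 0 b) := by
    refine ContinuousOn.div (by fun_prop) (by fun_prop) fun θ hθ => ?_
    have := hcos θ hθ
    positivity
  have hGc : ContinuousOn (fun θ => Real.sin θ / (x * Real.cos θ ^ 2)) (Set.uIcc 0 b) := by
    refine ContinuousOn.div (by fun_prop) (by fun_prop) fun θ hθ => ?_
    have := hcos θ hθ
    positivity
  have hci : IntervalIntegrable (fun θ => Real.cos (x * Real.sin θ)) volume 0 b :=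
    Continuous.intervalIntegrable (by fun_prop) _ _
  have e1 := intervalIntegral.integral_eq_sub_of_hasDerivAt hF (hci.add hgc.intervalIntegrable)
  have e2 := intervalIntegral.integral_eq_sub_of_hasDerivAt hG hGc.intervalIntegrable
  rw [intervalIntegral.integral_add hci hgc.intervalIntegrable] at e1
  have hg : |∫ θ in (0 : ℝ)..b, g θ| ≤ ∫ θ in (0 : ℝ)..b, Real.sin θ / (x * Real.cos θ ^ 2) := by
    rw [← Real.norm_eq_abs]
    refine intervalIntegral.norm_integral_le_of_norm_le hb0 (Eventually.of_forall fun θ hθ => ?_)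
      hGc.intervalIntegrable
    have hθ' : θ ∈ Set.uIcc 0 b := by
      rw [Set.uIcc_of_le hb0]; exact ⟨hθ.1.le, hθ.2⟩
    have hc := hcos θ hθ'
    have hs : 0 ≤ Real.sin θ :=
      Real.sin_nonneg_of_nonneg_of_le_pi hθ.1.le (by linarith [hθ.2, Real.pi_pos])
    rw [Real.norm_eq_abs]
    simp only [g]
    rw [abs_div, abs_mul, abs_of_nonneg hs, abs_of_pos (by positivity : 0 < x * Real.cos θ ^ 2)]
    gcongr
    exact mul_le_of_le_one_left hs (Real.abs_sin_le_one _)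
  have hcb := hcos b Set.right_mem_uIcc
  have hFb : |F b| ≤ 1 / (x * Real.cos b) := by
    simp only [F]
    rw [abs_div, abs_of_pos (by positivity : 0 < x * Real.cos b)]
    gcongr
    exact Real.abs_sin_le_one _
  have hF0 : F 0 = 0 := by simp [F]
  rw [hF0] at e1
  rw [e2, Real.cos_zero, mul_one] at hg
  have hx1 : 0 < 1 / x := by positivity
  have h2 : 2 / (x * Real.cos b) = 1 / (x * Real.cos b) + 1 / (x * Real.cos b) := by ring
  rw [h2, abs_le]
  rw [abs_le] at hg hFb
  constructor <;> linarith [hg.1, hg.2, hFb.1, hFb.2]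

/-- The last stretch of length `δ = 1 / √x` before the stationary point is bounded trivially by `δ`.
Before it, the integration by parts gives `2 / (x sin δ)`, at most `π / √x` by Jordan's inequality
`sin δ ≥ 2 δ / π`. This `δ` balances the two orders. -/
theorem abs_integral_cos_mul_sin_half_le {x : ℝ} (hx : 1 ≤ x) :
    |∫ θ in (0 : ℝ)..(Real.pi / 2), Real.cos (x * Real.sin θ)|
      ≤ (1 + Real.pi) / Real.sqrt x := by
  have hx0 : 0 < x := by linarith
  have hs1 : 1 ≤ Real.sqrt x := Real.one_le_sqrt.2 hx
  have hs0 : 0 < Real.sqrt x := by linarith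
  have hsq : Real.sqrt x * Real.sqrt x = x := Real.mul_self_sqrt hx0.le
  set δ := 1 / Real.sqrt x with hδ
  have hδ0 : 0 < δ := by positivity
  have hδ1 : δ ≤ 1 := by rw [hδ, div_le_one hs0]; exact hs1
  have hpi := Real.pi_gt_three
  have hcont : ∀ a b, IntervalIntegrable (fun θ => Real.cos (x * Real.sin θ)) volume a b :=
    fun a b => Continuous.intervalIntegrable (by fun_prop) _ _
  rw [← intervalIntegral.integral_add_adjacent_intervals (hcont 0 (Real.pi / 2 - δ)) (hcont _ _)]
  have h1 := abs_integral_cos_mul_sin_le hx0 (b := Real.pi / 2 - δ) (by linarith) (by linarith)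
  rw [Real.cos_pi_div_two_sub] at h1
  have hsin : 2 / Real.pi * δ ≤ Real.sin δ := Real.mul_le_sin hδ0.le (by linarith)
  have h3 : 2 / (x * Real.sin δ) ≤ Real.pi / Real.sqrt x := by
    have : x * (2 / Real.pi * δ) ≤ x * Real.sin δ := mul_le_mul_of_nonneg_left hsin hx0.le
    calc 2 / (x * Real.sin δ) ≤ 2 / (x * (2 / Real.pi * δ)) := by gcongr
      _ = Real.pi / Real.sqrt x := by
        rw [hδ]
        nth_rewrite 1 [← hsq]
        field_simp
  have h4 : |∫ θ in (Real.pi / 2 - δ)..(Real.pi / 2), Real.cos (x * Real.sin θ)| ≤ δ := by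
    have h := intervalIntegral.norm_integral_le_of_norm_le_const (a := Real.pi / 2 - δ)
      (b := Real.pi / 2) (C := 1) (f := fun θ => Real.cos (x * Real.sin θ)) fun θ _ => by
        rw [Real.norm_eq_abs]; exact Real.abs_cos_le_one _
    rw [Real.norm_eq_abs, one_mul, sub_sub_cancel, abs_of_pos hδ0] at h
    exact h
  calc _ ≤ _ := abs_add_le _ _
    _ ≤ Real.pi / Real.sqrt x + 1 / Real.sqrt x := add_le_add (h1.trans h3) h4
    _ = _ := by ring

theorem besselJ0_eq_half (x : ℝ) :
    besselJ0 x = 2 / Real.pi * ∫ θ in (0 : ℝ)..(Real.pi / 2), Real.cos (x * Real.sin θ) := by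
  have hcont : ∀ a b, IntervalIntegrable (fun θ => Real.cos (x * Real.sin θ)) volume a b :=
    fun a b => Continuous.intervalIntegrable (by fun_prop) _ _
  have h := intervalIntegral.integral_comp_sub_left (a := 0) (b := Real.pi / 2)
    (fun θ => Real.cos (x * Real.sin θ)) Real.pi
  simp only [Real.sin_pi_sub, sub_zero] at h
  rw [show Real.pi - Real.pi / 2 = Real.pi / 2 by ring] at h
  rw [besselJ0, ← intervalIntegral.integral_add_adjacent_intervals (hcont 0 (Real.pi / 2))
    (hcont _ _), ← h]
  ring

/-- The decay of `J₀`. -/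
theorem besselJ0_sq_le {x : ℝ} (hx : 0 < x) : besselJ0 x ^ 2 ≤ 9 / x := by
  rcases le_total x 1 with h1 | h1
  · have h := abs_besselJ0_le_one x
    have h2 : besselJ0 x ^ 2 ≤ 1 := (sq_le_one_iff_abs_le_one _).2 h
    refine h2.trans ?_
    rw [le_div_iff₀ hx]
    linarith
  · have h := abs_integral_cos_mul_sin_half_le h1
    have hpi := Real.pi_gt_three
    have hs0 : 0 < Real.sqrt x := Real.sqrt_pos.2 hx
    have h2 : |besselJ0 x| ≤ 3 / Real.sqrt x := by
      rw [besselJ0_eq_half, abs_mul, abs_of_pos (by positivity : 0 < 2 / Real.pi)]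
      calc _ ≤ 2 / Real.pi * ((1 + Real.pi) / Real.sqrt x) := by gcongr
        _ = (2 * (1 + Real.pi) / Real.pi) / Real.sqrt x := by ring
        _ ≤ 3 / Real.sqrt x := by
          gcongr
          rw [div_le_iff₀ Real.pi_pos]
          linarith
    rw [← sq_abs]
    calc |besselJ0 x| ^ 2 ≤ (3 / Real.sqrt x) ^ 2 := by gcongr
      _ = 9 / x := by rw [div_pow, Real.sq_sqrt hx.le]; norm_num

/-- The diagonal term is at most `1`. On either side of it the decay `9 / (c j)` at distance `j`
sums to `9 / c` times a harmonic number. -/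
theorem sum_range_besselJ0_sq_le {c : ℝ} (hc : 0 < c) {n N : ℕ} (hn : n < N) :
    ∑ m ∈ Finset.range N, besselJ0 (c * |(n : ℝ) - m|) ^ 2
      ≤ 1 + 18 / c * (1 + Real.log N) := by
  have hH : ∀ k ≤ N, ∑ j ∈ Finset.range k, 9 / (c * ((j : ℝ) + 1)) ≤ 9 / c * (1 + Real.log N) := by
    intro k hk
    have h1 : ∑ j ∈ Finset.range k, 9 / (c * ((j : ℝ) + 1)) ≤
        ∑ j ∈ Finset.range N, 9 / (c * ((j : ℝ) + 1)) :=
      Finset.sum_le_sum_of_subset_of_nonneg (Finset.range_mono hk) fun j _ _ => by positivity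
    refine h1.trans ?_
    have h2 := harmonic_le_one_add_log N
    have h3 : ∑ j ∈ Finset.range N, 9 / (c * ((j : ℝ) + 1)) = 9 / c * (harmonic N : ℝ) := by
      rw [harmonic, Rat.cast_sum, Finset.mul_sum]
      refine Finset.sum_congr rfl fun j _ => ?_
      push_cast
      field_simp
    rw [h3]
    gcongr
  rw [← Finset.sum_range_add_sum_Ico _ hn, Finset.sum_range_succ]
  have hA : ∑ m ∈ Finset.range n, besselJ0 (c * |(n : ℝ) - m|) ^ 2 ≤ 9 / c * (1 + Real.log N) := by
    refine le_trans ?_ (hH n hn.le)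
    rw [← Finset.sum_range_reflect]
    refine Finset.sum_le_sum fun j hj => ?_
    have hj := Finset.mem_range.1 hj
    have hcast : ((n - 1 - j : ℕ) : ℝ) = n - 1 - j := by
      rw [Nat.cast_sub (by omega), Nat.cast_sub (by omega)]; simp
    have e : |(n : ℝ) - ((n - 1 - j : ℕ) : ℝ)| = (j : ℝ) + 1 := by
      rw [hcast, show (n : ℝ) - (n - 1 - j) = j + 1 by ring, abs_of_pos (by positivity)]
    rw [e]
    exact besselJ0_sq_le (by positivity)
  have hB : ∑ m ∈ Finset.Ico (n + 1) N, besselJ0 (c * |(n : ℝ) - m|) ^ 2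
      ≤ 9 / c * (1 + Real.log N) := by
    rw [Finset.sum_Ico_eq_sum_range]
    refine le_trans ?_ (hH (N - (n + 1)) (by omega))
    refine Finset.sum_le_sum fun j hj => ?_
    have e : |(n : ℝ) - ((n + 1 + j : ℕ) : ℝ)| = (j : ℝ) + 1 := by
      push_cast
      rw [show (n : ℝ) - (n + 1 + j) = -(j + 1) by ring, abs_neg, abs_of_pos (by positivity)]
    rw [e]
    exact besselJ0_sq_le (by positivity)
  have hD : besselJ0 (c * |(n : ℝ) - n|) ^ 2 ≤ 1 :=
    (sq_le_one_iff_abs_le_one _).2 (abs_besselJ0_le_one _)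
  have : 18 / c * (1 + Real.log N) = 9 / c * (1 + Real.log N) + 9 / c * (1 + Real.log N) := by ring
  linarith

/-- Replacing the logarithm by a power keeps the later series elementary. An exponent `a` is good
enough when `2 (1 + a) - 4 < -1`, that is `a < 1 / 2`. -/
theorem one_add_log_le {N : ℕ} (hN : 1 ≤ N) : 1 + Real.log N ≤ 5 * (N : ℝ) ^ (1 / 4 : ℝ) := by
  have h := Real.log_le_rpow_div (Nat.cast_nonneg N) (by norm_num : (0 : ℝ) < 1 / 4)
  have h1 : 1 ≤ (N : ℝ) ^ (1 / 4 : ℝ) := Real.one_le_rpow (by exact_mod_cast hN) (by norm_num)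
  have : (N : ℝ) ^ (1 / 4 : ℝ) / (1 / 4) = 4 * (N : ℝ) ^ (1 / 4 : ℝ) := by ring
  linarith

/-- The squared Frobenius norm of the Jakes correlation matrix grows slower than `N ^ (3 / 2)`. -/
theorem sum_sum_besselJ0_sq_le {c : ℝ} (hc : 0 < c) (N : ℕ) :
    ∑ n : Fin N, ∑ m : Fin N, besselJ0 (c * |(n : ℝ) - m|) ^ 2
      ≤ (1 + 90 / c) * (N * (N : ℝ) ^ (1 / 4 : ℝ)) := by
  have hrow : ∀ n : Fin N, ∑ m : Fin N, besselJ0 (c * |(n : ℝ) - m|) ^ 2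
      ≤ (1 + 90 / c) * (N : ℝ) ^ (1 / 4 : ℝ) := by
    intro n
    have hN : 1 ≤ N := Nat.one_le_of_lt n.2
    have h1 := sum_range_besselJ0_sq_le hc n.2
    rw [Finset.sum_range] at h1
    have h2 := one_add_log_le hN
    have h3 : 1 ≤ (N : ℝ) ^ (1 / 4 : ℝ) := Real.one_le_rpow (by exact_mod_cast hN) (by norm_num)
    calc _ ≤ _ := h1
      _ ≤ (N : ℝ) ^ (1 / 4 : ℝ) + 18 / c * (5 * (N : ℝ) ^ (1 / 4 : ℝ)) := by gcongr
      _ = _ := by ring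
  calc _ ≤ ∑ _n : Fin N, (1 + 90 / c) * (N : ℝ) ^ (1 / 4 : ℝ) :=
        Finset.sum_le_sum fun n _ => hrow n
    _ = _ := by
      rw [Finset.sum_const, Finset.card_univ, Fintype.card_fin, nsmul_eq_mul]
      ring

end Bessel

end DopplerMIMO

namespace DopplerMIMO

open scoped ComplexOrder

set_option linter.unusedSectionVars false

/-! ### Quadratic forms with an independent random matrix -/

section Moments

variable {ι κ Ω : Type*} [MeasurableSpace Ω] {P : Measure Ω} [Fintype ι] [DecidableEq ι] [Fintype κ]

theorem continuous_quadraticForm_sub (Φ : Matrix ι ι ℂ) {A : (κ → ℂ) → Matrix ι ι ℂ}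
    (hAc : Continuous A) : Continuous fun p : (ι → ℂ) × (κ → ℂ) =>
      (star p.1 ⬝ᵥ (A p.2 *ᵥ p.1)).re - (Φ * A p.2).trace.re := by
  have hA2 : Continuous fun p : (ι → ℂ) × (κ → ℂ) => A p.2 := hAc.comp continuous_snd
  have h1 : Continuous fun p : (ι → ℂ) × (κ → ℂ) => star p.1 ⬝ᵥ (A p.2 *ᵥ p.1) :=
    Continuous.dotProduct continuous_fst.star (hA2.matrix_mulVec continuous_fst)
  have h2 : Continuous fun p : (ι → ℂ) × (κ → ℂ) => (Φ * A p.2).trace :=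
    (continuous_const.matrix_mul hA2).matrix_trace
  exact (Complex.continuous_re.comp h1).sub (Complex.continuous_re.comp h2)

/-- Concentration of a quadratic form whose matrix is an independent random contraction. -/
theorem IsCSCGProcess.fourth_moment_random_quadraticForm {X : ι → Ω → ℂ} {C : ι → ι → ℂ}
    (hX : IsCSCGProcess X C P) {Y : κ → Ω → ℂ} (hY : ∀ k, Measurable (Y k))
    (hXY : IndepFun (fun ω i => X i ω) (fun ω k => Y k ω) P) {A : (κ → ℂ) → Matrix ι ι ℂ}
    (hAc : Continuous A) (hA : ∀ y, (A y).PosSemidef) (hA1 : ∀ y, (1 - A y).PosSemidef) :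
    ∫⁻ ω, ENNReal.ofReal (((star (fun i => X i ω) ⬝ᵥ (A (fun k => Y k ω) *ᵥ fun i => X i ω)).re
      - (Matrix.of C * A (fun k => Y k ω)).trace.re) ^ 4) ∂P
      ≤ ENNReal.ofReal
        (quadConst * ((Matrix.of C * Matrix.of C).trace.re) ^ 2) := by
  have hP := hX.gaussian.isProbabilityMeasure
  set F : (ι → ℂ) × (κ → ℂ) → ENNReal := fun p => ENNReal.ofReal
    (((star p.1 ⬝ᵥ (A p.2 *ᵥ p.1)).re - (Matrix.of C * A p.2).trace.re) ^ 4)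
  have hFm : Measurable F :=
    (((continuous_quadraticForm_sub (Matrix.of C) hAc).pow 4).measurable).ennreal_ofReal
  have hXm : Measurable fun ω i => X i ω := measurable_pi_lambda _ hX.measurable
  have hYm : Measurable fun ω k => Y k ω := measurable_pi_lambda _ hY
  have hprod := (indepFun_iff_map_prod_eq_prod_map_map hXm.aemeasurable hYm.aemeasurable).1 hXY
  have hPX := Measure.isProbabilityMeasure_map hXm.aemeasurable (μ := P)
  have hPY := Measure.isProbabilityMeasure_map hYm.aemeasurable (μ := P)
  calc _ = ∫⁻ p, F p ∂(P.map fun ω => (fun i => X i ω, fun k => Y k ω)) :=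
        (lintegral_map hFm (hXm.prodMk hYm)).symm
    _ = ∫⁻ y, ∫⁻ x, F (x, y) ∂(P.map fun ω i => X i ω) ∂(P.map fun ω k => Y k ω) := by
        rw [hprod, lintegral_prod_symm' _ hFm]
    _ ≤ ∫⁻ _y, ENNReal.ofReal (quadConst * ((Matrix.of C * Matrix.of C).trace.re) ^ 2)
          ∂(P.map fun ω k => Y k ω) := by
        -- By independence the matrix is frozen at `A y` while `X` is integrated. The bound `Tr (Φ A
        -- Φ A) ≤ Tr (Φ Φ)` removes the dependence on `y`.
        refine lintegral_mono fun y => ?_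
        rw [lintegral_map (f := fun x => F (x, y)) (hFm.comp measurable_prodMk_right) hXm]
        refine (hX.fourth_moment_quadraticForm (hA y)).trans (ENNReal.ofReal_le_ofReal ?_)
        refine mul_le_mul_of_nonneg_left ?_ quadConst_nonneg
        refine pow_le_pow_left₀ ?_ (trace_mul_mul_mul_le hX.cov_posSemidef (hA y) (hA1 y)) 2
        refine trace_mul_re_nonneg ?_ (hA y)
        have := (hA y).mul_mul_conjTranspose_same (Matrix.of C)
        rwa [hX.cov_posSemidef.1] at this
    _ = _ := by simp

end Moments

/-! ### Spectral facts and the Schur complement -/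

section SmallLemmas

variable {n m : Type*} [Fintype n] [DecidableEq n] [Fintype m] [DecidableEq m]

/-- For nonnegative eigenvalues the sum of squares is at most the square of the sum. -/
theorem trace_mul_self_le_sq_trace {A : Matrix n n ℂ} (hA : A.PosSemidef) :
    (A * A).trace.re ≤ A.trace.re ^ 2 := by
  have h1 : A.trace.re = ∑ i, hA.1.eigenvalues i := by
    rw [hA.1.trace_eq_sum_eigenvalues, Complex.re_sum]
    rfl
  have h2 : (A * A).trace.re = ∑ i, hA.1.eigenvalues i ^ 2 := by
    have hs := hA.1.spectral_theorem
    rw [Unitary.conjStarAlgAut_apply] at hs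
    have hUU : star (hA.1.eigenvectorUnitary : Matrix n n ℂ) * hA.1.eigenvectorUnitary = 1 :=
      Unitary.star_mul_self_of_mem hA.1.eigenvectorUnitary.2
    set U := (hA.1.eigenvectorUnitary : Matrix n n ℂ)
    set D : Matrix n n ℂ := Matrix.diagonal (RCLike.ofReal ∘ hA.1.eigenvalues)
    have h3 : A * A = U * (D * D) * star U := by
      conv_lhs => rw [hs]
      calc U * D * star U * (U * D * star U) = U * D * (star U * U) * D * star U := by
            simp only [mul_assoc]
        _ = _ := by rw [hUU, mul_one]; simp only [mul_assoc]
    rw [h3, Matrix.trace_mul_comm, ← mul_assoc, hUU, one_mul, Matrix.diagonal_mul_diagonal,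
      Matrix.trace_diagonal, Complex.re_sum]
    refine Finset.sum_congr rfl fun i _ => ?_
    simp [sq]
  rw [h1, h2]
  exact Finset.sum_sq_le_sq_sum_of_nonneg fun i _ => hA.eigenvalues_nonneg i

theorem trace_one_kronecker (A : Matrix n n ℂ) :
    ((1 : Matrix m m ℂ) ⊗ₖ A).trace.re = Fintype.card m * A.trace.re := by
  rw [Matrix.trace_kronecker, Matrix.trace_one, ← Complex.ofReal_natCast, Complex.re_ofReal_mul]

/-- In the eigenbasis the functional calculus acts as `λ ↦ 1 / √λ`, and all eigenvalues are
positive. -/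
theorem cfc_inv_sqrt_spec {W : Matrix n n ℂ} (hW : W.PosDef) :
    (cfc (fun x : ℝ => (Real.sqrt x)⁻¹) W).IsHermitian ∧
    cfc (fun x : ℝ => (Real.sqrt x)⁻¹) W * cfc (fun x : ℝ => (Real.sqrt x)⁻¹) W = W⁻¹ := by
  rw [hW.1.cfc_eq, Matrix.IsHermitian.cfc, Unitary.conjStarAlgAut_apply]
  have hs := hW.1.spectral_theorem
  rw [Unitary.conjStarAlgAut_apply] at hs
  have hUU : star (hW.1.eigenvectorUnitary : Matrix n n ℂ) * hW.1.eigenvectorUnitary = 1 :=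
    Unitary.star_mul_self_of_mem hW.1.eigenvectorUnitary.2
  have hUU' : (hW.1.eigenvectorUnitary : Matrix n n ℂ) * star hW.1.eigenvectorUnitary.1 = 1 :=
    Unitary.mul_star_self_of_mem hW.1.eigenvectorUnitary.2
  set U := (hW.1.eigenvectorUnitary : Matrix n n ℂ)
  set lam := hW.1.eigenvalues
  have hlam : ∀ i, 0 < lam i := fun i => hW.eigenvalues_pos i
  set E : Matrix n n ℂ := Matrix.diagonal (RCLike.ofReal ∘ (fun x : ℝ => (Real.sqrt x)⁻¹) ∘ lam) with hE
  set D : Matrix n n ℂ := Matrix.diagonal (RCLike.ofReal ∘ lam) with hD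
  constructor
  · have hEh : Eᴴ = E := by
      rw [hE, Matrix.diagonal_conjTranspose]
      congr 1
      ext i
      simp
    rw [Matrix.IsHermitian, Matrix.conjTranspose_mul, Matrix.conjTranspose_mul, hEh,
      Matrix.star_eq_conjTranspose, Matrix.conjTranspose_conjTranspose, mul_assoc]
  · symm
    apply Matrix.inv_eq_right_inv
    have hDEE : D * (E * E) = 1 := by
      rw [hE, hD, Matrix.diagonal_mul_diagonal, Matrix.diagonal_mul_diagonal, ← Matrix.diagonal_one]
      congr 1
      ext i
      have h1 := Real.sqrt_pos.2 (hlam i)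
      have h2 := Real.mul_self_sqrt (hlam i).le
      have : lam i * ((Real.sqrt (lam i))⁻¹ * (Real.sqrt (lam i))⁻¹) = 1 := by
        rw [← mul_inv, h2, mul_inv_cancel₀ (hlam i).ne']
      simpa using congrArg (fun x : ℝ => (x : ℂ)) this
    conv_lhs => rw [hs]
    calc U * D * star U * (U * E * star U * (U * E * star U))
        = U * D * (star U * U) * E * (star U * U) * E * star U := by simp only [mul_assoc]
      _ = U * (D * (E * E)) * star U := by rw [hUU, mul_one, mul_one]; simp only [mul_assoc]
      _ = 1 := by rw [hDEE, mul_one, hUU']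

/-- The Schur complement of a regularized joint covariance matrix is positive semidefinite. -/
theorem schur_regularized_posSemidef {A : Matrix m m ℂ} {B : Matrix m n ℂ} {D : Matrix n n ℂ}
    (h : (Matrix.fromBlocks A B Bᴴ D).PosSemidef) {c : ℂ} (hc : 0 < c) :
    (A - B * (D + c • 1)⁻¹ * Bᴴ).PosSemidef := by
  have hD : D.PosSemidef := by
    have := h.submatrix (Sum.inr : n → m ⊕ n)
    have e : (Matrix.fromBlocks A B Bᴴ D).submatrix Sum.inr Sum.inr = D := by
      ext i j; rfl
    rwa [e] at this
  have hDc : (D + c • (1 : Matrix n n ℂ)).PosDef :=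
    (Matrix.PosDef.one.smul hc).posSemidef_add hD
  have hinv : Invertible (D + c • (1 : Matrix n n ℂ)) := hDc.isUnit.invertible
  rw [← Matrix.PosDef.fromBlocks₂₂ A B hDc]
  -- Adding `c` to the lower right block only, a positive semidefinite perturbation, makes that
  -- block invertible and leaves `A` and `B` untouched.
  have h0 : (Matrix.fromBlocks (0 : Matrix m m ℂ) (0 : Matrix m n ℂ) 0 (c • (1 : Matrix n n ℂ))).PosSemidef := by
    have h1 : (Matrix.diagonal (Sum.elim (fun _ : m => (0 : ℂ)) fun _ : n => c)).PosSemidef := by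
      refine Matrix.PosSemidef.diagonal fun i => ?_
      rcases i with i | i
      · simp
      · exact hc.le
    convert h1 using 1
    rw [← Matrix.fromBlocks_diagonal]
    congr 1
    · simp
    · rw [Matrix.smul_one_eq_diagonal]
  have h2 := h.add h0
  rwa [Matrix.fromBlocks_add, add_zero, add_zero, add_zero] at h2

end SmallLemmas

end DopplerMIMO

namespace DopplerMIMO

open scoped ComplexOrder

set_option linter.unusedSectionVars false

/-! ### Covariance matrices of the channel model -/

namespace Params

variable {S : Params} {Ω : Type*} [MeasurableSpace Ω] {P : Measure Ω}
  {h : Fin S.NT → ℕ → ℕ → Ω → ℂ} {z : ℕ → ℕ → Ω → ℂ}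

/-- The antenna offset is smaller than the period `NT + K`, so Euclidean division recovers both
indices. Distinct pilot times are what decorrelates the noise seen by different transmit antennas.
-/
theorem pilotTime_inj (hS : S.Valid) {t t' : Fin S.NT} {n n' : ℕ} :
    S.pilotTime t n = S.pilotTime t' n' ↔ t = t' ∧ n = n' := by
  constructor
  · intro e
    have hK : 0 < S.K := lt_of_lt_of_le hS.one_le_k hS.k_le_K
    have e' : (t : ℕ) + n * (S.NT + S.K) = t' + n' * (S.NT + S.K) := by
      unfold pilotTime at e
      omega
    have ht : (t : ℕ) < S.NT + S.K := by have := t.2; omega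
    have ht' : (t' : ℕ) < S.NT + S.K := by have := t'.2; omega
    have hpos : 0 < S.NT + S.K := by omega
    have h1 := congrArg (· % (S.NT + S.K)) e'
    have h2 := congrArg (· / (S.NT + S.K)) e'
    simp only [Nat.add_mul_mod_self_right, Nat.mod_eq_of_lt ht, Nat.mod_eq_of_lt ht'] at h1
    simp only [Nat.add_mul_div_right _ _ hpos, Nat.div_eq_of_lt ht, Nat.div_eq_of_lt ht',
      zero_add] at h2
    exact ⟨Fin.ext h1, h2⟩
  · rintro ⟨rfl, rfl⟩; rfl

/-- By stationarity the offset of the antenna cancels, so one matrix `R_P` serves all antennas. -/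
theorem rho_pilotTime (t : Fin S.NT) (n m : ℕ) :
    S.rho (S.pilotTime t n) (S.pilotTime t m) = besselJ0
      (2 * Real.pi * S.fD * |(n : ℝ) - (m : ℝ)| * (((S.NT : ℝ) + S.K) * S.T)) := by
  rw [rho, pilotTime, pilotTime]
  congr 1
  push_cast
  have e : ((t : ℕ) : ℝ) + 1 + n * (S.NT + S.K) - (t + 1 + m * (S.NT + S.K))
      = (n - m) * (S.NT + S.K) := by ring
  rw [e, abs_mul, abs_of_nonneg (by positivity : (0 : ℝ) ≤ S.NT + S.K)]
  ring

theorem rho_dataTime (n m : ℕ) :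
    S.rho (S.dataTime n) (S.dataTime m) = besselJ0
      (2 * Real.pi * S.fD * (((S.NT : ℝ) + S.K) * S.T) * |(n : ℝ) - (m : ℝ)|) := by
  rw [rho, dataTime, dataTime]
  congr 1
  push_cast
  have e : (S.NT : ℝ) + S.k + n * (S.NT + S.K) - (S.NT + S.k + m * (S.NT + S.K))
      = (n - m) * (S.NT + S.K) := by ring
  rw [e, abs_mul, abs_of_nonneg (by positivity : (0 : ℝ) ≤ S.NT + S.K)]
  ring

theorem rho_comm (m n : ℕ) : S.rho m n = S.rho n m := by
  rw [rho, rho, abs_sub_comm]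

theorem gammaP_pos (hS : S.Valid) : 0 < S.gammaP := div_pos hS.EP_pos (pow_pos hS.sigma_pos 2)

theorem gammaC_pos (hS : S.Valid) : 0 < S.gammaC := div_pos hS.EC_pos (pow_pos hS.sigma_pos 2)

/-- This is the joint covariance matrix of one channel at data and pilot times. Positivity of the
Jakes kernel comes from the given process, not from an analysis of `J₀`. -/
theorem fromBlocks_rho_posSemidef (hhz : S.IsChannel P h z) (N : ℕ) (t : Fin S.NT) :
    (Matrix.fromBlocks (S.Rk N) (S.RPtk N t) (S.RPtk N t)ᴴ (S.RP N)).PosSemidef := by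
  have hX := (hhz.channel t 0).comp (Sum.elim (fun n : Fin N => S.dataTime n)
    fun n : Fin N => S.pilotTime t n)
  convert hX.cov_posSemidef using 1
  ext (i | i) (j | j)
  · rfl
  · rfl
  · simp [RPtk, rho_comm]
  · simp [RP, rho_pilotTime]

theorem RP_posSemidef (hhz : S.IsChannel P h z) (N : ℕ) (t : Fin S.NT) : (S.RP N).PosSemidef := by
  have hX := (hhz.channel t 0).comp (fun n : Fin N => S.pilotTime t n)
  convert hX.cov_posSemidef using 1
  ext i j
  simp [RP, rho_pilotTime]

/-- The covariance matrix of the MMSE channel estimate. -/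
noncomputable def estCov (S : Params) (N : ℕ) (t : Fin S.NT) : Matrix (Fin N) (Fin N) ℂ :=
  S.RPtk N t * (S.RP N + ((1 / S.gammaP : ℝ) : ℂ) • 1)⁻¹ * (S.RPtk N t)ᴴ

theorem regularized_RP_posDef (hS : S.Valid) (hhz : S.IsChannel P h z) (N : ℕ) (t : Fin S.NT) :
    (S.RP N + ((1 / S.gammaP : ℝ) : ℂ) • 1).PosDef :=
  (Matrix.PosDef.one.smul (Complex.zero_lt_real.2 (one_div_pos.2 (gammaP_pos hS)))).posSemidef_add
    (RP_posSemidef hhz N t)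

theorem estCov_posSemidef (hS : S.Valid) (hhz : S.IsChannel P h z) (N : ℕ) (t : Fin S.NT) :
    (S.estCov N t).PosSemidef :=
  (regularized_RP_posDef hS hhz N t).inv.posSemidef.mul_mul_conjTranspose_same _

theorem Rtilde_posSemidef (hS : S.Valid) (hhz : S.IsChannel P h z) (N : ℕ) (t : Fin S.NT) :
    (S.Rtilde N t).PosSemidef :=
  schur_regularized_posSemidef (fromBlocks_rho_posSemidef hhz N t)
    (Complex.zero_lt_real.2 (one_div_pos.2 (gammaP_pos hS)))

theorem Rk_sub_estCov_posSemidef (hS : S.Valid) (hhz : S.IsChannel P h z) (N : ℕ) (t : Fin S.NT) :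
    (S.Rk N - S.estCov N t).PosSemidef :=
  Rtilde_posSemidef hS hhz N t

theorem W_posDef (hS : S.Valid) (hhz : S.IsChannel P h z) (N : ℕ) : (S.W N).PosDef :=
  (Matrix.PosDef.one.smul (Complex.zero_lt_real.2 (one_div_pos.2 (gammaC_pos hS)))).posSemidef_add
    (Matrix.posSemidef_sum _ fun t _ => Rtilde_posSemidef hS hhz N t)

theorem WInvSqrt_isHermitian (hS : S.Valid) (hhz : S.IsChannel P h z) (N : ℕ) :
    (S.WInvSqrt N)ᴴ = S.WInvSqrt N :=
  (cfc_inv_sqrt_spec (W_posDef hS hhz N)).1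

theorem WInvSqrt_mul_self (hS : S.Valid) (hhz : S.IsChannel P h z) (N : ℕ) :
    S.WInvSqrt N * S.WInvSqrt N = (S.W N)⁻¹ :=
  (cfc_inv_sqrt_spec (W_posDef hS hhz N)).2

/-- `γ_C⁻¹ W⁻¹` is a contraction. -/
theorem one_sub_smul_W_inv_posSemidef (hS : S.Valid) (hhz : S.IsChannel P h z) (N : ℕ) :
    (1 - ((1 / S.gammaC : ℝ) : ℂ) • (S.W N)⁻¹).PosSemidef := by
  have hg := gammaC_pos hS
  have hA : (((1 / S.gammaC : ℝ) : ℂ) • (1 : Matrix (Fin N) (Fin N) ℂ)).PosDef :=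
    Matrix.PosDef.one.smul (Complex.zero_lt_real.2 (one_div_pos.2 hg))
  have h1 := inv_sub_inv_posSemidef (B := S.W N) hA (by
    rw [W, add_sub_cancel_right]
    exact Matrix.posSemidef_sum _ fun t _ => Rtilde_posSemidef hS hhz N t)
  have h2 : (((1 / S.gammaC : ℝ) : ℂ) • (1 : Matrix (Fin N) (Fin N) ℂ))⁻¹
      = ((S.gammaC : ℝ) : ℂ) • 1 := by
    refine Matrix.inv_eq_right_inv ?_
    rw [Matrix.smul_mul, Matrix.mul_smul, smul_smul, ← Complex.ofReal_mul,
      one_div_mul_cancel hg.ne', one_mul]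
    simp
  rw [h2] at h1
  have h3 := h1.smul (Complex.zero_le_real.2 (one_div_pos.2 hg).le)
  rwa [smul_sub, smul_smul, ← Complex.ofReal_mul, one_div_mul_cancel hg.ne', Complex.ofReal_one,
    one_smul] at h3

/-- The covariance matrix of the whitened channel estimate at one receive antenna. -/
noncomputable def whiteCov (S : Params) (N : ℕ) (t : Fin S.NT) : Matrix (Fin N) (Fin N) ℂ :=
  S.WInvSqrt N * S.estCov N t * S.WInvSqrt N

theorem whiteCov_posSemidef (hS : S.Valid) (hhz : S.IsChannel P h z) (N : ℕ) (t : Fin S.NT) :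
    (S.whiteCov N t).PosSemidef := by
  have := (estCov_posSemidef hS hhz N t).mul_mul_conjTranspose_same (S.WInvSqrt N)
  rwa [WInvSqrt_isHermitian hS hhz] at this

/-- By cyclicity the trace is `Tr (C W⁻¹)` with `C` the estimate covariance. Here `W⁻¹ ≤ γ_C`, `C ≤
R_k` because the error covariance is positive semidefinite, and the diagonal of `R_k` is at most
`1`. -/
theorem trace_whiteCov_le (hS : S.Valid) (hhz : S.IsChannel P h z) (N : ℕ) (t : Fin S.NT) :
    (S.whiteCov N t).trace.re ≤ S.gammaC * N := by
  have hg := gammaC_pos hS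
  have h1 : (S.whiteCov N t).trace
      = (S.gammaC : ℂ) * (S.estCov N t * (((1 / S.gammaC : ℝ) : ℂ) • (S.W N)⁻¹)).trace := by
    rw [Matrix.mul_smul, Matrix.trace_smul, smul_eq_mul, ← mul_assoc, ← Complex.ofReal_mul,
      mul_one_div_cancel hg.ne', Complex.ofReal_one, one_mul, whiteCov, mul_assoc,
      Matrix.trace_mul_comm, mul_assoc, WInvSqrt_mul_self hS hhz]
  rw [h1, Complex.re_ofReal_mul]
  refine mul_le_mul_of_nonneg_left ?_ hg.le
  have h2 := trace_mul_re_mono (estCov_posSemidef hS hhz N t)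
    (one_sub_smul_W_inv_posSemidef hS hhz N)
  rw [mul_one] at h2
  refine h2.trans ?_
  have h3 := (Complex.nonneg_iff.1 (Rk_sub_estCov_posSemidef hS hhz N t).trace_nonneg).1
  rw [Matrix.trace_sub, Complex.sub_re] at h3
  have h4 : (S.Rk N).trace.re ≤ N := by
    rw [Matrix.trace, Complex.re_sum]
    calc _ ≤ ∑ _n : Fin N, (1 : ℝ) := Finset.sum_le_sum fun n _ => by
          simp only [Matrix.diag_apply, Rk, Matrix.of_apply, Complex.ofReal_re]
          exact (le_abs_self _).trans (abs_besselJ0_le_one _)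
      _ = N := by simp
  linarith

/-- The exponent-`5 / 4` bound on the squared Frobenius norm of the whitened covariance. -/
theorem exists_trace_whiteCov_sq_le (hS : S.Valid) (hhz : S.IsChannel P h z) :
    ∃ c : ℝ, 0 ≤ c ∧ ∀ (N : ℕ) (t : Fin S.NT), (S.whiteCov N t * S.whiteCov N t).trace.re
      ≤ c * (N * (N : ℝ) ^ (1 / 4 : ℝ)) := by
  set a : ℝ := 2 * Real.pi * S.fD * (((S.NT : ℝ) + S.K) * S.T) with ha
  have hK : (0 : ℝ) < S.K := by
    have := lt_of_lt_of_le hS.one_le_k hS.k_le_K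
    exact_mod_cast this
  have ha0 : 0 < a := by
    have := hS.fD_pos
    have := hS.T_pos
    have := Real.pi_pos
    positivity
  have hg := gammaC_pos hS
  refine ⟨S.gammaC ^ 2 * (1 + 90 / a), by positivity, fun N t => ?_⟩
  set C := S.estCov N t with hC
  set G := ((1 / S.gammaC : ℝ) : ℂ) • (S.W N)⁻¹ with hG
  have hCps := estCov_posSemidef hS hhz N t
  have hGps : G.PosSemidef :=
    (W_posDef hS hhz N).inv.posSemidef.smul (Complex.zero_le_real.2 (one_div_pos.2 hg).le)
  have hWG : (S.W N)⁻¹ = (S.gammaC : ℂ) • G := by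
    rw [hG, smul_smul, ← Complex.ofReal_mul, mul_one_div_cancel hg.ne', Complex.ofReal_one,
      one_smul]
  have h1 : (S.whiteCov N t * S.whiteCov N t).trace
      = ((S.gammaC ^ 2 : ℝ) : ℂ) * (C * G * C * G).trace := by
    have e1 : (S.whiteCov N t * S.whiteCov N t).trace
        = (C * (S.W N)⁻¹ * C * (S.W N)⁻¹).trace := by
      rw [← WInvSqrt_mul_self hS hhz, whiteCov, mul_assoc (S.WInvSqrt N), mul_assoc (S.WInvSqrt N),
        Matrix.trace_mul_comm]
      simp only [mul_assoc]
      rfl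
    rw [e1, hWG]
    simp only [Matrix.mul_smul, Matrix.smul_mul, smul_smul, Matrix.trace_smul, smul_eq_mul]
    rw [← sq, ← Complex.ofReal_pow]
  -- The chain is `Tr (C G C G) ≤ Tr (C C) ≤ Tr (C R_k) ≤ Tr (R_k R_k)`, using `0 ≤ G ≤ 1` and then
  -- `0 ≤ C ≤ R_k` twice. The last trace is the sum of squared Bessel values.
  have h2 := trace_mul_mul_mul_le hCps hGps (one_sub_smul_W_inv_posSemidef hS hhz N)
  have h3 := trace_mul_re_mono hCps (Rk_sub_estCov_posSemidef hS hhz N t)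
  have hRk : (S.Rk N).PosSemidef := by
    simpa using (Rk_sub_estCov_posSemidef hS hhz N t).add hCps
  have h4 := trace_mul_re_mono hRk (Rk_sub_estCov_posSemidef hS hhz N t)
  rw [Matrix.trace_mul_comm] at h4
  have h5 : (S.Rk N * S.Rk N).trace.re
      = ∑ n : Fin N, ∑ m : Fin N, besselJ0 (a * |(n : ℝ) - m|) ^ 2 := by
    rw [Matrix.trace, Complex.re_sum]
    refine Finset.sum_congr rfl fun n _ => ?_
    rw [Matrix.diag_apply, Matrix.mul_apply, Complex.re_sum]
    refine Finset.sum_congr rfl fun m _ => ?_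
    simp only [Rk, Matrix.of_apply]
    rw [← Complex.ofReal_mul, Complex.ofReal_re, rho_comm (S.dataTime m), ← sq, rho_dataTime]
  have h6 := sum_sum_besselJ0_sq_le ha0 N
  rw [h1, Complex.re_ofReal_mul, mul_assoc (S.gammaC ^ 2)]
  refine mul_le_mul_of_nonneg_left ?_ (by positivity)
  linarith

end Params

end DopplerMIMO

namespace DopplerMIMO

open scoped ComplexOrder

set_option linter.unusedSectionVars false

/-! ### The law of the whitened channel estimates -/

namespace Params

variable {S : Params} {Ω : Type*} [MeasurableSpace Ω] {P : Measure Ω}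
  {h : Fin S.NT → ℕ → ℕ → Ω → ℂ} {z : ℕ → ℕ → Ω → ℂ}

/-- The covariance matrix of the received pilots at one receive antenna. -/
noncomputable def pilotCov (S : Params) (N : ℕ) : Matrix (Fin N) (Fin N) ℂ :=
  (S.EP : ℂ) • (S.XP N * S.RP N * (S.XP N)ᴴ) + (S.sigma : ℂ) ^ 2 • 1

/-- The matrix of the whitened MMSE estimator. -/
noncomputable def whiteEst (S : Params) (N : ℕ) (t : Fin S.NT) : Matrix (Fin N) (Fin N) ℂ :=
  S.WInvSqrt N * ((Real.sqrt S.EP : ℂ) • (S.RPtk N t * (S.XP N)ᴴ * (S.pilotCov N)⁻¹))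

theorem XP_mul_conjTranspose (hS : S.Valid) (N : ℕ) : S.XP N * (S.XP N)ᴴ = 1 := by
  rw [XP, Matrix.diagonal_conjTranspose, Matrix.diagonal_mul_diagonal, ← Matrix.diagonal_one]
  congr 1
  ext n
  rw [Pi.star_apply, RCLike.star_def, Complex.mul_conj, Complex.normSq_eq_norm_sq, hS.pilot_unit]
  simp

theorem XP_conjTranspose_mul (hS : S.Valid) (N : ℕ) : (S.XP N)ᴴ * S.XP N = 1 :=
  mul_eq_one_comm.1 (XP_mul_conjTranspose hS N)

/-- Pilots of unit modulus make `X_P` unitary, so it factors out of the noise term as well; this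
brings the estimator to the regularized inverse of `R_P` used in `estCov`. -/
theorem pilotCov_mul_aux (hS : S.Valid) (N : ℕ) :
    S.pilotCov N = S.XP N * ((S.EP : ℂ) • (S.RP N + ((1 / S.gammaP : ℝ) : ℂ) • 1)) * (S.XP N)ᴴ := by
  have hE : (S.EP : ℂ) * ((1 / S.gammaP : ℝ) : ℂ) = (S.sigma : ℂ) ^ 2 := by
    rw [← Complex.ofReal_mul, ← Complex.ofReal_pow, gammaP]
    congr 1
    have := hS.EP_pos
    have := hS.sigma_pos
    field_simp
  rw [smul_add, smul_smul, hE, Matrix.mul_add, Matrix.add_mul, Matrix.mul_smul, Matrix.smul_mul,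
    Matrix.mul_smul, Matrix.smul_mul, mul_one, XP_mul_conjTranspose hS, pilotCov]

theorem pilotCov_inv (hS : S.Valid) (hhz : S.IsChannel P h z) (N : ℕ) (t : Fin S.NT) :
    (S.pilotCov N)⁻¹ = S.XP N *
      (((S.EP⁻¹ : ℝ) : ℂ) • (S.RP N + ((1 / S.gammaP : ℝ) : ℂ) • 1)⁻¹) * (S.XP N)ᴴ := by
  have hu := (Matrix.isUnit_iff_isUnit_det _).1 (regularized_RP_posDef hS hhz N t).isUnit
  refine Matrix.inv_eq_right_inv ?_
  rw [pilotCov_mul_aux hS]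
  set D := S.RP N + ((1 / S.gammaP : ℝ) : ℂ) • 1
  calc S.XP N * ((S.EP : ℂ) • D) * (S.XP N)ᴴ * (S.XP N * (((S.EP⁻¹ : ℝ) : ℂ) • D⁻¹) * (S.XP N)ᴴ)
      = S.XP N * ((S.EP : ℂ) • D) * ((S.XP N)ᴴ * S.XP N) * (((S.EP⁻¹ : ℝ) : ℂ) • D⁻¹) * (S.XP N)ᴴ := by
        simp only [mul_assoc]
    _ = S.XP N * (((S.EP : ℂ) * ((S.EP⁻¹ : ℝ) : ℂ)) • (D * D⁻¹)) * (S.XP N)ᴴ := by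
        rw [XP_conjTranspose_mul hS, mul_one]
        simp only [Matrix.smul_mul, Matrix.mul_smul, smul_smul, mul_assoc]
        rw [mul_comm]
    _ = 1 := by
        rw [← Complex.ofReal_mul, mul_inv_cancel₀ hS.EP_pos.ne', Complex.ofReal_one, one_smul,
          Matrix.mul_nonsing_inv _ hu, mul_one, XP_mul_conjTranspose hS]

/-- The inner factor `M⁻¹ M M⁻¹`, with `M` the pilot covariance, collapses to `M⁻¹`, and then the
pilots cancel by unitarity. -/
theorem whiteEst_mul_pilotCov_mul (hS : S.Valid) (hhz : S.IsChannel P h z) (N : ℕ) (t : Fin S.NT) :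
    S.whiteEst N t * S.pilotCov N * (S.whiteEst N t)ᴴ = S.whiteCov N t := by
  have hD := regularized_RP_posDef hS hhz N t
  have hM : (S.pilotCov N).IsHermitian := by
    rw [pilotCov_mul_aux hS]
    refine Matrix.isHermitian_mul_mul_conjTranspose _ ?_
    rw [Matrix.IsHermitian, Matrix.conjTranspose_smul, hD.1]
    simp
  have hMi : ((S.pilotCov N)⁻¹)ᴴ = (S.pilotCov N)⁻¹ := hM.inv
  have hMu : IsUnit (S.pilotCov N).det := by
    have hDu := (Matrix.isUnit_iff_isUnit_det _).1 hD.isUnit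
    have hEP : (S.EP : ℂ) ≠ 0 := Complex.ofReal_ne_zero.2 hS.EP_pos.ne'
    have hX := congrArg Matrix.det (XP_mul_conjTranspose hS N)
    rw [Matrix.det_mul, Matrix.det_one] at hX
    rw [pilotCov_mul_aux hS, Matrix.det_mul, Matrix.det_mul, Matrix.det_smul, mul_right_comm, hX,
      one_mul]
    exact ((isUnit_iff_ne_zero.2 hEP).pow _).mul hDu
  have hs : (Real.sqrt S.EP : ℂ) * (Real.sqrt S.EP : ℂ) = S.EP := by
    rw [← Complex.ofReal_mul, Real.mul_self_sqrt hS.EP_pos.le]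
  rw [whiteEst, Matrix.conjTranspose_mul, Matrix.conjTranspose_smul, Matrix.conjTranspose_mul,
    Matrix.conjTranspose_mul, Matrix.conjTranspose_conjTranspose, hMi,
    WInvSqrt_isHermitian hS hhz, RCLike.star_def, Complex.conj_ofReal]
  calc S.WInvSqrt N * ((Real.sqrt S.EP : ℂ) • (S.RPtk N t * (S.XP N)ᴴ * (S.pilotCov N)⁻¹))
        * S.pilotCov N * ((Real.sqrt S.EP : ℂ) • ((S.pilotCov N)⁻¹ * (S.XP N * (S.RPtk N t)ᴴ))
          * S.WInvSqrt N)
      = ((Real.sqrt S.EP : ℂ) * (Real.sqrt S.EP : ℂ)) • (S.WInvSqrt N * (S.RPtk N t * (S.XP N)ᴴ *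
          ((S.pilotCov N)⁻¹ * S.pilotCov N) * (S.pilotCov N)⁻¹ * S.XP N * (S.RPtk N t)ᴴ)
          * S.WInvSqrt N) := by
        simp only [Matrix.mul_smul, Matrix.smul_mul, smul_smul, mul_assoc]
    _ = S.whiteCov N t := by
        rw [hs, Matrix.nonsing_inv_mul _ hMu, mul_one, pilotCov_inv hS hhz N t, whiteCov, estCov]
        set D := S.RP N + ((1 / S.gammaP : ℝ) : ℂ) • 1
        have e : S.RPtk N t * (S.XP N)ᴴ * (S.XP N * (((S.EP⁻¹ : ℝ) : ℂ) • D⁻¹) * (S.XP N)ᴴ) *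
            S.XP N * (S.RPtk N t)ᴴ = ((S.EP⁻¹ : ℝ) : ℂ) • (S.RPtk N t * D⁻¹ * (S.RPtk N t)ᴴ) := by
          calc _ = S.RPtk N t * ((S.XP N)ᴴ * S.XP N) * (((S.EP⁻¹ : ℝ) : ℂ) • D⁻¹) *
                ((S.XP N)ᴴ * S.XP N) * (S.RPtk N t)ᴴ := by simp only [mul_assoc]
            _ = _ := by
                rw [XP_conjTranspose_mul hS, mul_one, mul_one, Matrix.mul_smul, Matrix.smul_mul]
        rw [e, Matrix.mul_smul, Matrix.smul_mul, smul_smul, ← Complex.ofReal_mul,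
          mul_inv_cancel₀ hS.EP_pos.ne', Complex.ofReal_one, one_smul]

theorem hBreve_apply (N NR : ℕ) (t : Fin S.NT) (ω : Ω) (i : Fin NR × Fin N) :
    S.hBreve h z N NR t ω i = ∑ j, S.whiteEst N t i.2 j * S.yP h z N t i.1 ω j := by
  have e1 : S.hBreve h z N NR t ω i = (S.WInvSqrt N *ᵥ S.hHatR h z N t i.1 ω) i.2 := by
    obtain ⟨r, n⟩ := i
    simp only [hBreve, hHat, Matrix.mulVec, dotProduct, Matrix.kroneckerMap_apply,
      Fintype.sum_prod_type, Matrix.one_apply, ite_mul, one_mul, zero_mul]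
    rw [Finset.sum_eq_single r]
    · simp
    · intro b _ hb
      simp [hb.symm]
    · simp
  rw [e1, hHatR, Matrix.mulVec_mulVec]
  rfl

/-- The received pilots form a circularly symmetric Gaussian process. -/
theorem isCSCGProcess_yP (hS : S.Valid) (hhz : S.IsChannel P h z) (N : ℕ) :
    IsCSCGProcess (fun (p : Fin S.NT × ℕ × Fin N) ω => S.yP h z N p.1 p.2.1 ω p.2.2)
      (fun p q => if p.1 = q.1 ∧ p.2.1 = q.2.1 then S.pilotCov N p.2.2 q.2.2 else 0) P := by
  have hbase := IsCSCGProcess.joint (P := P)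
    (Y := (Sum.elim (fun p : Fin S.NT × ℕ => h p.1 p.2) z : (Fin S.NT × ℕ) ⊕ ℕ → ℕ → Ω → ℂ))
    (D := Sum.elim (fun _ m n => (S.rho m n : ℂ))
      (fun _ m n => if m = n then (S.sigma : ℂ) ^ 2 else 0))
    (by rintro (p | r); exacts [hhz.channel p.1 p.2, hhz.noise r])
    (by
      convert hhz.indep using 1
      ext (p | r) <;> rfl)
  -- Each received pilot combines two entries of the joint process: the channel (`true`) and the
  -- noise (`false`). The noise at a receive antenna is shared by all transmit antennas, so its
  -- decorrelation across them comes from the distinct pilot times.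
  have hlin := hbase.linearComb (κ := Fin S.NT × ℕ × Fin N)
    (fun p (b : Bool) => cond b (Sum.inl (p.1, p.2.1), S.pilotTime p.1 p.2.2)
      (Sum.inr p.2.1, S.pilotTime p.1 p.2.2))
    (fun p (b : Bool) => cond b ((Real.sqrt S.EP : ℂ) * S.pilot p.2.2) 1)
  have hcov := hlin.congr_cov
    (C' := fun p q => if p.1 = q.1 ∧ p.2.1 = q.2.1 then S.pilotCov N p.2.2 q.2.2 else 0) (by
      rintro ⟨t, r, n⟩ ⟨t', r', n'⟩
      simp only [Fintype.sum_bool, cond_true, cond_false, Sum.elim_inl, Sum.elim_inr,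
        reduceCtorEq, if_false, mul_zero, add_zero, zero_add, Sum.inl.injEq, Sum.inr.injEq,
        Prod.mk.injEq, pilotTime_inj hS, map_one, mul_one, one_mul]
      have hs : (Real.sqrt S.EP : ℂ) * (Real.sqrt S.EP : ℂ) = S.EP := by
        rw [← Complex.ofReal_mul, Real.mul_self_sqrt hS.EP_pos.le]
      by_cases htr : t = t' ∧ r = r'
      · obtain ⟨rfl, rfl⟩ := htr
        have hX : (S.XP N * S.RP N * (S.XP N)ᴴ) n n'
            = S.pilot n * (S.rho (S.pilotTime t n) (S.pilotTime t n') : ℂ) * conj (S.pilot n') := by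
          rw [XP, Matrix.diagonal_conjTranspose, Matrix.mul_diagonal, Matrix.diagonal_mul,
            rho_pilotTime]
          rfl
        simp only [and_self, if_true, true_and, pilotCov, Matrix.add_apply, Matrix.smul_apply,
          Matrix.one_apply, smul_eq_mul, hX, map_mul, Complex.conj_ofReal, Fin.val_inj, mul_ite,
          mul_one, mul_zero]
        congr 1
        rw [← hs]
        ring
      · rw [if_neg htr, if_neg htr, mul_zero, zero_add]
        split_ifs with h1 h2
        · exact absurd ⟨h2.1, h1⟩ htr
        · rfl
        · rfl)
  convert hcov using 1
  ext p ω
  simp [yP, XP, Matrix.mulVec_diagonal, mul_assoc]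

/-- The whitened channel estimates form a circularly symmetric Gaussian process, independent
across the transmit and the receive antennas. -/
theorem isCSCGProcess_hBreve (hS : S.Valid) (hhz : S.IsChannel P h z) (N NR : ℕ) :
    IsCSCGProcess (fun (p : Fin S.NT × (Fin NR × Fin N)) ω => S.hBreve h z N NR p.1 ω p.2)
      (fun p q => if p.1 = q.1 then ((1 : Matrix (Fin NR) (Fin NR) ℂ) ⊗ₖ S.whiteCov N p.1) p.2 q.2
        else 0) P := by
  have hlin := (isCSCGProcess_yP hS hhz N).linearComb (κ := Fin S.NT × (Fin NR × Fin N))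
    (fun p (j : Fin N) => (p.1, (p.2.1 : ℕ), j)) (fun p j => S.whiteEst N p.1 p.2.2 j)
  have hcov := hlin.congr_cov
    (C' := fun p q => if p.1 = q.1 then
      ((1 : Matrix (Fin NR) (Fin NR) ℂ) ⊗ₖ S.whiteCov N p.1) p.2 q.2 else 0) (by
      rintro ⟨t, r, n⟩ ⟨t', r', n'⟩
      simp only [Fin.val_inj, Matrix.kroneckerMap_apply, Matrix.one_apply]
      by_cases ht : t = t'
      · subst ht
        by_cases hr : r = r'
        · subst hr
          simp only [and_self, if_true, one_mul]
          rw [← whiteEst_mul_pilotCov_mul hS hhz N t, Matrix.mul_apply]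
          simp only [Matrix.mul_apply, Matrix.conjTranspose_apply, RCLike.star_def, Finset.sum_mul]
          rw [Finset.sum_comm]
          refine Finset.sum_congr rfl fun k _ => Finset.sum_congr rfl fun l _ => ?_
          ring
        · simp [hr]
      · simp [ht])
  convert hcov using 1
  ext p ω
  rw [hBreve_apply]

theorem isCSCGProcess_hBreve_single (hS : S.Valid) (hhz : S.IsChannel P h z) (N NR : ℕ)
    (t : Fin S.NT) :
    IsCSCGProcess (fun (i : Fin NR × Fin N) ω => S.hBreve h z N NR t ω i)
      (fun i j => ((1 : Matrix (Fin NR) (Fin NR) ℂ) ⊗ₖ S.whiteCov N t) i j) P :=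
  ((isCSCGProcess_hBreve hS hhz N NR).comp fun i => (t, i)).congr_cov fun i j => by simp

/-- The identity factor reflects independence across receive antennas. It makes `Tr Φ` and `Tr Φ²`
both linear in `NR`, the source of all gains in `NR`. -/
theorem Phi_eq (hS : S.Valid) (hhz : S.IsChannel P h z) (N NR : ℕ) (t : Fin S.NT) :
    S.Phi h z P N NR t = (1 : Matrix (Fin NR) (Fin NR) ℂ) ⊗ₖ S.whiteCov N t := by
  have hX := isCSCGProcess_hBreve_single hS hhz N NR t
  ext i j
  rw [Phi, covMatrix, Matrix.of_apply]
  have h0 := fun i => hX.mean_zero i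
  simp only [h0, sub_zero]
  exact hX.covariance i j

theorem Phi_posSemidef (hS : S.Valid) (hhz : S.IsChannel P h z) (N NR : ℕ) (t : Fin S.NT) :
    (S.Phi h z P N NR t).PosSemidef := by
  rw [Phi_eq hS hhz]
  exact (isCSCGProcess_hBreve_single hS hhz N NR t).cov_posSemidef

theorem trace_Phi (hS : S.Valid) (hhz : S.IsChannel P h z) (N NR : ℕ) (t : Fin S.NT) :
    (S.Phi h z P N NR t).trace.re = NR * (S.whiteCov N t).trace.re := by
  rw [Phi_eq hS hhz, trace_one_kronecker, Fintype.card_fin]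

theorem trace_Phi_sq (hS : S.Valid) (hhz : S.IsChannel P h z) (N NR : ℕ) (t : Fin S.NT) :
    (S.Phi h z P N NR t * S.Phi h z P N NR t).trace.re
      = NR * (S.whiteCov N t * S.whiteCov N t).trace.re := by
  rw [Phi_eq hS hhz, ← Matrix.mul_kronecker_mul, one_mul, trace_one_kronecker, Fintype.card_fin]

/-- Whitening of the output SINR. -/
theorem gammaMMSE_eq (hS : S.Valid) (hhz : S.IsChannel P h z) (N NR : ℕ) (t : Fin S.NT) (ω : Ω) :
    S.gammaMMSE h z N NR t ω = (star (S.hBreve h z N NR t ω) ⬝ᵥ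
      ((S.HBreveMinus h z N NR t ω * (S.HBreveMinus h z N NR t ω)ᴴ + 1)⁻¹ *ᵥ
        S.hBreve h z N NR t ω)).re := by
  set V : Matrix (Fin NR × Fin N) (Fin NR × Fin N) ℂ :=
    (1 : Matrix (Fin NR) (Fin NR) ℂ) ⊗ₖ S.WInvSqrt N with hV
  have hWd := W_posDef hS hhz N
  have hWu := (Matrix.isUnit_iff_isUnit_det _).1 hWd.isUnit
  have hVh : Vᴴ = V := by
    rw [hV, Matrix.conjTranspose_kronecker, Matrix.conjTranspose_one, WInvSqrt_isHermitian hS hhz]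
  have hVV : V * V * ((1 : Matrix (Fin NR) (Fin NR) ℂ) ⊗ₖ S.W N) = 1 := by
    rw [hV, ← Matrix.mul_kronecker_mul, ← Matrix.mul_kronecker_mul, WInvSqrt_mul_self hS hhz,
      Matrix.nonsing_inv_mul _ hWu, one_mul, one_mul, Matrix.one_kronecker_one]
  -- A one-sided inverse of a square matrix is two-sided, so the factors of `V * (V * W) = 1` may be
  -- swapped cyclically.
  have hVW : V * ((1 : Matrix (Fin NR) (Fin NR) ℂ) ⊗ₖ S.W N) * V = 1 := by
    rw [mul_assoc] at hVV
    exact mul_eq_one_comm.1 hVV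
  have hVu : IsUnit V := by
    rw [mul_assoc] at hVV
    exact IsUnit.of_mul_eq_one _ hVV
  have hVd := (Matrix.isUnit_iff_isUnit_det _).1 hVu
  set H := S.HHatMinus h z N NR t ω with hH
  have hHb : S.HBreveMinus h z N NR t ω = V * H := by
    ext i l
    rfl
  have hres : V * H * (V * H)ᴴ + 1 = V * (H * Hᴴ + (1 : Matrix (Fin NR) (Fin NR) ℂ) ⊗ₖ S.W N) * V := by
    rw [Matrix.mul_add, Matrix.add_mul, hVW, Matrix.conjTranspose_mul, hVh]
    simp only [Matrix.mul_assoc]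
  have hinv : V * (V * H * (V * H)ᴴ + 1)⁻¹ * V
      = (H * Hᴴ + (1 : Matrix (Fin NR) (Fin NR) ℂ) ⊗ₖ S.W N)⁻¹ := by
    rw [hres, Matrix.mul_inv_rev, Matrix.mul_inv_rev]
    simp only [← mul_assoc]
    rw [Matrix.mul_nonsing_inv _ hVd, one_mul, mul_assoc, Matrix.nonsing_inv_mul _ hVd, mul_one]
  rw [gammaMMSE, ← hinv, hHb]
  have hb : S.hBreve h z N NR t ω = V *ᵥ S.hHat h z N NR t ω := rfl
  rw [hb, Matrix.star_mulVec, hVh, ← Matrix.dotProduct_mulVec, Matrix.mulVec_mulVec,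
    Matrix.mulVec_mulVec, mul_assoc V]

end Params

end DopplerMIMO

namespace DopplerMIMO

/-! ### Almost sure convergence over pairs and the comparison of logarithms -/

section Limits

/-- A finite set of pairs has bounded products. Hence Borel-Cantelli over the countable set of all
pairs settles the two-parameter limit. -/
theorem prodAtTop_le_cofinite : prodAtTop ≤ cofinite := by
  intro s hs
  rw [mem_cofinite] at hs
  obtain ⟨M, hM⟩ := (hs.image fun p : ℕ × ℕ => p.1 * p.2).bddAbove
  refine ⟨Set.Ioi M, Ioi_mem_atTop M, fun p hp => ?_⟩
  by_contra hcon
  exact absurd (hM (Set.mem_image_of_mem _ hcon)) (not_le.2 hp)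

/-- The Borel-Cantelli argument: summable fourth moments give almost sure convergence. -/
theorem ae_tendsto_cofinite_zero {ι Ω : Type*} [Countable ι] [MeasurableSpace Ω] {P : Measure Ω}
    {q : ι → Ω → ℝ} (hq : ∀ i, Measurable (q i)) {b c : ι → ℝ}
    (hb : ∀ i, ∫⁻ ω, ENNReal.ofReal (q i ω ^ 4) ∂P ≤ ENNReal.ofReal (b i))
    (hs : Summable fun i => c i ^ 4 * b i) :
    ∀ᵐ ω ∂P, Tendsto (fun i => c i * q i ω) cofinite (𝓝 0) := by
  have hc4 : ∀ i, 0 ≤ c i ^ 4 := fun i => by positivity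
  have hbound : ∀ i, ∫⁻ ω, ENNReal.ofReal ((c i * q i ω) ^ 4) ∂P ≤ ENNReal.ofReal (c i ^ 4 * b i) := by
    intro i
    simp_rw [mul_pow, ENNReal.ofReal_mul (hc4 i)]
    rw [lintegral_const_mul _ ((hq i).pow_const 4).ennreal_ofReal]
    gcongr
    exact hb i
  have hmeas : ∀ i, Measurable fun ω => ENNReal.ofReal ((c i * q i ω) ^ 4) :=
    fun i => (((hq i).const_mul _).pow_const 4).ennreal_ofReal
  -- By Tonelli the series of fourth powers has finite expectation, so it converges almost surely
  -- and its terms tend to zero.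
  have hfin : ∫⁻ ω, ∑' i, ENNReal.ofReal ((c i * q i ω) ^ 4) ∂P ≠ ⊤ := by
    rw [lintegral_tsum fun i => (hmeas i).aemeasurable]
    exact ne_top_of_le_ne_top hs.tsum_ofReal_ne_top (ENNReal.tsum_le_tsum hbound)
  filter_upwards [ae_lt_top' (Measurable.tsum hmeas).aemeasurable hfin] with ω hω
  have h1 := ENNReal.tendsto_cofinite_zero_of_tsum_ne_top hω.ne
  have h2 := (ENNReal.tendsto_toReal ENNReal.zero_ne_top).comp h1
  have h3 : Tendsto (fun i => (c i * q i ω) ^ 4) cofinite (𝓝 0) := by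
    refine h2.congr fun i => ?_
    simp only [Function.comp_apply]
    exact ENNReal.toReal_ofReal (by positivity)
  have h4 := (Real.continuous_sqrt.tendsto 0).comp ((Real.continuous_sqrt.tendsto' 0 0
    Real.sqrt_zero).comp h3)
  rw [Real.sqrt_zero] at h4
  rw [tendsto_zero_iff_abs_tendsto_zero]
  refine h4.congr fun i => ?_
  simp only [Function.comp_apply]
  rw [show (c i * q i ω) ^ 4 = ((c i * q i ω) ^ 2) ^ 2 by ring, Real.sqrt_sq (sq_nonneg _),
    Real.sqrt_sq_eq_abs]

/-- The common majorant of both fourth-moment series. The exponent `-3 / 2` is `2 * (5 / 4) - 4`;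
the exponent `-5 / 4` is what remains of `R ^ (-2)` after `R ^ (-3 / 4) ≤ N ^ (-3 / 2)` in the
regime `N² < R`. -/
theorem summable_pair_rpow :
    Summable fun p : ℕ × ℕ => (p.1 : ℝ) ^ (-(3 / 2) : ℝ) * (p.2 : ℝ) ^ (-(5 / 4) : ℝ) :=
  Summable.mul_of_nonneg (Real.summable_nat_rpow.2 (by norm_num))
    (Real.summable_nat_rpow.2 (by norm_num)) (fun n => Real.rpow_nonneg (Nat.cast_nonneg n) _)
    fun n => Real.rpow_nonneg (Nat.cast_nonneg n) _

/-- With `m` comparable to `x` and `y`, the bound is the relative error, whatever the scale. -/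
theorem abs_log_sub_log_le {x y m : ℝ} (hm : 0 < m) (hx : m ≤ x) (hy : m ≤ y) :
    |Real.log (1 + x) - Real.log (1 + y)| ≤ |x - y| / m := by
  have aux : ∀ a b : ℝ, m ≤ a → m ≤ b → Real.log (1 + a) - Real.log (1 + b) ≤ |a - b| / m := by
    intro a b ha hb
    have hb1 : 0 < 1 + b := by linarith
    have ha1 : 0 < 1 + a := by linarith
    rw [← Real.log_div ha1.ne' hb1.ne']
    have h1 := Real.log_le_sub_one_of_pos (div_pos ha1 hb1)
    have h2 : (1 + a) / (1 + b) - 1 = (a - b) / (1 + b) := by field_simp; ring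
    rw [h2] at h1
    refine h1.trans ?_
    calc (a - b) / (1 + b) ≤ |a - b| / (1 + b) := by gcongr; exact le_abs_self _
      _ ≤ |a - b| / m := by gcongr; linarith
  rw [abs_le]
  constructor
  · have := aux y x hy hx
    rw [abs_sub_comm] at this
    linarith
  · exact aux x y hx hy

theorem tendsto_log_one_add_mul_cube_div (g : ℝ) (hg : 0 ≤ g) :
    Tendsto (fun n : ℕ => Real.log (1 + g * (n : ℝ) ^ 3) / n) atTop (𝓝 0) := by
  have h1 : Tendsto (fun n : ℕ => Real.log (n : ℝ) / n) atTop (𝓝 0) := by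
    have := Real.isLittleO_log_id_atTop.tendsto_div_nhds_zero
    exact this.comp tendsto_natCast_atTop_atTop
  have h2 : Tendsto (fun n : ℕ => Real.log (1 + g) / (n : ℝ)) atTop (𝓝 0) :=
    tendsto_const_div_atTop_nhds_zero_nat _
  have h3 : Tendsto (fun n : ℕ => Real.log (1 + g) / (n : ℝ) + 3 * (Real.log (n : ℝ) / n)) atTop
      (𝓝 0) := by simpa using h2.add (h1.const_mul 3)
  refine squeeze_zero' (Eventually.of_forall fun n => ?_) ?_ h3
  · exact div_nonneg (Real.log_nonneg (by have : 0 ≤ g * (n : ℝ) ^ 3 := by positivity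
                                          linarith)) (Nat.cast_nonneg n)
  · filter_upwards [eventually_ge_atTop 1] with n hn
    have hn1 : (1 : ℝ) ≤ n := by exact_mod_cast hn
    have h4 : Real.log (1 + g * (n : ℝ) ^ 3) ≤ Real.log (1 + g) + 3 * Real.log n := by
      have e : Real.log (1 + g) + 3 * Real.log n = Real.log ((1 + g) * (n : ℝ) ^ 3) := by
        rw [Real.log_mul (by linarith) (by positivity), Real.log_pow]
        norm_num
      rw [e]
      refine Real.log_le_log (by positivity) ?_
      have : (1 : ℝ) ≤ (n : ℝ) ^ 3 := one_le_pow₀ hn1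
      linarith
    calc _ ≤ (Real.log (1 + g) + 3 * Real.log n) / n := by gcongr
      _ = _ := by ring

theorem eventually_prodAtTop {M : ℕ} : ∀ᶠ p : ℕ × ℕ in prodAtTop, M ≤ p.1 * p.2 :=
  tendsto_comap.eventually (eventually_ge_atTop M)

/-- The comparison of the rates: on pairs with few receive antennas the logarithms are negligible,
on pairs with many of them the relative error is. -/
theorem tendsto_rate_diff {γ τ s q D : ℕ × ℕ → ℝ} {g B : ℝ} (hg : 0 ≤ g)
    (hγ : ∀ p, 0 ≤ γ p) (hτ : ∀ p, 0 ≤ τ p) (hs : ∀ p, 0 ≤ s p)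
    (hγτ : ∀ p, |γ p - τ p| ≤ |q p| + D p) (hγs : ∀ p, γ p ≤ |q p| + s p)
    (hτs : ∀ p, τ p ≤ s p) (hsτ : ∀ p, s p - D p ≤ τ p)
    (hsg : ∀ p, s p ≤ g * (p.1 * p.2)) (hD : ∀ p, D p ≤ s p * Real.sqrt (B / p.2))
    (hq1 : Tendsto (fun p : ℕ × ℕ => 1 / ((p.1 : ℝ) * p.2) * q p) prodAtTop (𝓝 0))
    (hq2 : Tendsto (fun p : ℕ × ℕ => (if p.1 ^ 2 < p.2 then 1 / s p else 0) * q p)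
      prodAtTop (𝓝 0))
    (hq0 : ∀ p, s p = 0 → q p = 0) :
    Tendsto (fun p : ℕ × ℕ => 1 / (p.1 : ℝ) * (Real.log (1 + γ p) - Real.log (1 + τ p)))
      prodAtTop (𝓝 0) := by
  rw [Metric.tendsto_nhds]
  intro ε hε
  simp only [dist_zero_right, Real.norm_eq_abs]
  obtain ⟨N₀, hN₀⟩ := eventually_atTop.1 ((tendsto_log_one_add_mul_cube_div (1 + g)
    (by linarith)).eventually (gt_mem_nhds hε))
  -- With `|x - y| ≤ 2 δ σ` and `y ≥ σ - δ σ`, the bound `δ ≤ 1 / 6` keeps `x` and `y` above `σ /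
  -- 2`. The logarithms then differ by at most `4 δ`, which is below `ε` as `δ ≤ ε / 5`.
  set δ := min (1 / 6) (ε / 5) with hδ
  have hδ0 : 0 < δ := lt_min (by norm_num) (by linarith)
  have hδ1 : δ ≤ 1 / 6 := min_le_left _ _
  have hδ2 : δ ≤ ε / 5 := min_le_right _ _
  have hsq : Tendsto (fun n : ℕ => Real.sqrt (B / n)) atTop (𝓝 0) :=
    (Real.continuous_sqrt.tendsto' 0 0 Real.sqrt_zero).comp
      (tendsto_const_div_atTop_nhds_zero_nat B)
  obtain ⟨M₀, hM₀⟩ := eventually_atTop.1 (hsq.eventually (gt_mem_nhds hδ0))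
  have e1 : ∀ᶠ p : ℕ × ℕ in prodAtTop, |1 / ((p.1 : ℝ) * p.2) * q p| < 1 := by
    have := (Metric.tendsto_nhds.1 hq1) 1 one_pos
    simpa only [dist_zero_right, Real.norm_eq_abs] using this
  have e2 : ∀ᶠ p : ℕ × ℕ in prodAtTop, |(if p.1 ^ 2 < p.2 then 1 / s p else 0) * q p| < δ := by
    have := (Metric.tendsto_nhds.1 hq2) δ hδ0
    simpa only [dist_zero_right, Real.norm_eq_abs] using this
  -- The threshold forces the right variable to be large in each regime: `N² < R` gives `N R ≤ R²`,
  -- hence `R ≥ M₀`, and `R ≤ N²` gives `N R ≤ N³`, hence `N ≥ N₀`.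
  filter_upwards [e1, e2, eventually_prodAtTop (M := N₀ ^ 3 + M₀ ^ 2 + 1)] with p h1 h2 h3
  obtain ⟨N, R⟩ := p
  simp only at h1 h2 h3 ⊢
  have hNR : 0 < N * R := by omega
  have hN : 1 ≤ N := Nat.pos_of_mul_pos_right hNR
  have hR : 1 ≤ R := Nat.pos_of_mul_pos_left hNR
  have hNr : (1 : ℝ) ≤ N := by exact_mod_cast hN
  have hRr : (1 : ℝ) ≤ R := by exact_mod_cast hR
  set x := γ (N, R)
  set y := τ (N, R)
  set σ := s (N, R)
  set w := q (N, R)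
  have hx : 0 ≤ x := hγ _
  have hy : 0 ≤ y := hτ _
  have hσ : 0 ≤ σ := hs _
  by_cases hcase : N ^ 2 < R
  · rw [if_pos hcase] at h2
    have hN1 : |1 / (N : ℝ)| ≤ 1 := by
      rw [abs_of_nonneg (by positivity), div_le_one (by linarith)]; exact hNr
    rw [abs_mul]
    refine lt_of_le_of_lt (mul_le_of_le_one_left (abs_nonneg _) hN1) ?_
    have hMR : M₀ ≤ R := by
      by_contra hcon
      push Not at hcon
      have : N * R ≤ M₀ ^ 2 := by nlinarith
      have : 0 ≤ N₀ ^ 3 := Nat.zero_le _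
      omega
    have hDσ : D (N, R) ≤ δ * σ := by
      refine (hD (N, R)).trans ?_
      rw [mul_comm]
      exact mul_le_mul_of_nonneg_right (hM₀ R hMR).le hσ
    rcases hσ.eq_or_lt with h0 | hpos
    · have hw : w = 0 := hq0 _ h0.symm
      have h4 := hγτ (N, R)
      change |x - y| ≤ |w| + D (N, R) at h4
      rw [hw, abs_zero, zero_add] at h4
      rw [← h0, mul_zero] at hDσ
      have h5 : x - y = 0 := abs_nonpos_iff.1 (h4.trans hDσ)
      have h6 : x = y := sub_eq_zero.1 h5
      rw [h6, sub_self, abs_zero]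
      exact hε
    · have hw : |w| ≤ δ * σ := by
        rw [abs_mul, abs_of_pos (by positivity : 0 < 1 / σ), one_div, inv_mul_lt_iff₀ hpos] at h2
        linarith [mul_comm σ δ]
      have h4 : |x - y| ≤ |w| + D (N, R) := hγτ (N, R)
      have h4' : |x - y| ≤ 2 * δ * σ := by linarith
      have h5 : σ - D (N, R) ≤ y := hsτ (N, R)
      have hδσ : δ * σ ≤ 1 / 6 * σ := mul_le_mul_of_nonneg_right hδ1 hσ
      have hy2 : σ / 2 ≤ y := by linarith
      have hx2 : σ / 2 ≤ x := by
        have := (abs_le.1 h4').1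
        linarith
      refine lt_of_le_of_lt (abs_log_sub_log_le (by positivity) hx2 hy2) ?_
      have h6 : |x - y| / (σ / 2) ≤ 4 * δ := by
        rw [div_le_iff₀ (by positivity)]
        linarith
      linarith
  · push Not at hcase
    have hNN : N₀ ≤ N := by
      by_contra hcon
      push Not at hcon
      have h6 : N * R ≤ N ^ 3 := by
        calc N * R ≤ N * N ^ 2 := Nat.mul_le_mul_left _ hcase
          _ = N ^ 3 := by ring
      have h7 : N ^ 3 ≤ N₀ ^ 3 := Nat.pow_le_pow_left hcon.le 3
      have : 0 ≤ M₀ ^ 2 := Nat.zero_le _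
      omega
    have hcast : (R : ℝ) ≤ (N : ℝ) ^ 2 := by exact_mod_cast hcase
    have hNRc : (N : ℝ) * R ≤ (N : ℝ) ^ 3 := by
      calc (N : ℝ) * R ≤ N * (N : ℝ) ^ 2 := by gcongr
        _ = (N : ℝ) ^ 3 := by ring
    have hNRpos : (0 : ℝ) < N * R := by positivity
    have hw : |w| ≤ N * R := by
      rw [abs_mul, abs_of_pos (by positivity : 0 < 1 / ((N : ℝ) * R)), one_div,
        inv_mul_lt_iff₀ hNRpos, mul_one] at h1
      exact h1.le
    have hσg : σ ≤ g * (N * R) := hsg (N, R)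
    have hgN : g * ((N : ℝ) * R) ≤ g * (N : ℝ) ^ 3 := mul_le_mul_of_nonneg_left hNRc hg
    -- Both the fluctuation, at most `N R`, and the trace, at most `g N R`, are controlled by `N³`,
    -- so each logarithm is `O(log N)`.
    have hxb : x ≤ (1 + g) * (N : ℝ) ^ 3 := by
      have : x ≤ |w| + σ := hγs (N, R)
      linarith
    have hyb : y ≤ (1 + g) * (N : ℝ) ^ 3 := by
      have : y ≤ σ := hτs (N, R)
      have : (0 : ℝ) ≤ (N : ℝ) ^ 3 := by positivity
      linarith
    have lx : Real.log (1 + x) ≤ Real.log (1 + (1 + g) * (N : ℝ) ^ 3) :=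
      Real.log_le_log (by linarith) (by linarith)
    have ly : Real.log (1 + y) ≤ Real.log (1 + (1 + g) * (N : ℝ) ^ 3) :=
      Real.log_le_log (by linarith) (by linarith)
    have lx0 : 0 ≤ Real.log (1 + x) := Real.log_nonneg (by linarith)
    have ly0 : 0 ≤ Real.log (1 + y) := Real.log_nonneg (by linarith)
    have hdiff : |Real.log (1 + x) - Real.log (1 + y)| ≤ Real.log (1 + (1 + g) * (N : ℝ) ^ 3) := by
      rw [abs_le]; constructor <;> linarith
    rw [abs_mul, abs_of_nonneg (by positivity : 0 ≤ 1 / (N : ℝ)), one_div, inv_mul_eq_div]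
    exact lt_of_le_of_lt (by gcongr) (hN₀ N hNN)

end Limits

end DopplerMIMO

/-! ### SINR fluctuations, rank bounds and limits -/

namespace DopplerMIMO

open scoped ComplexOrder

set_option linter.unusedSectionVars false

/-- The resolvent `(H Hᴴ + 1)⁻¹` of the matrix `H` with entries `y`. -/
noncomputable def columnResolvent {n m : Type*} [Fintype n] [DecidableEq n] [Fintype m]
    (y : m × n → ℂ) : Matrix n n ℂ :=
  ((Matrix.of fun i l => y (l, i) : Matrix n m ℂ) *
    (Matrix.of fun i l => y (l, i) : Matrix n m ℂ)ᴴ + 1)⁻¹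

theorem continuous_columnResolvent {n m : Type*} [Fintype n] [DecidableEq n] [Fintype m] :
    Continuous (columnResolvent : (m × n → ℂ) → Matrix n n ℂ) := by
  have hH : Continuous fun y : m × n → ℂ => (Matrix.of fun i l => y (l, i) : Matrix n m ℂ) :=
    continuous_matrix fun i l => continuous_apply (l, i)
  have hM := (hH.matrix_mul hH.matrix_conjTranspose).add
    (continuous_const (y := (1 : Matrix n n ℂ)))
  rw [continuous_iff_continuousAt]
  intro y
  have hu := (Matrix.isUnit_iff_isUnit_det _).1 (Matrix.PosDef.one.posSemidef_add
    (Matrix.posSemidef_self_mul_conjTranspose (Matrix.of fun i l => y (l, i) : Matrix n m ℂ))).isUnit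
  refine ContinuousAt.comp (g := fun M : Matrix n n ℂ => M⁻¹) (continuousAt_matrix_inv _ ?_)
    hM.continuousAt
  simp only [Ring.inverse_eq_inv']
  exact continuousAt_inv₀ hu.ne_zero

namespace Params

variable {S : Params} {Ω : Type*} [MeasurableSpace Ω] {P : Measure Ω}
  {h : Fin S.NT → ℕ → ℕ → Ω → ℂ} {z : ℕ → ℕ → Ω → ℂ}

/-- The resolvent of the interference covariance. -/
noncomputable def interfResolvent (S : Params) (h : Fin S.NT → ℕ → ℕ → Ω → ℂ) (z : ℕ → ℕ → Ω → ℂ)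
    (N NR : ℕ) (t : Fin S.NT) (ω : Ω) : Matrix (Fin NR × Fin N) (Fin NR × Fin N) ℂ :=
  (S.HBreveMinus h z N NR t ω * (S.HBreveMinus h z N NR t ω)ᴴ + 1)⁻¹

/-- The fluctuation of the output SINR around `Tr (Q (B + 1)⁻¹)`. -/
noncomputable def sinrError (S : Params) (h : Fin S.NT → ℕ → ℕ → Ω → ℂ) (z : ℕ → ℕ → Ω → ℂ)
    (P : Measure Ω) (N NR : ℕ) (t : Fin S.NT) (ω : Ω) : ℝ :=
  S.gammaMMSE h z N NR t ω - (S.Phi h z P N NR t * S.interfResolvent h z N NR t ω).trace.re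

theorem sinrError_eq (hS : S.Valid) (hhz : S.IsChannel P h z) (N NR : ℕ) (t : Fin S.NT) (ω : Ω) :
    S.sinrError h z P N NR t ω =
      (star (fun i => S.hBreve h z N NR t ω i) ⬝ᵥ
        (columnResolvent (fun k : {l : Fin S.NT // l ≠ t} × (Fin NR × Fin N) =>
          S.hBreve h z N NR k.1 ω k.2) *ᵥ fun i => S.hBreve h z N NR t ω i)).re
      - (Matrix.of (fun i j => ((1 : Matrix (Fin NR) (Fin NR) ℂ) ⊗ₖ S.whiteCov N t) i j) *
        columnResolvent (fun k : {l : Fin S.NT // l ≠ t} × (Fin NR × Fin N) =>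
          S.hBreve h z N NR k.1 ω k.2)).trace.re := by
  rw [sinrError, gammaMMSE_eq hS hhz, Phi_eq hS hhz]
  rfl

theorem measurable_sinrError (hS : S.Valid) (hhz : S.IsChannel P h z) (N NR : ℕ) (t : Fin S.NT) :
    Measurable (S.sinrError h z P N NR t) := by
  have hX := isCSCGProcess_hBreve hS hhz N NR
  have hm : ∀ l i, Measurable fun ω => S.hBreve h z N NR l ω i := fun l i => hX.measurable (l, i)
  have hc := (continuous_quadraticForm_sub
    (Matrix.of (fun i j => ((1 : Matrix (Fin NR) (Fin NR) ℂ) ⊗ₖ S.whiteCov N t) i j))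
    (continuous_columnResolvent (n := Fin NR × Fin N) (m := {l : Fin S.NT // l ≠ t}))).measurable
  have := hc.comp ((measurable_pi_lambda (fun ω i => S.hBreve h z N NR t ω i) fun i => hm t i).prodMk
    (measurable_pi_lambda (fun ω (k : {l : Fin S.NT // l ≠ t} × (Fin NR × Fin N)) =>
      S.hBreve h z N NR k.1 ω k.2) fun k => hm k.1 k.2))
  convert this using 1
  ext ω
  exact sinrError_eq hS hhz N NR t ω

theorem fourth_moment_sinrError (hS : S.Valid) (hhz : S.IsChannel P h z) (N NR : ℕ)
    (t : Fin S.NT) :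
    ∫⁻ ω, ENNReal.ofReal (S.sinrError h z P N NR t ω ^ 4) ∂P ≤ ENNReal.ofReal
      (quadConst * (NR * (S.whiteCov N t * S.whiteCov N t).trace.re) ^ 2) := by
  have hX := isCSCGProcess_hBreve hS hhz N NR
  have h1 := (isCSCGProcess_hBreve_single hS hhz N NR t).fourth_moment_random_quadraticForm
    (Y := fun (k : {l : Fin S.NT // l ≠ t} × (Fin NR × Fin N)) ω => S.hBreve h z N NR k.1 ω k.2)
    (fun k => hX.measurable (k.1.1, k.2))
    -- The desired column is independent of the interfering ones because their covariances vanish in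
    -- the joint Gaussian process.
    (hX.indepFun (fun i => (t, i))
      (fun k : {l : Fin S.NT // l ≠ t} × (Fin NR × Fin N) => (k.1.1, k.2))
      fun i k => if_neg k.1.2.symm)
    continuous_columnResolvent
    (fun y => (resolvent_posDef (Matrix.posSemidef_self_mul_conjTranspose _)).posSemidef)
    (fun y => one_sub_resolvent_posSemidef (Matrix.posSemidef_self_mul_conjTranspose _))
  simp_rw [sinrError_eq hS hhz]
  refine h1.trans (le_of_eq ?_)
  rw [← trace_Phi_sq hS hhz N NR t, Phi_eq hS hhz]
  rfl

theorem interfResolvent_posDef (N NR : ℕ) (t : Fin S.NT) (ω : Ω) :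
    (S.interfResolvent h z N NR t ω).PosDef :=
  resolvent_posDef (Matrix.posSemidef_self_mul_conjTranspose _)

theorem card_ne_le (t : Fin S.NT) : (Fintype.card {l : Fin S.NT // l ≠ t} : ℝ) ≤ S.NT := by
  have := Fintype.card_subtype_le fun l : Fin S.NT => l ≠ t
  rw [Fintype.card_fin] at this
  exact_mod_cast this

/-- The bound on the effect of the finite rank interference on traces against `Φ`. -/
noncomputable def rankBound (S : Params) (N NR : ℕ) (t : Fin S.NT) : ℝ :=
  Real.sqrt (NR * (S.whiteCov N t * S.whiteCov N t).trace.re * S.NT)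

/-- Stated for any contraction close to the identity in trace, so that it applies both to the random
resolvent and to the deterministic `T`. The lower bound is Cauchy-Schwarz for `1 - A`. -/
theorem trace_Phi_mul_bounds (hS : S.Valid) (hhz : S.IsChannel P h z) {N NR : ℕ} {t : Fin S.NT}
    {A : Matrix (Fin NR × Fin N) (Fin NR × Fin N) ℂ} (hA : A.PosSemidef)
    (hA1 : (1 - A).PosSemidef) (hAr : (1 - A).trace.re ≤ S.NT) :
    0 ≤ (S.Phi h z P N NR t * A).trace.re ∧
    (S.Phi h z P N NR t * A).trace.re ≤ NR * (S.whiteCov N t).trace.re ∧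
    NR * (S.whiteCov N t).trace.re - S.rankBound N NR t ≤ (S.Phi h z P N NR t * A).trace.re := by
  have hΦ := Phi_posSemidef hS hhz N NR t
  have h1 := trace_mul_re_nonneg hΦ hA1
  have h2 := trace_mul_le_sqrt hΦ hA1 (by rwa [sub_sub_cancel]) hAr
  rw [mul_sub, mul_one, Matrix.trace_sub, Complex.sub_re, trace_Phi hS hhz] at h1 h2
  rw [trace_Phi_sq hS hhz] at h2
  refine ⟨trace_mul_re_nonneg hΦ hA, by linarith, ?_⟩
  unfold rankBound
  linarith

theorem interfResolvent_bounds (hS : S.Valid) (hhz : S.IsChannel P h z) (N NR : ℕ) (t : Fin S.NT)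
    (ω : Ω) :
    0 ≤ (S.Phi h z P N NR t * S.interfResolvent h z N NR t ω).trace.re ∧
    (S.Phi h z P N NR t * S.interfResolvent h z N NR t ω).trace.re
      ≤ NR * (S.whiteCov N t).trace.re ∧
    NR * (S.whiteCov N t).trace.re - S.rankBound N NR t
      ≤ (S.Phi h z P N NR t * S.interfResolvent h z N NR t ω).trace.re :=
  trace_Phi_mul_bounds hS hhz (interfResolvent_posDef N NR t ω).posSemidef
    (one_sub_resolvent_posSemidef (Matrix.posSemidef_self_mul_conjTranspose _))
    ((trace_one_sub_resolvent_le _).trans (card_ne_le t))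

/-- The complex equation also asserts that the trace is real, which is automatic for a product of
two positive semidefinite matrices. -/
theorem isFixedPoint_iff (hS : S.Valid) (hhz : S.IsChannel P h z) {N NR : ℕ} {t : Fin S.NT}
    {e : {l : Fin S.NT // l ≠ t} → ℝ} : S.IsFixedPoint h z P N NR t e ↔ (∀ l, 0 ≤ e l) ∧
      traceStep (fun l : {l : Fin S.NT // l ≠ t} => S.Phi h z P N NR l) e = e := by
  have hΦ : ∀ l : {l : Fin S.NT // l ≠ t}, (S.Phi h z P N NR l).PosSemidef :=
    fun l => Phi_posSemidef hS hhz N NR l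
  constructor
  · intro H
    refine ⟨fun l => (H l).1, funext fun l => ?_⟩
    have := congrArg Complex.re (H l).2
    rw [Complex.ofReal_re] at this
    exact this.symm
  · rintro ⟨h0, hf⟩ l
    refine ⟨h0 l, ?_⟩
    have h1 := ofReal_trace_mul_re (hΦ l) (resolventSum_posDef hΦ h0).posSemidef
    have h2 : (Matrix.trace (S.Phi h z P N NR l *
      resolventSum (fun l : {l : Fin S.NT // l ≠ t} => S.Phi h z P N NR l) e)).re = e l :=
      congrFun hf l
    rw [h2] at h1
    exact h1

theorem trQT_bounds (hS : S.Valid) (hhz : S.IsChannel P h z) {N NR : ℕ} {t : Fin S.NT}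
    {e : {l : Fin S.NT // l ≠ t} → ℝ} (he : S.IsFixedPoint h z P N NR t e) :
    0 ≤ S.trQT h z P N NR t e ∧
    S.trQT h z P N NR t e ≤ NR * (S.whiteCov N t).trace.re ∧
    NR * (S.whiteCov N t).trace.re - S.rankBound N NR t ≤ S.trQT h z P N NR t e := by
  obtain ⟨h0, hf⟩ := (isFixedPoint_iff hS hhz).1 he
  have hΦ : ∀ l : {l : Fin S.NT // l ≠ t}, (S.Phi h z P N NR l).PosSemidef :=
    fun l => Phi_posSemidef hS hhz N NR l
  exact trace_Phi_mul_bounds hS hhz (resolventSum_posDef hΦ h0).posSemidef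
    (one_sub_resolventSum_posSemidef hΦ h0)
    ((trace_one_sub_resolventSum_le hΦ h0 hf).trans (card_ne_le t))

theorem existsUnique_isFixedPoint (hS : S.Valid) (hhz : S.IsChannel P h z) (N NR : ℕ)
    (t : Fin S.NT) : ∃! e, S.IsFixedPoint h z P N NR t e := by
  have hΦ : ∀ l : {l : Fin S.NT // l ≠ t}, (S.Phi h z P N NR l).PosSemidef :=
    fun l => Phi_posSemidef hS hhz N NR l
  obtain ⟨e, h0, hf, -⟩ := exists_fixedPoint hΦ
  refine ⟨e, (isFixedPoint_iff hS hhz).2 ⟨h0, hf⟩, fun e' he' => ?_⟩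
  obtain ⟨h0', hf'⟩ := (isFixedPoint_iff hS hhz).1 he'
  exact le_antisymm (fixedPoint_le hΦ h0 h0' hf hf') (fixedPoint_le hΦ h0' h0 hf' hf)

theorem tendsto_iterate_fixedPointStep (hS : S.Valid) (hhz : S.IsChannel P h z) {N NR : ℕ}
    {t : Fin S.NT} {e : {l : Fin S.NT // l ≠ t} → ℝ} (he : S.IsFixedPoint h z P N NR t e) :
    Tendsto (fun j : ℕ => (S.fixedPointStep h z P N NR t)^[j] 0) atTop (𝓝 e) := by
  have hΦ : ∀ l : {l : Fin S.NT // l ≠ t}, (S.Phi h z P N NR l).PosSemidef :=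
    fun l => Phi_posSemidef hS hhz N NR l
  obtain ⟨e', h0, hf, hlim⟩ := exists_fixedPoint hΦ
  rw [(existsUnique_isFixedPoint hS hhz N NR t).unique he ((isFixedPoint_iff hS hhz).2 ⟨h0, hf⟩)]
  exact hlim

theorem trace_whiteCov_nonneg (hS : S.Valid) (hhz : S.IsChannel P h z) (N : ℕ) (t : Fin S.NT) :
    0 ≤ (S.whiteCov N t).trace.re :=
  (Complex.nonneg_iff.1 (whiteCov_posSemidef hS hhz N t).trace_nonneg).1

theorem trace_whiteCov_sq_nonneg (hS : S.Valid) (hhz : S.IsChannel P h z) (N : ℕ) (t : Fin S.NT) :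
    0 ≤ (S.whiteCov N t * S.whiteCov N t).trace.re :=
  trace_mul_self_nonneg (whiteCov_posSemidef hS hhz N t).1

/-- After division by `(N R)⁴` the fourth moment is of order `N ^ (5 / 2 - 4) * R ^ (2 - 4)`,
summable over all pairs. Pairs with a zero entry contribute nothing since `1 / 0 = 0`. -/
theorem ae_tendsto_sinrError_div (hS : S.Valid) (hhz : S.IsChannel P h z) (t : Fin S.NT) :
    ∀ᵐ ω ∂P, Tendsto (fun p : ℕ × ℕ => 1 / ((p.1 : ℝ) * p.2) * S.sinrError h z P p.1 p.2 t ω)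
      prodAtTop (𝓝 0) := by
  obtain ⟨c, hc0, hc⟩ := exists_trace_whiteCov_sq_le hS hhz
  have hsum : Summable fun p : ℕ × ℕ => (1 / ((p.1 : ℝ) * p.2)) ^ 4 *
      (quadConst * (p.2 * (S.whiteCov p.1 t * S.whiteCov p.1 t).trace.re) ^ 2) := by
    refine Summable.of_nonneg_of_le
      (fun p => mul_nonneg (by positivity) (mul_nonneg quadConst_nonneg (sq_nonneg _))) (fun p => ?_)
      (summable_pair_rpow.mul_left (quadConst * c ^ 2))
    obtain ⟨N, R⟩ := p
    simp only
    rcases Nat.eq_zero_or_pos N with rfl | hN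
    · have := quadConst_nonneg
      simp
    rcases Nat.eq_zero_or_pos R with rfl | hR
    · simp
    have hNr : (1 : ℝ) ≤ N := by exact_mod_cast hN
    have hRr : (1 : ℝ) ≤ R := by exact_mod_cast hR
    have hN0 : (0 : ℝ) < N := by linarith
    have hR0 : (0 : ℝ) < R := by linarith
    have hF := hc N t
    have hF0 := trace_whiteCov_sq_nonneg hS hhz N t
    set F := (S.whiteCov N t * S.whiteCov N t).trace.re
    have e1 : (1 / ((N : ℝ) * R)) ^ 4 * (quadConst * (R * F) ^ 2)
        = quadConst * (F ^ 2 * ((N : ℝ) ^ 4)⁻¹) * ((R : ℝ) ^ 2)⁻¹ := by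
      field_simp
    have e2 : (c * (N * (N : ℝ) ^ (1 / 4 : ℝ))) ^ 2 * ((N : ℝ) ^ 4)⁻¹
        = c ^ 2 * (N : ℝ) ^ (-(3 / 2) : ℝ) := by
      rw [mul_pow, mul_assoc]
      congr 1
      rw [mul_pow, ← Real.rpow_natCast ((N : ℝ) ^ (1 / 4 : ℝ)), ← Real.rpow_mul hN0.le,
        ← Real.rpow_natCast (N : ℝ) 2, ← Real.rpow_natCast (N : ℝ) 4, ← Real.rpow_neg hN0.le,
        ← Real.rpow_add hN0, ← Real.rpow_add hN0]
      norm_num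
    have e3 : ((R : ℝ) ^ 2)⁻¹ ≤ (R : ℝ) ^ (-(5 / 4) : ℝ) := by
      rw [← Real.rpow_natCast, ← Real.rpow_neg hR0.le]
      exact Real.rpow_le_rpow_of_exponent_le hRr (by norm_num)
    have hq := quadConst_nonneg
    calc _ = _ := e1
      _ ≤ quadConst * ((c * (N * (N : ℝ) ^ (1 / 4 : ℝ))) ^ 2 * ((N : ℝ) ^ 4)⁻¹)
          * (R : ℝ) ^ (-(5 / 4) : ℝ) := by gcongr
      _ = _ := by rw [e2]; ring
  filter_upwards [ae_tendsto_cofinite_zero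
    (q := fun p : ℕ × ℕ => S.sinrError h z P p.1 p.2 t)
    (fun p => measurable_sinrError hS hhz p.1 p.2 t)
    (fun p => fourth_moment_sinrError hS hhz p.1 p.2 t) hsum] with ω hω
  exact hω.mono_left prodAtTop_le_cofinite

/-- No lower bound on `Tr Q` is used, so the error is measured against `Tr Q` itself. Since `Tr C² ≤
(Tr C)²` for one block `C`, the normalized fourth moment is at most a constant times `R ^ (-2)`, and
the restriction to `N² < R` makes the double series converge. -/
theorem ae_tendsto_sinrError_relative (hS : S.Valid) (hhz : S.IsChannel P h z) (t : Fin S.NT) :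
    ∀ᵐ ω ∂P, Tendsto (fun p : ℕ × ℕ =>
      (if p.1 ^ 2 < p.2 then 1 / (p.2 * (S.whiteCov p.1 t).trace.re) else 0) *
        S.sinrError h z P p.1 p.2 t ω) prodAtTop (𝓝 0) := by
  have hq := quadConst_nonneg
  have hsum : Summable fun p : ℕ × ℕ =>
      (if p.1 ^ 2 < p.2 then 1 / (p.2 * (S.whiteCov p.1 t).trace.re) else 0) ^ 4 *
      (quadConst * (p.2 * (S.whiteCov p.1 t * S.whiteCov p.1 t).trace.re) ^ 2) := by
    refine Summable.of_nonneg_of_le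
      (fun p => mul_nonneg (by positivity) (mul_nonneg quadConst_nonneg (sq_nonneg _))) (fun p => ?_)
      (summable_pair_rpow.mul_left quadConst)
    obtain ⟨N, R⟩ := p
    simp only
    have hrhs : 0 ≤ quadConst * ((N : ℝ) ^ (-(3 / 2) : ℝ) * (R : ℝ) ^ (-(5 / 4) : ℝ)) := by
      positivity
    split_ifs with hlt
    swap
    · simpa using hrhs
    have hF := trace_mul_self_le_sq_trace (whiteCov_posSemidef hS hhz N t)
    have hF0 := trace_whiteCov_sq_nonneg hS hhz N t
    have hs0 := trace_whiteCov_nonneg hS hhz N t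
    rcases Nat.eq_zero_or_pos N with rfl | hN
    · have : (S.whiteCov 0 t).trace = 0 := by simp [Matrix.trace]
      rw [this]
      simp
    set F := (S.whiteCov N t * S.whiteCov N t).trace.re
    set s := (S.whiteCov N t).trace.re
    rcases hs0.eq_or_lt with h0 | hpos
    · rw [← h0]
      simpa using hrhs
    have hR : 0 < R := by omega
    have hNr : (1 : ℝ) ≤ N := by exact_mod_cast hN
    have hRr : (1 : ℝ) ≤ R := by exact_mod_cast hR
    have hN0 : (0 : ℝ) < N := by linarith
    have hR0 : (0 : ℝ) < R := by linarith
    have hNR : (N : ℝ) ^ 2 ≤ R := by exact_mod_cast hlt.le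
    have e1 : (1 / ((R : ℝ) * s)) ^ 4 * (quadConst * (R * F) ^ 2)
        ≤ (1 / ((R : ℝ) * s)) ^ 4 * (quadConst * (R * s ^ 2) ^ 2) := by gcongr
    have e2 : (1 / ((R : ℝ) * s)) ^ 4 * (quadConst * (R * s ^ 2) ^ 2)
        = quadConst * ((R : ℝ) ^ 2)⁻¹ := by field_simp
    have e3 : ((R : ℝ) ^ 2)⁻¹ = (R : ℝ) ^ (-(3 / 4) : ℝ) * (R : ℝ) ^ (-(5 / 4) : ℝ) := by
      rw [← Real.rpow_natCast, ← Real.rpow_neg hR0.le, ← Real.rpow_add hR0]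
      norm_num
    have e4 : (R : ℝ) ^ (-(3 / 4) : ℝ) ≤ (N : ℝ) ^ (-(3 / 2) : ℝ) := by
      calc (R : ℝ) ^ (-(3 / 4) : ℝ) ≤ ((N : ℝ) ^ 2) ^ (-(3 / 4) : ℝ) :=
            Real.rpow_le_rpow_of_nonpos (by positivity) hNR (by norm_num)
        _ = (N : ℝ) ^ (-(3 / 2) : ℝ) := by
            rw [← Real.rpow_natCast, ← Real.rpow_mul hN0.le]
            norm_num
    refine e1.trans (e2.trans_le ?_)
    rw [e3]
    gcongr
  filter_upwards [ae_tendsto_cofinite_zero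
    (q := fun p : ℕ × ℕ => S.sinrError h z P p.1 p.2 t)
    (fun p => measurable_sinrError hS hhz p.1 p.2 t)
    (fun p => fourth_moment_sinrError hS hhz p.1 p.2 t) hsum] with ω hω
  exact hω.mono_left prodAtTop_le_cofinite

/-- The degenerate pairs, where the relative error is meaningless: `Tr Q = 0` forces a zero fourth
moment. Countability of the pairs gives one exceptional null set. -/
theorem ae_sinrError_eq_zero (hS : S.Valid) (hhz : S.IsChannel P h z) (t : Fin S.NT) :
    ∀ᵐ ω ∂P, ∀ p : ℕ × ℕ, (p.2 : ℝ) * (S.whiteCov p.1 t).trace.re = 0 →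
      S.sinrError h z P p.1 p.2 t ω = 0 := by
  rw [ae_all_iff]
  rintro ⟨N, R⟩
  by_cases h0 : (R : ℝ) * (S.whiteCov N t).trace.re = 0
  swap
  · exact Eventually.of_forall fun ω hω => absurd hω h0
  have hF := trace_mul_self_le_sq_trace (whiteCov_posSemidef hS hhz N t)
  have hF0 := trace_whiteCov_sq_nonneg hS hhz N t
  have hV : (R : ℝ) * (S.whiteCov N t * S.whiteCov N t).trace.re = 0 := by
    rcases mul_eq_zero.1 h0 with h1 | h1
    · rw [h1, zero_mul]
    · rw [h1] at hF
      rw [le_antisymm (by simpa using hF) hF0, mul_zero]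
  have h4 := fourth_moment_sinrError hS hhz N R t
  rw [hV] at h4
  simp only [ne_eq, OfNat.ofNat_ne_zero, not_false_eq_true, zero_pow, mul_zero,
    ENNReal.ofReal_zero, nonpos_iff_eq_zero] at h4
  rw [lintegral_eq_zero_iff ((measurable_sinrError hS hhz N R t).pow_const 4).ennreal_ofReal] at h4
  filter_upwards [h4] with ω hω _
  have h5 : S.sinrError h z P N R t ω ^ 4 ≤ 0 := ENNReal.ofReal_eq_zero.1 hω
  exact pow_eq_zero_iff (n := 4) (by norm_num) |>.1 (le_antisymm h5 (by positivity))

/-- The bound is of order `(R * N ^ (5 / 4)) ^ (1 / 2) ≤ (N R) ^ (5 / 8)`, so division by `N R`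
leaves `(N R) ^ (-3 / 8)`. -/
theorem tendsto_rankBound (hS : S.Valid) (hhz : S.IsChannel P h z) (t : Fin S.NT) :
    Tendsto (fun p : ℕ × ℕ => 1 / ((p.1 : ℝ) * p.2) * S.rankBound p.1 p.2 t) prodAtTop (𝓝 0) := by
  obtain ⟨c, hc0, hc⟩ := exists_trace_whiteCov_sq_le hS hhz
  have hlim : Tendsto (fun p : ℕ × ℕ => Real.sqrt (c * S.NT) *
      ((p.1 * p.2 : ℕ) : ℝ) ^ (-(3 / 8) : ℝ)) prodAtTop (𝓝 0) := by
    have h1 : Tendsto (fun n : ℕ => Real.sqrt (c * S.NT) * (n : ℝ) ^ (-(3 / 8) : ℝ)) atTop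
        (𝓝 0) := by
      have := ((tendsto_rpow_neg_atTop (by norm_num : (0 : ℝ) < 3 / 8)).comp
        tendsto_natCast_atTop_atTop).const_mul (Real.sqrt (c * S.NT))
      simpa using this
    exact h1.comp tendsto_comap
  refine squeeze_zero' (Eventually.of_forall fun p =>
    mul_nonneg (by positivity) (Real.sqrt_nonneg _)) ?_ hlim
  filter_upwards [eventually_prodAtTop (M := 1)] with p hp
  obtain ⟨N, R⟩ := p
  simp only at hp ⊢
  have hN : (1 : ℝ) ≤ N := by exact_mod_cast Nat.pos_of_mul_pos_right hp
  have hR : (1 : ℝ) ≤ R := by exact_mod_cast Nat.pos_of_mul_pos_left hp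
  have hx : (0 : ℝ) < N * R := by positivity
  have h1 : (R : ℝ) * (S.whiteCov N t * S.whiteCov N t).trace.re * S.NT
      ≤ c * S.NT * ((N : ℝ) * R) ^ (5 / 4 : ℝ) := by
    have h2 : (R : ℝ) * (N * (N : ℝ) ^ (1 / 4 : ℝ)) ≤ ((N : ℝ) * R) ^ (5 / 4 : ℝ) := by
      have h3 : ((N : ℝ) * R) ^ (5 / 4 : ℝ) = (N * R) * (N * R) ^ (1 / 4 : ℝ) := by
        rw [show (5 / 4 : ℝ) = 1 + 1 / 4 by norm_num, Real.rpow_add hx, Real.rpow_one]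
      rw [h3]
      have h4 : (N : ℝ) ^ (1 / 4 : ℝ) ≤ (N * R) ^ (1 / 4 : ℝ) :=
        Real.rpow_le_rpow (by linarith) (by nlinarith) (by norm_num)
      calc (R : ℝ) * (N * (N : ℝ) ^ (1 / 4 : ℝ)) = N * R * (N : ℝ) ^ (1 / 4 : ℝ) := by ring
        _ ≤ _ := by gcongr
    calc (R : ℝ) * (S.whiteCov N t * S.whiteCov N t).trace.re * S.NT
        ≤ R * (c * (N * (N : ℝ) ^ (1 / 4 : ℝ))) * S.NT := by gcongr; exact hc N t
      _ = c * S.NT * (R * (N * (N : ℝ) ^ (1 / 4 : ℝ))) := by ring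
      _ ≤ _ := by gcongr
  have h5 : S.rankBound N R t ≤ Real.sqrt (c * S.NT) * ((N : ℝ) * R) ^ (5 / 8 : ℝ) := by
    unfold rankBound
    refine (Real.sqrt_le_sqrt h1).trans (le_of_eq ?_)
    rw [Real.sqrt_mul (by positivity), Real.sqrt_eq_rpow (((N : ℝ) * R) ^ (5 / 4 : ℝ)),
      ← Real.rpow_mul hx.le]
    norm_num
  have h6 : 1 / ((N : ℝ) * R) * ((N : ℝ) * R) ^ (5 / 8 : ℝ) = ((N : ℝ) * R) ^ (-(3 / 8) : ℝ) := by
    rw [one_div, ← Real.rpow_neg_one, ← Real.rpow_add hx]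
    norm_num
  push_cast
  calc _ ≤ 1 / ((N : ℝ) * R) * (Real.sqrt (c * S.NT) * ((N : ℝ) * R) ^ (5 / 8 : ℝ)) := by gcongr
    _ = Real.sqrt (c * S.NT) * (1 / ((N : ℝ) * R) * ((N : ℝ) * R) ^ (5 / 8 : ℝ)) := by ring
    _ = _ := by rw [h6]

/-- The relative form of the rank bound, from `Tr C² ≤ (Tr C)²`; it is useful when `NR` is large and
involves no decay of `J₀`. -/
theorem rankBound_le (hS : S.Valid) (hhz : S.IsChannel P h z) (N NR : ℕ) (t : Fin S.NT) :
    S.rankBound N NR t ≤ NR * (S.whiteCov N t).trace.re * Real.sqrt (S.NT / NR) := by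
  have hF := trace_mul_self_le_sq_trace (whiteCov_posSemidef hS hhz N t)
  have hs0 := trace_whiteCov_nonneg hS hhz N t
  unfold rankBound
  rcases Nat.eq_zero_or_pos NR with rfl | hR
  · simp
  have hR0 : (0 : ℝ) < NR := by exact_mod_cast hR
  set s := (S.whiteCov N t).trace.re
  calc _ ≤ Real.sqrt ((NR * s) ^ 2 * (S.NT / NR)) := by
        apply Real.sqrt_le_sqrt
        calc (NR : ℝ) * (S.whiteCov N t * S.whiteCov N t).trace.re * S.NT
            ≤ NR * s ^ 2 * S.NT := by gcongr
          _ = (NR * s) ^ 2 * (S.NT / NR) := by field_simp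
    _ = _ := by rw [Real.sqrt_mul (sq_nonneg _), Real.sqrt_sq (by positivity)]

theorem gammaMMSE_nonneg (hS : S.Valid) (hhz : S.IsChannel P h z) (N NR : ℕ) (t : Fin S.NT)
    (ω : Ω) : 0 ≤ S.gammaMMSE h z N NR t ω := by
  rw [gammaMMSE_eq hS hhz]
  exact (interfResolvent_posDef N NR t ω).posSemidef.re_dotProduct_nonneg _

/-- Both traces lie in the same interval of length `rankBound`, so the comparison holds for every
`ω`. -/
theorem abs_trace_sub_trQT_le (hS : S.Valid) (hhz : S.IsChannel P h z) {N NR : ℕ} {t : Fin S.NT}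
    {e : {l : Fin S.NT // l ≠ t} → ℝ} (he : S.IsFixedPoint h z P N NR t e) (ω : Ω) :
    |(S.Phi h z P N NR t * S.interfResolvent h z N NR t ω).trace.re - S.trQT h z P N NR t e|
      ≤ S.rankBound N NR t := by
  have h1 := interfResolvent_bounds hS hhz N NR t ω
  have h2 := trQT_bounds hS hhz he
  rw [abs_le]
  constructor <;> linarith [h1.2.1, h1.2.2, h2.2.1, h2.2.2]

theorem gammaMMSE_sub_mBQ (N NR : ℕ) (t : Fin S.NT) (ω : Ω) :
    (1 / ((N : ℝ) * NR)) * S.gammaMMSE h z N NR t ω - S.mBQ h z P N NR t ω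
      = 1 / ((N : ℝ) * NR) * S.sinrError h z P N NR t ω := by
  rw [sinrError, mul_sub]
  rfl

theorem tendsto_mBQ_sub (hS : S.Valid) (hhz : S.IsChannel P h z)
    {e : (N NR : ℕ) → (t : Fin S.NT) → {l : Fin S.NT // l ≠ t} → ℝ}
    (he : ∀ N NR t, S.IsFixedPoint h z P N NR t (e N NR t)) (t : Fin S.NT) (ω : Ω) :
    Tendsto (fun p : ℕ × ℕ => S.mBQ h z P p.1 p.2 t ω
      - (1 / ((p.1 : ℝ) * p.2)) * S.trQT h z P p.1 p.2 t (e p.1 p.2 t)) prodAtTop (𝓝 0) := by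
  refine squeeze_zero_norm (fun p => ?_) (tendsto_rankBound hS hhz t)
  have h1 := abs_trace_sub_trQT_le hS hhz (he p.1 p.2 t) ω
  have h2 : S.mBQ h z P p.1 p.2 t ω
      - (1 / ((p.1 : ℝ) * p.2)) * S.trQT h z P p.1 p.2 t (e p.1 p.2 t)
      = 1 / ((p.1 : ℝ) * p.2) * ((S.Phi h z P p.1 p.2 t *
        S.interfResolvent h z p.1 p.2 t ω).trace.re - S.trQT h z P p.1 p.2 t (e p.1 p.2 t)) := by
    rw [mul_sub]
    rfl
  rw [h2, Real.norm_eq_abs, abs_mul, abs_of_nonneg (by positivity : 0 ≤ 1 / ((p.1 : ℝ) * p.2))]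
  gcongr

/-- `tendsto_rate_diff` is applied with `s = Tr Q`, `q` the SINR fluctuation and `D` the rank bound.
-/
theorem ae_tendsto_log_diff (hS : S.Valid) (hhz : S.IsChannel P h z)
    {e : (N NR : ℕ) → (t : Fin S.NT) → {l : Fin S.NT // l ≠ t} → ℝ}
    (he : ∀ N NR t, S.IsFixedPoint h z P N NR t (e N NR t)) (t : Fin S.NT) :
    ∀ᵐ ω ∂P, Tendsto (fun p : ℕ × ℕ => 1 / (p.1 : ℝ) *
      (Real.log (1 + S.gammaMMSE h z p.1 p.2 t ω)
        - Real.log (1 + S.trQT h z P p.1 p.2 t (e p.1 p.2 t)))) prodAtTop (𝓝 0) := by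
  filter_upwards [ae_tendsto_sinrError_div hS hhz t, ae_tendsto_sinrError_relative hS hhz t,
    ae_sinrError_eq_zero hS hhz t] with ω h1 h2 h3
  have hb := fun p : ℕ × ℕ => trQT_bounds hS hhz (he p.1 p.2 t)
  have ha := fun p : ℕ × ℕ => interfResolvent_bounds hS hhz p.1 p.2 t ω
  have hγ : ∀ p : ℕ × ℕ, S.gammaMMSE h z p.1 p.2 t ω = S.sinrError h z P p.1 p.2 t ω
      + (S.Phi h z P p.1 p.2 t * S.interfResolvent h z p.1 p.2 t ω).trace.re := fun p => by
    rw [sinrError, sub_add_cancel]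
  refine tendsto_rate_diff (s := fun p => (p.2 : ℝ) * (S.whiteCov p.1 t).trace.re)
    (q := fun p => S.sinrError h z P p.1 p.2 t ω) (D := fun p => S.rankBound p.1 p.2 t)
    (B := S.NT) (gammaC_pos hS).le (fun p => gammaMMSE_nonneg hS hhz p.1 p.2 t ω)
    (fun p => (hb p).1) (fun p => mul_nonneg (Nat.cast_nonneg _) (trace_whiteCov_nonneg hS hhz _ t))
    (fun p => ?_) (fun p => ?_) (fun p => (hb p).2.1) (fun p => (hb p).2.2) (fun p => ?_)
    (fun p => rankBound_le hS hhz p.1 p.2 t) h1 h2 h3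
  · rw [hγ, add_sub_assoc]
    exact (abs_add_le _ _).trans (add_le_add le_rfl (abs_trace_sub_trQT_le hS hhz (he p.1 p.2 t) ω))
  · rw [hγ]
    exact add_le_add (le_abs_self _) (ha p).2.1
  · have := mul_le_mul_of_nonneg_left (trace_whiteCov_le hS hhz p.1 t) (Nat.cast_nonneg (α := ℝ) p.2)
    linarith

end Params

end DopplerMIMO

/-! ### Assembly -/

theorem mainTheorem6 (S : DopplerMIMO.Params) (hS : S.Valid)
    {Ω : Type*} [MeasurableSpace Ω] (P : Measure Ω) [IsProbabilityMeasure P]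
    (h : Fin S.NT → ℕ → ℕ → Ω → ℂ) (z : ℕ → ℕ → Ω → ℂ) (hhz : S.IsChannel P h z) :
    (∀ (N NR : ℕ) (t : Fin S.NT), ∃! e, S.IsFixedPoint h z P N NR t e) ∧
    ∀ e : (N NR : ℕ) → (t : Fin S.NT) → {l : Fin S.NT // l ≠ t} → ℝ,
      (∀ N NR t, S.IsFixedPoint h z P N NR t (e N NR t)) →
      (∀ N NR t, Tendsto (fun j : ℕ => (S.fixedPointStep h z P N NR t)^[j] 0) atTop
        (𝓝 (e N NR t))) ∧
      (∀ t, ∀ᵐ ω ∂P, Tendsto (fun p : ℕ × ℕ =>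
        (1 / ((p.1 : ℝ) * p.2)) * S.gammaMMSE h z p.1 p.2 t ω - S.mBQ h z P p.1 p.2 t ω)
        DopplerMIMO.prodAtTop (𝓝 0)) ∧
      (∀ t, ∀ᵐ ω ∂P, Tendsto (fun p : ℕ × ℕ =>
        S.mBQ h z P p.1 p.2 t ω
          - (1 / ((p.1 : ℝ) * p.2)) * S.trQT h z P p.1 p.2 t (e p.1 p.2 t))
        DopplerMIMO.prodAtTop (𝓝 0)) ∧
      (∀ t, ∀ᵐ ω ∂P, Tendsto (fun p : ℕ × ℕ =>
        (1 / ((p.1 : ℝ) * p.2)) * S.gammaMMSE h z p.1 p.2 t ω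
          - (1 / ((p.1 : ℝ) * p.2)) * S.trQT h z P p.1 p.2 t (e p.1 p.2 t))
        DopplerMIMO.prodAtTop (𝓝 0)) ∧
      (∀ᵐ ω ∂P, Tendsto (fun p : ℕ × ℕ =>
        S.rateMMSE h z p.1 p.2 ω
          - (1 / (p.1 : ℝ)) * ∑ t, Real.logb 2 (1 + S.trQT h z P p.1 p.2 t (e p.1 p.2 t)))
        DopplerMIMO.prodAtTop (𝓝 0)) := by
  refine ⟨fun N NR t => DopplerMIMO.Params.existsUnique_isFixedPoint hS hhz N NR t,
    fun e he => ?_⟩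
  have hA : ∀ t, ∀ᵐ ω ∂P, Tendsto (fun p : ℕ × ℕ =>
      (1 / ((p.1 : ℝ) * p.2)) * S.gammaMMSE h z p.1 p.2 t ω - S.mBQ h z P p.1 p.2 t ω)
      DopplerMIMO.prodAtTop (𝓝 0) := by
    intro t
    filter_upwards [DopplerMIMO.Params.ae_tendsto_sinrError_div hS hhz t] with ω hω
    simpa only [DopplerMIMO.Params.gammaMMSE_sub_mBQ] using hω
  have hB := fun t ω => DopplerMIMO.Params.tendsto_mBQ_sub hS hhz he t ω
  refine ⟨fun N NR t => DopplerMIMO.Params.tendsto_iterate_fixedPointStep hS hhz (he N NR t), hA,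
    fun t => Eventually.of_forall (hB t), fun t => ?_, ?_⟩
  · filter_upwards [hA t] with ω hω
    have := hω.add (hB t ω)
    simpa only [sub_add_sub_cancel, add_zero] using this
  · have hC := ae_all_iff.2 fun t => DopplerMIMO.Params.ae_tendsto_log_diff hS hhz he t
    filter_upwards [hC] with ω hω
    -- The sum over `t` has a fixed finite number of terms, so the limits add up; division by `log
    -- 2` passes to base-two logarithms.
    have hsum := (tendsto_finsetSum Finset.univ fun t _ => hω t).div_const (Real.log 2)
    simp only [Finset.sum_const_zero, zero_div] at hsum
    refine hsum.congr fun p => ?_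
    rw [DopplerMIMO.Params.rateMMSE, ← mul_sub, ← Finset.sum_sub_distrib, ← Finset.mul_sum,
      mul_div_assoc, Finset.sum_div]
    congr 1
    refine Finset.sum_congr rfl fun t _ => ?_
    rw [Real.logb, Real.logb, sub_div]
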